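/- **Model.** Time is $t\in\mathbf R_+=[0,\infty)$ and $r>0$ is a discount rate. The frontiers $F^0,F^1:[0,\infty)\to[-\infty,\infty)$ are concave and upper semi-continuous, with unique peaks $u^0,u^1$ respectively (i.e. $F^j(u)<F^j(u^j)$ for all $u\neq u^j$), where $0\le u^1<u^0$; moreover $F^0$ is finite on $(0,u^0]$ and $F^1\ge F^0$. Put $F^1(\infty):=-\infty$. A *mechanism* is a pair $(x^0,X^1)$ where $x^0:\mathbf R_+\to\mathbf R_+$ (the pre-disclosure flow) is Lebesgue-measurable and $X^1:\mathbf R_+\to[0,\infty]$ (the disclosure reward) is a function. It is *incentive-compatible (IC)* if for every $t\ge 0$ $$X^1_t\ \ge\ r\int_t^{t+d}e^{-r(s-t)}x^0_s\,ds+e^{-rd}X^1_{t+d}\quad\text{for all } d>0,\qquad X^1_t\ \ge\ r\int_t^\infty e^{-r(s-t)}x^0_s\,ds .$$ For a distribution (Borel probability measure) $G$ on $\mathbf R_+$ of the breakthrough time $\tau$, the principal's payoff is $$\Pi_G(x^0,X^1)=\mathbf E_{\tau\sim G}\Big(r\int_0^\tau e^{-rt}F^0(x^0_t)\,dt+e^{-r\tau}F^1(X^1_\tau)\Big)\in[-\infty,\infty).$$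 An IC mechanism *dominates* another if it yields a weakly higher payoff $\Pi_G$ for every distribution $G$ and a strictly higher one for some $G$. An IC mechanism is *undominated* if no IC mechanism dominates it, and it is *optimal for $G$* if it maximises $\Pi_G$ among IC mechanisms and is undominated. **Theorem.** Suppose that $F^0$ is strictly concave on its effective domain $\{F^0>-\infty\}$. Let $G,G^\dagger$ be distributions on $\mathbf R_+$ that are absolutely continuous with respect to Lebesgue measure and have equal, unbounded support. Suppose that $G$ MLR-dominates $G^\dagger$, i.e. the ratio $g/g^\dagger$ of (versions of) their densities is increasing on the support, in the sense that $g(s)\,g^\dagger(t)\le g(t)\,g^\dagger(s)$ for all $s\le t$ in the support. If the mechanism $(x,X)$ is optimal for $G$ and the mechanism $(x^\dagger,X^\dagger)$ is optimal for $G^\dagger$, then $$X_t\ \ge\ X^\dagger_t\qquad\text{for every } t\ge 0 .$$ -/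

import Mathlib

open MeasureTheory Set
open scoped NNReal ENNReal

noncomputable section

namespace Breakthrough

/-- The Lebesgue integral of an extended-real function: integral of the positive part minus
integral of the negative part. It is used only for functions that are bounded above and measures
that are finite, so that the positive part always has a finite integral. -/
def erealIntegral (μ : Measure ℝ) (f : ℝ → EReal) : EReal :=
  ((∫⁻ t, (f t).toENNReal ∂μ : ℝ≥0∞) : EReal) - ((∫⁻ t, (-f t).toENNReal ∂μ : ℝ≥0∞) : EReal)

/-- Concavity of a utility possibility frontier `[0,∞) → [-∞,∞)`. -/
def IsConcave (F : ℝ≥0 → EReal) : Prop :=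
  ∀ u v a b : ℝ≥0, a + b = 1 →
    ((a : ℝ) : EReal) * F u + ((b : ℝ) : EReal) * F v ≤ F (a * u + b * v)

/-- Strict concavity of a frontier, on its effective domain `{u | F u > -∞}`. -/
def IsStrictlyConcave (F : ℝ≥0 → EReal) : Prop :=
  ∀ u v a b : ℝ≥0, F u ≠ ⊥ → F v ≠ ⊥ → u ≠ v → 0 < a → 0 < b → a + b = 1 →
    ((a : ℝ) : EReal) * F u + ((b : ℝ) : EReal) * F v < F (a * u + b * v)

/-- A concave, upper semi-continuous frontier `[0,∞) → [-∞,∞)` with unique peak `p`. -/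
structure IsFrontier (F : ℝ≥0 → EReal) (p : ℝ≥0) : Prop where
  lt_top : ∀ u, F u < ⊤
  concave : IsConcave F
  usc : UpperSemicontinuous F
  peak : ∀ u, u ≠ p → F u < F p

/-- The standing assumptions on the old frontier `F0` (with peak `u0`) and the new frontier `F1`
(with peak `u1`), including the conflict of interest `u1 < u0`. -/
structure IsTechnology (F0 F1 : ℝ≥0 → EReal) (u0 u1 : ℝ≥0) : Prop where
  frontier0 : IsFrontier F0 u0
  frontier1 : IsFrontier F1 u1
  u0_pos : 0 < u0
  finite0 : ∀ u, 0 < u → u ≤ u0 → ⊥ < F0 u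
  le : ∀ u, F0 u ≤ F1 u
  conflict : u1 < u0

/-- A mechanism: a Lebesgue-measurable pre-disclosure utility flow `x⁰` and a disclosure reward `X¹`.
Times are the nonnegative reals; the values at negative times play no role. -/
structure Mechanism where
  flow : ℝ → ℝ≥0
  measurable_flow : AEMeasurable flow volume
  reward : ℝ → ℝ≥0∞

/-- `r ∫_S e^{-r(s-t)} x_s ds`, the period-`t` value of the flow `x` over the set `S` of times. -/
def flowValue (r : ℝ) (x : ℝ → ℝ≥0) (t : ℝ) (S : Set ℝ) : ℝ≥0∞ :=
  ∫⁻ s in S, ENNReal.ofReal (r * Real.exp (-r * (s - t))) * (x s : ℝ≥0∞)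

/-- Incentive-compatibility: prompt disclosure is at least as good as (a) disclosing with a delay
`d` and (b) never disclosing. -/
def IsIC (r : ℝ) (m : Mechanism) : Prop :=
  ∀ t : ℝ, 0 ≤ t →
    (∀ d : ℝ, 0 < d →
      flowValue r m.flow t (Ioo t (t + d))
        + ENNReal.ofReal (Real.exp (-r * d)) * m.reward (t + d) ≤ m.reward t) ∧
    flowValue r m.flow t (Ioi t) ≤ m.reward t

/-- The upper semi-continuous extension of a frontier to `[0,∞]`, with value `-∞` at `∞`. -/
def extendFrontier (F : ℝ≥0 → EReal) (X : ℝ≥0∞) : EReal :=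
  if X = ⊤ then ⊥ else F X.toNNReal

/-- Distributions of the breakthrough time: probability measures on `[0,∞)`. -/
def IsDistribution (G : Measure ℝ) : Prop :=
  IsProbabilityMeasure G ∧ G (Iio 0) = 0

/-- The principal's payoff
`Π_G(x⁰,X¹) = E_G( r ∫_0^τ e^{-rt} F⁰(x⁰_t) dt + e^{-rτ} F¹(X¹_τ) ) ∈ [-∞,∞)`. -/
def payoff (r : ℝ) (F0 F1 : ℝ≥0 → EReal) (G : Measure ℝ) (m : Mechanism) : EReal :=
  erealIntegral G fun τ =>
    erealIntegral (volume.restrict (Ioo 0 τ))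
        (fun t => ((r * Real.exp (-r * t) : ℝ) : EReal) * F0 (m.flow t))
      + ((Real.exp (-r * τ) : ℝ) : EReal) * extendFrontier F1 (m.reward τ)

/-- `m` dominates `m'`: weakly better for every distribution, strictly better for some. -/
def Dominates (r : ℝ) (F0 F1 : ℝ≥0 → EReal) (m m' : Mechanism) : Prop :=
  (∀ G : Measure ℝ, IsDistribution G → payoff r F0 F1 G m' ≤ payoff r F0 F1 G m) ∧
    ∃ G : Measure ℝ, IsDistribution G ∧ payoff r F0 F1 G m' < payoff r F0 F1 G m

/-- An IC mechanism is undominated iff no IC mechanism dominates it. -/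
def IsUndominated (r : ℝ) (F0 F1 : ℝ≥0 → EReal) (m : Mechanism) : Prop :=
  IsIC r m ∧ ∀ m' : Mechanism, IsIC r m' → ¬ Dominates r F0 F1 m' m

/-- An IC mechanism is optimal for `G` iff it maximises `Π_G` among IC mechanisms and is
undominated. -/
def IsOptimal (r : ℝ) (F0 F1 : ℝ≥0 → EReal) (G : Measure ℝ) (m : Mechanism) : Prop :=
  IsUndominated r F0 F1 m ∧
    ∀ m' : Mechanism, IsIC r m' → payoff r F0 F1 G m' ≤ payoff r F0 F1 G m

/-- `G` MLR-dominates `G'`: for some versions `g`, `g'` of their Lebesgue densities, the ratio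
`g / g'` is increasing on the support. The monotonicity of the ratio is written in
cross-multiplied form, so that it also makes sense where a density vanishes. -/
def MLRDominates (G G' : Measure ℝ) : Prop :=
  ∃ g g' : ℝ → ℝ≥0, Measurable g ∧ Measurable g' ∧
    G = volume.withDensity (fun t => (g t : ℝ≥0∞)) ∧
    G' = volume.withDensity (fun t => (g' t : ℝ≥0∞)) ∧
    ∀ s ∈ G.support ∪ G'.support, ∀ t ∈ G.support ∪ G'.support, s ≤ t →
      g s * g' t ≤ g t * g' s

end Breakthrough

end

/-!
An optimal mechanism keeps the agent indifferent at all times: its flow `x` stays in `[0, u⁰]` and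
its reward is the value `X_t = r ∫_t^∞ e^{-r(s-t)} x_s ds` of never disclosing. Indeed, given the
flow, the rewards can be moved towards the peak of `F¹` down to the least promise that is
incentive-compatible, and if that promise still exceeded `X_t`, then the flow could be raised
towards the peak of `F⁰`. So `x` maximises a concave functional of the flow alone.

Replacing `x`, on an interval at whose ends `X = m`, by the constant flow `m` shows that `X` is
decreasing. Moving a unit of discounted consumption from just before `t₁` to just before `t₂` gives
the first-order condition
`F⁰'(x_{t₂}) G[t₂,∞) - F⁰'(x_{t₁}) G[t₁,∞) + ∫_{[t₁,t₂)} F¹'(X_τ) dG(τ) ≤ 0`,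
and first of all that `x` is decreasing as well. If `X < X†` somewhere, then `X < X†` throughout
some `[t₁, t₂]` with `x < x†` at `t₂` and with `x† < x` at `t₁` or `t₁ = 0`. Both first-order
conditions then hold with the same increasing secant slope `c` between `X` and `X†` in place of
`F¹'`, the one for `G†` with the reverse sign. Conditionally on `[t₁,∞)`, the distribution `G` is
the later one, so the inequality for `G†` carries over to `G`, where strict concavity of `F⁰` makes
it contradict the inequality for `G`.
-/

noncomputable section

namespace Breakthrough

open Filter
open Real (exp)

/-! ### One-sided density points -/

lemma ae_forall_Ioi_of_forall_Ioo {a : ℝ} {p : ℝ → Prop}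
    (h : ∀ b, ∀ᵐ t, t ∈ Ioo a b → p t) : ∀ᵐ t, a < t → p t := by
  filter_upwards [ae_all_iff.2 fun n : ℕ => h n] with t ht hat
  obtain ⟨n, hn⟩ := exists_nat_gt t
  exact ht n ⟨hat, hn⟩

/-- `S` has positive Lebesgue measure immediately to the left of `t`. Such points `t` are where the
flow of a mechanism can be perturbed on a set of times concentrated near `t`. -/
def HasLeftMass (S : Set ℝ) (t : ℝ) : Prop := ∀ s < t, 0 < volume (S ∩ Ioo s t)

-- Lebesgue's density theorem, with the intervals `[s, t]` shrinking to `t` from the left.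
lemma ae_hasLeftMass (S : Set ℝ) : ∀ᵐ t, t ∈ S → HasLeftMass S t := by
  refine ae_imp_of_ae_restrict ?_
  filter_upwards [(IsUnifLocDoublingMeasure.vitaliFamily volume 1).ae_tendsto_measure_inter_div S]
    with t ht s hs
  have hdense := (ht.comp (Real.tendsto_Icc_vitaliFamily_left t)).eventually_const_lt one_pos
  obtain ⟨y, hy, hsy⟩ := (hdense.and (Ioo_mem_nhdsLT hs)).exists
  have hpos : 0 < volume (S ∩ Icc y t) := (ENNReal.div_pos_iff.1 hy).1.bot_lt
  refine hpos.trans_le ((measure_mono_ae ?_).trans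
    (measure_mono (inter_subset_inter_right S (Ioo_subset_Ioo_left hsy.1.le))))
  exact (ae_eq_refl S).inter Ioo_ae_eq_Icc.symm |>.le

namespace HasLeftMass

variable {S T : Set ℝ} {s t : ℝ}

lemma mono (h : HasLeftMass S t) (hST : S ⊆ T) : HasLeftMass T t :=
  fun s hs => (h s hs).trans_le (measure_mono (by gcongr))

lemma exists_mem (h : HasLeftMass S t) (hs : s < t) {p : ℝ → Prop} (hp : ∀ᵐ u, p u) :
    ∃ u ∈ Ioo s t, u ∈ S ∧ p u := by
  obtain ⟨u, ⟨huS, hu⟩, hpu⟩ :=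
    ((frequently_ae_mem_iff.2 (h s hs).ne').and_eventually hp).exists
  exact ⟨u, hu, huS, hpu⟩

lemma exists_lt (h : HasLeftMass S t) (hs : s < t) : ∃ u ∈ Ioo s t, HasLeftMass S u := by
  obtain ⟨u, hu, huS, hL⟩ := h.exists_mem hs (ae_hasLeftMass S)
  exact ⟨u, hu, hL huS⟩

end HasLeftMass

lemma exists_separated_hasLeftMass {x y : ℝ → ℝ} {a b : ℝ}
    (h : ¬ ∀ᵐ t, t ∈ Ioo a b → y t ≤ x t) :
    ∃ v w t, v < w ∧ t ∈ Ioo a b ∧ HasLeftMass {t | x t ≤ v ∧ w ≤ y t} t := by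
  by_contra! hcon
  refine h ?_
  filter_upwards [ae_all_iff.2 fun p : ℚ × ℚ =>
    ae_hasLeftMass {t | x t ≤ p.1 ∧ (p.2 : ℝ) ≤ y t}] with t ht htab
  by_contra! hlt
  obtain ⟨v, hxv, hvy⟩ := exists_rat_btwn hlt
  obtain ⟨w, hvw, hwy⟩ := exists_rat_btwn hvy
  exact hcon v w t (by exact_mod_cast hvw) htab (ht (v, w) ⟨hxv.le, hwy.le⟩)

lemma exists_measureReal_Ico_lt (G : Measure ℝ) [IsFiniteMeasure G] {a b e : ℝ} (hab : a < b)
    (he : 0 < e) : ∃ s ∈ Ioo a b, G.real (Ico s b) < e := by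
  have hlim := tendsto_measure_biInter_gt (μ := G) (s := fun d : ℝ => Ico (b - d) b) (a := 0)
    (fun d _ => measurableSet_Ico.nullMeasurableSet)
    (fun c d _ hcd => Ico_subset_Ico_left (sub_le_sub_left hcd b)) ⟨1, one_pos, measure_ne_top _ _⟩
  have hempty : ⋂ d > (0 : ℝ), Ico (b - d) b = ∅ := by
    refine eq_empty_of_forall_notMem fun u hu => ?_
    simp only [mem_iInter] at hu
    have hub : u < b := (hu 1 one_pos).2
    linarith [(hu ((b - u) / 2) (by linarith)).1]
  rw [hempty, measure_empty] at hlim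
  obtain ⟨d, hd, hdab⟩ := ((hlim.eventually_lt_const (ENNReal.ofReal_pos.2 he)).and
    (Ioo_mem_nhdsGT (sub_pos.2 hab))).exists
  exact ⟨b - d, ⟨by linarith [hdab.2], by linarith [hdab.1]⟩,
    (ENNReal.lt_ofReal_iff_toReal_lt (measure_ne_top _ _)).1 hd⟩

lemma measureReal_Ici_eq_add (G : Measure ℝ) [IsFiniteMeasure G] {s t : ℝ} (hst : s ≤ t) :
    G.real (Ici s) = G.real (Ico s t) + G.real (Ici t) := by
  rw [← Ico_union_Ici_eq_Ici hst, measureReal_union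
    ((Iio_disjoint_Ici le_rfl).mono_left Ico_subset_Iio_self) measurableSet_Ici]

/-! ### Discounted values of flows -/

/-- Bounded measurable real functions: the class of flows and of perturbations of flows, for which
all discounted integrals converge. -/
structure IsBoundedMeasurable {α : Type*} [MeasurableSpace α] (x : α → ℝ) : Prop where
  measurable : Measurable x
  bounded : ∃ C, ∀ t, |x t| ≤ C

namespace IsBoundedMeasurable

variable {α : Type*} [MeasurableSpace α] {x y : α → ℝ}

lemma const (c : ℝ) : IsBoundedMeasurable fun _ : α => c :=
  ⟨measurable_const, |c|, fun _ => le_rfl⟩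

lemma of_mem_Icc (hx : Measurable x) {a b : ℝ} (h : ∀ t, x t ∈ Icc a b) :
    IsBoundedMeasurable x :=
  ⟨hx, max |a| |b|, fun t => abs_le_max_abs_abs (h t).1 (h t).2⟩

lemma add (hx : IsBoundedMeasurable x) (hy : IsBoundedMeasurable y) :
    IsBoundedMeasurable fun t => x t + y t := by
  obtain ⟨hx, C, hC⟩ := hx
  obtain ⟨hy, D, hD⟩ := hy
  exact ⟨hx.add hy, C + D, fun t => (abs_add_le _ _).trans (add_le_add (hC t) (hD t))⟩

lemma mul (hx : IsBoundedMeasurable x) (hy : IsBoundedMeasurable y) :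
    IsBoundedMeasurable fun t => x t * y t := by
  obtain ⟨hx, C, hC⟩ := hx
  obtain ⟨hy, D, hD⟩ := hy
  refine ⟨hx.mul hy, C * D, fun t => ?_⟩
  rw [abs_mul]
  exact mul_le_mul (hC t) (hD t) (abs_nonneg _) ((abs_nonneg _).trans (hC t))

lemma const_mul (c : ℝ) (hx : IsBoundedMeasurable x) : IsBoundedMeasurable fun t => c * x t :=
  (const c).mul hx

lemma sub (hx : IsBoundedMeasurable x) (hy : IsBoundedMeasurable y) :
    IsBoundedMeasurable fun t => x t - y t := by
  simpa only [neg_one_mul, sub_eq_add_neg] using hx.add (hy.const_mul (-1))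

lemma indicator (hx : IsBoundedMeasurable x) {S : Set α} (hS : MeasurableSet S) :
    IsBoundedMeasurable (S.indicator x) := by
  obtain ⟨hx, C, hC⟩ := hx
  exact ⟨hx.indicator hS, C, fun t => (norm_indicator_le_norm_self x t).trans (hC t)⟩

lemma integrable (hx : IsBoundedMeasurable x) (G : Measure α) [IsFiniteMeasure G] :
    Integrable x G :=
  let ⟨hx, C, hC⟩ := hx
  Integrable.of_bound hx.aestronglyMeasurable C (.of_forall hC)

end IsBoundedMeasurable

/-- The value at time `0` of the flow `x` over `(t,∞)`. -/
def tailValue (r : ℝ) (x : ℝ → ℝ) (t : ℝ) : ℝ := ∫ s in Ioi t, r * exp (-r * s) * x s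

/-- The value at time `t` of the flow `x` over `(t,∞)`: the disclosure reward `X¹_t` at which the
second incentive constraint binds. -/
def promisedValue (r : ℝ) (x : ℝ → ℝ) (t : ℝ) : ℝ := exp (r * t) * tailValue r x t

section Value

variable {r : ℝ} {x y : ℝ → ℝ}

lemma exp_mul_exp_neg (r t : ℝ) : exp (r * t) * exp (-r * t) = 1 := by
  rw [← Real.exp_add, neg_mul, add_neg_cancel, Real.exp_zero]

lemma discount_pos (hr : 0 < r) (s : ℝ) : 0 < r * exp (-r * s) := by positivity

lemma integrableOn_discount_Ioi (hr : 0 < r) (t : ℝ) :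
    IntegrableOn (fun s => r * exp (-r * s)) (Ioi t) :=
  (integrableOn_exp_mul_Ioi (by linarith) t).const_mul r

lemma integral_discount_Ioi (hr : 0 < r) (t : ℝ) :
    ∫ s in Ioi t, r * exp (-r * s) = exp (-r * t) := by
  rw [integral_const_mul, integral_exp_mul_Ioi (by linarith)]
  field_simp

lemma IsBoundedMeasurable.integrableOn_Ioi (hr : 0 < r) (hx : IsBoundedMeasurable x) (t : ℝ) :
    IntegrableOn (fun s => r * exp (-r * s) * x s) (Ioi t) :=
  let ⟨hx, C, hC⟩ := hx
  (integrableOn_discount_Ioi hr t).mul_bdd (c := C) hx.aestronglyMeasurable (.of_forall hC)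

lemma IsBoundedMeasurable.intervalIntegrable (hr : 0 < r) (hx : IsBoundedMeasurable x) (s t : ℝ) :
    IntervalIntegrable (fun s => r * exp (-r * s) * x s) volume s t :=
  intervalIntegrable_iff.2 ((hx.integrableOn_Ioi hr (min s t)).mono_set fun _ hu => hu.1)

lemma setIntegral_Ioo_eq_tailValue_sub (hr : 0 < r) (hx : IsBoundedMeasurable x) {s t : ℝ}
    (hst : s ≤ t) :
    ∫ u in Ioo s t, r * exp (-r * u) * x u = tailValue r x s - tailValue r x t := by
  rw [eq_sub_iff_add_eq, tailValue, tailValue, ← integral_Ioc_eq_integral_Ioo,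
    ← setIntegral_union (Ioc_disjoint_Ioi le_rfl) measurableSet_Ioi
      ((hx.integrableOn_Ioi hr s).mono_set Ioc_subset_Ioi_self) (hx.integrableOn_Ioi hr t),
    Ioc_union_Ioi_eq_Ioi hst]

/-- The value at time `0` of the flow `x` over `(0,t)`. -/
def headValue (r : ℝ) (x : ℝ → ℝ) (t : ℝ) : ℝ := ∫ s in Ioo 0 t, r * exp (-r * s) * x s

lemma headValue_eq (hr : 0 < r) (hx : IsBoundedMeasurable x) {t : ℝ} (ht : 0 ≤ t) :
    headValue r x t = tailValue r x 0 - tailValue r x t :=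
  setIntegral_Ioo_eq_tailValue_sub hr hx ht

lemma headValue_nonneg (hr : 0 < r) (hx : ∀ t, 0 ≤ x t) (t : ℝ) : 0 ≤ headValue r x t :=
  integral_nonneg fun s => mul_nonneg (discount_pos hr s).le (hx s)

lemma tailValue_const_mul (c t : ℝ) :
    tailValue r (fun s => c * x s) t = c * tailValue r x t := by
  rw [tailValue, tailValue, ← integral_const_mul]
  exact integral_congr_ae (.of_forall fun s => mul_left_comm _ _ _)

lemma tailValue_const (hr : 0 < r) (c t : ℝ) :
    tailValue r (fun _ => c) t = c * exp (-r * t) := by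
  rw [tailValue, integral_mul_const, integral_discount_Ioi hr, mul_comm]

lemma tailValue_add (hr : 0 < r) (hx : IsBoundedMeasurable x) (hy : IsBoundedMeasurable y)
    (t : ℝ) : tailValue r (fun s => x s + y s) t = tailValue r x t + tailValue r y t := by
  simp only [tailValue, mul_add]
  exact integral_add (hx.integrableOn_Ioi hr t) (hy.integrableOn_Ioi hr t)

lemma tailValue_sub (hr : 0 < r) (hx : IsBoundedMeasurable x) (hy : IsBoundedMeasurable y)
    (t : ℝ) : tailValue r (fun s => x s - y s) t = tailValue r x t - tailValue r y t := by
  simp only [tailValue, mul_sub]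
  exact integral_sub (hx.integrableOn_Ioi hr t) (hy.integrableOn_Ioi hr t)

lemma tailValue_congr_ae {t : ℝ} (h : ∀ᵐ s, t < s → x s = y s) :
    tailValue r x t = tailValue r y t := by
  refine setIntegral_congr_ae measurableSet_Ioi ?_
  filter_upwards [h] with s hs hst
  rw [hs hst]

lemma promisedValue_congr_ae {t : ℝ} (h : ∀ᵐ s, t < s → x s = y s) :
    promisedValue r x t = promisedValue r y t := by
  rw [promisedValue, promisedValue, tailValue_congr_ae h]

lemma tailValue_mono (hr : 0 < r) (hx : IsBoundedMeasurable x) (hy : IsBoundedMeasurable y)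
    {t : ℝ} (h : ∀ᵐ s, t < s → x s ≤ y s) : tailValue r x t ≤ tailValue r y t := by
  refine setIntegral_mono_on_ae (hx.integrableOn_Ioi hr t) (hy.integrableOn_Ioi hr t)
    measurableSet_Ioi ?_
  filter_upwards [h] with s hs hst
  exact mul_le_mul_of_nonneg_left (hs hst) (discount_pos hr s).le

lemma tailValue_sub_le_of_ae_le (hr : 0 < r) (hx : IsBoundedMeasurable x)
    (hy : IsBoundedMeasurable y) {s t : ℝ} (hst : s ≤ t)
    (h : ∀ᵐ u, u ∈ Ioo s t → x u ≤ y u) :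
    tailValue r x s - tailValue r x t ≤ tailValue r y s - tailValue r y t := by
  rw [← setIntegral_Ioo_eq_tailValue_sub hr hx hst, ← setIntegral_Ioo_eq_tailValue_sub hr hy hst]
  refine setIntegral_mono_on_ae ((hx.integrableOn_Ioi hr s).mono_set Ioo_subset_Ioi_self)
    ((hy.integrableOn_Ioi hr s).mono_set Ioo_subset_Ioi_self) measurableSet_Ioo ?_
  filter_upwards [h] with u hu hust
  exact mul_le_mul_of_nonneg_left (hu hust) (discount_pos hr u).le

lemma mul_exp_lt_tailValue (hr : 0 < r) (hx : IsBoundedMeasurable x) {t c : ℝ}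
    (h : ∀ᵐ s, t < s → c < x s) : c * exp (-r * t) < tailValue r x t := by
  have hc := IsBoundedMeasurable.const (α := ℝ) c
  rw [← sub_pos, ← tailValue_const hr, ← tailValue_sub hr hx hc]
  have hpos : ∀ᵐ s, s ∈ Ioi t → 0 < r * exp (-r * s) * (x s - c) := by
    filter_upwards [h] with s hs hst
    exact mul_pos (discount_pos hr s) (sub_pos.2 (hs hst))
  refine (setIntegral_pos_iff_support_of_nonneg_ae
    ((ae_restrict_iff' measurableSet_Ioi).2 (hpos.mono fun s hs hst => (hs hst).le))
    ((hx.sub hc).integrableOn_Ioi hr t)).2 ?_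
  refine (measure_pos_of_superset (s := Ioi t) le_rfl (by simp)).trans_le (measure_mono_ae ?_)
  filter_upwards [hpos] with s hs hst using ⟨(hs hst).ne', hst⟩

lemma abs_tailValue_le (hr : 0 < r) (hx : IsBoundedMeasurable x) {C : ℝ} (hC : ∀ t, |x t| ≤ C)
    (t : ℝ) : |tailValue r x t| ≤ C * exp (-r * t) := by
  have hle := fun s => abs_le.1 (hC s)
  rw [abs_le, ← neg_mul, ← tailValue_const hr, ← tailValue_const hr]
  exact ⟨tailValue_mono hr (.const _) hx (.of_forall fun s _ => (hle s).1),
    tailValue_mono hr hx (.const _) (.of_forall fun s _ => (hle s).2)⟩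

lemma tendsto_tailValue (hr : 0 < r) (hx : IsBoundedMeasurable x) :
    Tendsto (tailValue r x) atTop (nhds 0) := by
  obtain ⟨C, hC⟩ := hx.bounded
  have hexp : Tendsto (fun t => C * exp (-r * t)) atTop (nhds 0) := by
    simpa only [mul_zero, Function.comp_def, id] using (Real.tendsto_exp_atBot.comp
      (tendsto_id.const_mul_atTop_of_neg (neg_lt_zero.2 hr))).const_mul C
  exact squeeze_zero_norm (abs_tailValue_le hr hx hC) hexp

lemma continuous_tailValue (hr : 0 < r) (hx : IsBoundedMeasurable x) :
    Continuous (tailValue r x) := by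
  have hprimitive : tailValue r x =
      fun t => tailValue r x 0 - ∫ s in (0 : ℝ)..t, r * exp (-r * s) * x s := by
    ext t
    rcases le_total 0 t with h | h
    · rw [intervalIntegral.integral_of_le h, integral_Ioc_eq_integral_Ioo,
        setIntegral_Ioo_eq_tailValue_sub hr hx h, sub_sub_cancel]
    · rw [intervalIntegral.integral_of_ge h, integral_Ioc_eq_integral_Ioo,
        setIntegral_Ioo_eq_tailValue_sub hr hx h, sub_neg_eq_add, add_sub_cancel]
  rw [hprimitive]
  exact continuous_const.sub (intervalIntegral.continuous_primitive (hx.intervalIntegrable hr) 0)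

lemma IsBoundedMeasurable.headValue (hr : 0 < r) (hx : IsBoundedMeasurable x) :
    IsBoundedMeasurable (headValue r x) := by
  obtain ⟨C, hC⟩ := hx.bounded
  have hC0 : 0 ≤ C := (abs_nonneg _).trans (hC 0)
  have heq : Breakthrough.headValue r x = fun t => tailValue r x 0 - tailValue r x (max 0 t) := by
    ext t
    rcases le_total 0 t with ht | ht
    · rw [max_eq_right ht, headValue_eq hr hx ht]
    · rw [max_eq_left ht, Breakthrough.headValue, Ioo_eq_empty ht.not_gt, Measure.restrict_empty,
        integral_zero_measure, sub_self]
  have hbound : ∀ t, 0 ≤ t → |tailValue r x t| ≤ C := fun t ht =>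
    (abs_tailValue_le hr hx hC t).trans (mul_le_of_le_one_right hC0
      (Real.exp_le_one_iff.2 (by nlinarith)))
  have hcont := continuous_tailValue hr hx
  rw [heq]
  exact ⟨by fun_prop, C + C, fun t => (abs_sub _ _).trans
    (add_le_add (hbound 0 le_rfl) (hbound _ (le_max_left 0 t)))⟩

lemma tailValue_eq_exp_mul_promisedValue (t : ℝ) :
    tailValue r x t = exp (-r * t) * promisedValue r x t := by
  rw [promisedValue, ← mul_assoc, mul_comm (exp _), exp_mul_exp_neg, one_mul]

lemma continuous_promisedValue (hr : 0 < r) (hx : IsBoundedMeasurable x) :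
    Continuous (promisedValue r x) :=
  (Real.continuous_exp.comp (continuous_const_mul r)).mul (continuous_tailValue hr hx)

lemma IsBoundedMeasurable.promisedValue (hr : 0 < r) (hx : IsBoundedMeasurable x) :
    IsBoundedMeasurable (promisedValue r x) := by
  obtain ⟨C, hC⟩ := hx.bounded
  refine ⟨(continuous_promisedValue hr hx).measurable, C, fun t => ?_⟩
  rw [Breakthrough.promisedValue, abs_mul, Real.abs_exp]
  calc exp (r * t) * |tailValue r x t| ≤ exp (r * t) * (C * exp (-r * t)) := by
        gcongr; exact abs_tailValue_le hr hx hC t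
    _ = C := by rw [mul_left_comm, exp_mul_exp_neg, mul_one]

lemma tailValue_indicator {J : Set ℝ} (hJ : MeasurableSet J) (u : ℝ) :
    tailValue r (J.indicator x) u = ∫ s in Ioi u ∩ J, r * exp (-r * s) * x s := by
  rw [tailValue, ← setIntegral_indicator hJ]
  exact integral_congr_ae (.of_forall fun s => (indicator_mul_right J
    (fun s => r * exp (-r * s)) x).symm)

lemma tailValue_indicator_Ioi (a u : ℝ) :
    tailValue r ((Ioi a).indicator x) u = tailValue r x (max a u) := by
  rw [tailValue_indicator measurableSet_Ioi, Ioi_inter_Ioi, max_comm, tailValue]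

lemma tailValue_indicator_Ioo (hr : 0 < r) (hx : IsBoundedMeasurable x) (a b u : ℝ) :
    tailValue r ((Ioo a b).indicator x) u
      = tailValue r x (min (max a u) b) - tailValue r x b := by
  rw [← setIntegral_Ioo_eq_tailValue_sub hr hx (min_le_right _ _),
    tailValue_indicator measurableSet_Ioo, inter_comm, Ioo_inter_Ioi]
  rcases le_total (max a u) b with h | h
  · rw [min_eq_left h]
  · rw [min_eq_right h, Ioo_eq_empty h.not_gt, Ioo_self]

lemma ae_le_of_tailValue_sub_le (hr : 0 < r) (hx : IsBoundedMeasurable x)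
    (hy : IsBoundedMeasurable y) {a b : ℝ} (h : ∀ s t, a < s → s < t → t < b →
      tailValue r x s - tailValue r x t ≤ tailValue r y s - tailValue r y t) :
    ∀ᵐ t, t ∈ Ioo a b → x t ≤ y t := by
  have hd := hy.sub hx
  have hinc : ∀ s t, a < s → s < t → t < b →
      0 ≤ ∫ u in s..t, r * exp (-r * u) * (y u - x u) := by
    intro s t has hst htb
    rw [intervalIntegral.integral_of_le hst.le, integral_Ioc_eq_integral_Ioo,
      setIntegral_Ioo_eq_tailValue_sub hr hd hst.le, tailValue_sub hr hy hx, tailValue_sub hr hy hx]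
    linarith [h s t has hst htb]
  filter_upwards [IntervalIntegrable.ae_hasDerivAt_integral (hd.intervalIntegrable hr a b)]
    with t ht htab
  have htmem : t ∈ uIcc a b := Icc_subset_uIcc (Ioo_subset_Icc_self htab)
  have hderiv : 0 ≤ r * exp (-r * t) * (y t - x t) := by
    refine ge_of_tendsto (ht htmem t htmem).tendsto_slope_zero_right ?_
    filter_upwards [Ioo_mem_nhdsGT (sub_pos.2 htab.2)] with e he
    rw [intervalIntegral.integral_same, sub_zero, smul_eq_mul]
    exact mul_nonneg (inv_nonneg.2 he.1.le)
      (hinc t (t + e) htab.1 (by linarith [he.1]) (by linarith [he.2]))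
  exact sub_nonneg.1 (nonneg_of_mul_nonneg_right hderiv (discount_pos hr t))

/-- The flow `x` with its values during `J` replaced by the constant `m`. It is written as a
perturbation of `x`, which is how its value is computed. -/
def flatten (J : Set ℝ) (m : ℝ) (x : ℝ → ℝ) : ℝ → ℝ :=
  fun s => x s + J.indicator (fun s => m - x s) s

lemma flatten_of_mem {J : Set ℝ} {m s : ℝ} (hs : s ∈ J) : flatten J m x s = m := by
  rw [flatten, indicator_of_mem hs, add_sub_cancel]

lemma flatten_of_notMem {J : Set ℝ} {m s : ℝ} (hs : s ∉ J) : flatten J m x s = x s := by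
  rw [flatten, indicator_of_notMem hs, add_zero]

lemma IsBoundedMeasurable.flatten (hx : IsBoundedMeasurable x) {J : Set ℝ} (hJ : MeasurableSet J)
    (m : ℝ) : IsBoundedMeasurable (flatten J m x) :=
  hx.add (((const m).sub hx).indicator hJ)

lemma tailValue_const_sub (hr : 0 < r) (hx : IsBoundedMeasurable x) (m t : ℝ) :
    tailValue r (fun s => m - x s) t = exp (-r * t) * (m - promisedValue r x t) := by
  rw [tailValue_sub hr (.const m) hx, tailValue_const hr, tailValue_eq_exp_mul_promisedValue]
  ring

lemma promisedValue_flatten (hr : 0 < r) (hx : IsBoundedMeasurable x) {J : Set ℝ}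
    (hJ : MeasurableSet J) (m u : ℝ) :
    promisedValue r (flatten J m x) u =
      promisedValue r x u + exp (r * u) * tailValue r (J.indicator fun s => m - x s) u := by
  rw [promisedValue, promisedValue, ← mul_add,
    ← tailValue_add hr hx (((IsBoundedMeasurable.const m).sub hx).indicator hJ)]
  rfl

lemma promisedValue_flatten_Ioo (hr : 0 < r) (hx : IsBoundedMeasurable x) {a b m : ℝ}
    (hab : a ≤ b) (hb : promisedValue r x b = m) (u : ℝ) :
    promisedValue r (flatten (Ioo a b) m x) u =
      if u ≤ a then promisedValue r x u + exp (r * u) * (exp (-r * a) * (m - promisedValue r x a))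
      else if u ≤ b then m else promisedValue r x u := by
  rw [promisedValue_flatten hr hx measurableSet_Ioo, tailValue_indicator_Ioo hr
    ((IsBoundedMeasurable.const m).sub hx), tailValue_const_sub hr hx, tailValue_const_sub hr hx,
    hb, sub_self, mul_zero, sub_zero]
  split_ifs with hua hub
  · rw [max_eq_left hua, min_eq_left hab]
  · rw [max_eq_right (not_le.1 hua).le, min_eq_left hub, ← mul_assoc, exp_mul_exp_neg]; ring
  · rw [min_eq_right ((not_le.1 hub).le.trans (le_max_right _ _)), hb]; ring

lemma promisedValue_flatten_Ioi (hr : 0 < r) (hx : IsBoundedMeasurable x) (a m u : ℝ) :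
    promisedValue r (flatten (Ioi a) m x) u =
      if u ≤ a then promisedValue r x u + exp (r * u) * (exp (-r * a) * (m - promisedValue r x a))
      else m := by
  rw [promisedValue_flatten hr hx measurableSet_Ioi, tailValue_indicator_Ioi,
    tailValue_const_sub hr hx]
  split_ifs with hua
  · rw [max_eq_left hua]
  · rw [max_eq_right (not_le.1 hua).le, ← mul_assoc, exp_mul_exp_neg]; ring

end Value

/-! ### Supergradients and marginal values -/

section Concave

variable {I : Set ℝ} {f : ℝ → ℝ}

lemma secant_anti_of_concaveOn (hf : ConcaveOn ℝ I f) {u w u' w' : ℝ} (hu : u ∈ I) (hw' : w' ∈ I)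
    (huw : u < w) (huw' : u' < w') (huu' : u ≤ u') (hww' : w ≤ w') :
    (f w' - f u') / (w' - u') ≤ (f w - f u) / (w - u) := by
  have hw : w ∈ I := hf.1.ordConnected.out hu hw' ⟨huw.le, hww'⟩
  have hu' : u' ∈ I := hf.1.ordConnected.out hu hw' ⟨huu', huw'.le⟩
  have huw'' : u < w' := huw.trans_le hww'
  simp only [← slope_def_field]
  calc slope f u' w' = slope f w' u' := slope_comm f u' w'
    _ ≤ slope f w' u := hf.slope_anti hw' ⟨hu, huw''.ne⟩ ⟨hu', huw'.ne⟩ huu'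
    _ = slope f u w' := slope_comm f w' u
    _ ≤ slope f u w := hf.slope_anti hu ⟨hw, huw.ne'⟩ ⟨hw', huw''.ne'⟩ hww'

lemma exists_supergradient_of_concaveOn (hf : ConcaveOn ℝ I f) {a m b : ℝ} (ha : a ∈ I)
    (hb : b ∈ I) (ham : a < m) (hmb : m < b) : ∃ p, ∀ v ∈ I, f v ≤ f m + p * (v - m) := by
  have hm : m ∈ I := hf.1.ordConnected.out ha hb ⟨ham.le, hmb.le⟩
  set T := (fun v => (f v - f m) / (v - m)) '' (I ∩ Ioi m)
  have hne : T.Nonempty := ⟨_, b, ⟨hb, hmb⟩, rfl⟩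
  have hub : ∀ u ∈ I, u < m → ∀ s ∈ T, s ≤ (f m - f u) / (m - u) := by
    rintro u hu hum _ ⟨v, ⟨hv, hvm⟩, rfl⟩
    exact hf.slope_anti_adjacent hu hv hum hvm
  refine ⟨sSup T, fun v hv => ?_⟩
  rcases lt_trichotomy v m with h | rfl | h
  · have := csSup_le hne (hub v hv h)
    rw [le_div_iff₀ (by linarith)] at this
    nlinarith
  · simp
  · have := le_csSup ⟨_, hub a ha ham⟩ (mem_image_of_mem _ ⟨hv, h⟩)
    rw [div_le_iff₀ (sub_pos.2 h)] at this
    linarith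

lemma exists_gap_of_strictConcaveOn_of_isMaxOn (hf : StrictConcaveOn ℝ I f) {m e : ℝ}
    (he : 0 < e) (hm : m ∈ I) (hmax : IsMaxOn f I m) :
    ∃ d > 0, ∀ v ∈ I, e ≤ |v - m| → f v + d ≤ f m := by
  have hbeyond : ∀ w ≠ m, ∃ d > 0, ∀ v ∈ I, w ∈ uIcc m v → f v + d ≤ f m := by
    intro w hwm
    by_cases hw : w ∈ I
    · refine ⟨f m - f w, sub_pos.2 ((hmax hw).lt_of_ne fun heq => hwm ?_), fun v hv hwv => ?_⟩
      · exact hf.eq_of_isMaxOn (fun v hv => (hmax hv).trans heq.ge) hmax hw hm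
      · have hmin := hf.concaveOn.min_le_of_mem_segment hm hv (segment_eq_uIcc m v ▸ hwv)
        rw [min_eq_right (hmax hv)] at hmin
        linarith
    · exact ⟨1, one_pos, fun v hv hwv => absurd (hf.1.ordConnected.uIcc_subset hm hv hwv) hw⟩
  obtain ⟨d, hd, hgap⟩ := hbeyond (m + e) (by linarith)
  obtain ⟨d', hd', hgap'⟩ := hbeyond (m - e) (by linarith)
  refine ⟨min d d', lt_min hd hd', fun v hv hev => ?_⟩
  rcases le_abs'.1 hev with h | h
  · linarith [min_le_right d d', hgap' v hv (mem_uIcc.2 (.inr ⟨by linarith, by linarith⟩))]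
  · linarith [min_le_left d d', hgap v hv (mem_uIcc.2 (.inl ⟨by linarith, by linarith⟩))]

lemma exists_supergradient_gap_of_strictConcaveOn (hf : StrictConcaveOn ℝ I f) {m p e : ℝ}
    (he : 0 < e) (hm : m ∈ I) (hp : ∀ v ∈ I, f v ≤ f m + p * (v - m)) :
    ∃ d > 0, ∀ v ∈ I, e ≤ |v - m| → f v + d ≤ f m + p * (v - m) := by
  have hlin : ConvexOn ℝ I fun v => p * (v - m) :=
    (((LinearMap.mulLeft ℝ p).convexOn hf.1).add_const (-(p * m))).congr
      fun v _ => (mul_sub p v m).symm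
  obtain ⟨d, hd, hgap⟩ := exists_gap_of_strictConcaveOn_of_isMaxOn (hf.sub_convexOn hlin) he hm
    fun v hv => by simpa using hp v hv
  refine ⟨d, hd, fun v hv hev => ?_⟩
  have := hgap v hv hev
  simp only [Pi.sub_apply, sub_self, mul_zero, sub_zero] at this
  linarith

/-- Displacing `w` by any `e` between `0` and `δ` stays in `I` and changes `f` by at least `c * e`.
The sign of `δ` is the direction of the displacement, so that `c` is a lower bound of the slope if
`δ > 0` and an upper bound if `δ < 0`. -/
def HasMarginalValue (I : Set ℝ) (f : ℝ → ℝ) (δ w c : ℝ) : Prop :=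
  ∀ e ∈ uIcc 0 δ, w + e ∈ I ∧ f w + c * e ≤ f (w + e)

lemma HasMarginalValue.mono {δ η w c : ℝ} (h : HasMarginalValue I f δ w c) (hη : η ∈ uIcc 0 δ) :
    HasMarginalValue I f η w c :=
  fun e he => h e (uIcc_subset_uIcc_left hη he)

lemma HasMarginalValue.mul_mem_and_le {δ w c θ : ℝ} (h : HasMarginalValue I f δ w c)
    (hθ : θ ∈ Icc 0 1) : w + δ * θ ∈ I ∧ f w + c * (δ * θ) ≤ f (w + δ * θ) := by
  refine h _ (mem_uIcc.2 ?_)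
  rcases le_total 0 δ with hδ | hδ
  · exact .inl ⟨mul_nonneg hδ hθ.1, mul_le_of_le_one_right hδ hθ.2⟩
  · exact .inr ⟨le_mul_of_le_one_right hδ hθ.2, mul_nonpos_of_nonpos_of_nonneg hδ hθ.1⟩

lemma hasMarginalValue_of_le (hf : ConcaveOn ℝ I f) {w a b : ℝ} (hw : w ∈ I) (hb : b ∈ I)
    (hwa : w ≤ a) (hab : a < b) :
    HasMarginalValue I f (b - a) w ((f b - f a) / (b - a)) := by
  intro e he
  rw [uIcc_of_le (sub_nonneg.2 hab.le)] at he
  have hweb : w + e ≤ b := by linarith [he.2]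
  refine ⟨hf.1.ordConnected.out hw hb ⟨le_add_of_nonneg_right he.1, hweb⟩, ?_⟩
  rcases he.1.eq_or_lt with rfl | he0
  · simp
  · have := secant_anti_of_concaveOn hf hw hb (lt_add_of_pos_right w he0) hab hwa hweb
    rw [add_sub_cancel_left, le_div_iff₀ he0] at this
    linarith

lemma hasMarginalValue_of_ge (hf : ConcaveOn ℝ I f) {w a b : ℝ} (ha : a ∈ I) (hw : w ∈ I)
    (hbw : b ≤ w) (hab : a < b) :
    HasMarginalValue I f (a - b) w ((f b - f a) / (b - a)) := by
  intro e he
  rw [uIcc_of_ge (sub_nonpos.2 hab.le)] at he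
  have hawe : a ≤ w + e := by linarith [he.1]
  refine ⟨hf.1.ordConnected.out ha hw ⟨hawe, add_le_of_nonpos_right he.2⟩, ?_⟩
  rcases he.2.eq_or_lt with rfl | he0
  · simp
  · have := secant_anti_of_concaveOn hf ha hw hab (add_lt_of_neg_right w he0) hawe hbw
    rw [sub_add_cancel_left, div_le_iff₀ (neg_pos.2 he0)] at this
    linarith

end Concave

/-! ### Optimal flows -/

/-- The data of a frontier on its effective domain below the peak `p`: `I` is `(0,p]` or `[0,p]`,
and `f` is real and concave on it. -/
structure IsRealFrontier (p : ℝ) (I : Set ℝ) (f : ℝ → ℝ) : Prop where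
  Ioc_subset : Ioc 0 p ⊆ I
  subset_Icc : I ⊆ Icc 0 p
  concave : ConcaveOn ℝ I f

lemma IsRealFrontier.mem_of_pos_of_le {p : ℝ} {I : Set ℝ} {f : ℝ → ℝ} (h : IsRealFrontier p I f)
    {u w : ℝ} (hu : 0 < u) (huw : u ≤ w) (hw : w ∈ I) : u ∈ I :=
  h.Ioc_subset ⟨hu, huw.trans (h.subset_Icc hw).2⟩

lemma IsRealFrontier.exists_supergradient {p m : ℝ} {I : Set ℝ} {f : ℝ → ℝ}
    (h : IsRealFrontier p I f) (hm : m ∈ Ioo 0 p) : ∃ q, ∀ v ∈ I, f v ≤ f m + q * (v - m) :=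
  exists_supergradient_of_concaveOn h.concave
    (h.Ioc_subset ⟨half_pos hm.1, (half_lt_self hm.1).le.trans hm.2.le⟩)
    (h.Ioc_subset ⟨hm.1.trans hm.2, le_rfl⟩) (half_lt_self hm.1) hm.2

/-- A probability measure on `[0,∞)` without atoms and with unbounded support. -/
structure IsUnboundedDistribution (G : Measure ℝ) : Prop where
  prob : IsProbabilityMeasure G
  neg : G (Iio 0) = 0
  noAtoms : NullSingletonClass G
  tail_pos : ∀ t, 0 < G (Ioi t)

/-- The mechanism with flow `x` and with reward equal to the value of `x` maximises the payoff `Π_G`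
among mechanisms of this form, with real frontiers `f0` on `I0` and `f1` on `I1`: no other flow `y`
gains. Only bounded measurable lower bounds `q`, `j` of the gains enter, so that no measurability of
the frontiers is needed. -/
structure IsOptimalFlow (r : ℝ) (I0 I1 : Set ℝ) (f0 f1 : ℝ → ℝ) (G : Measure ℝ) (x : ℝ → ℝ) :
    Prop where
  isBoundedMeasurable : IsBoundedMeasurable x
  mem0 : ∀ t, x t ∈ I0
  mem1 : ∀ t, 0 ≤ t → promisedValue r x t ∈ I1
  optimal : ∀ y q j : ℝ → ℝ, IsBoundedMeasurable y → IsBoundedMeasurable q →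
    IsBoundedMeasurable j → (∀ t, 0 < t → y t ∈ I0) → (∀ t, 0 ≤ t → promisedValue r y t ∈ I1) →
    (∀ t, 0 < t → f0 (x t) + q t ≤ f0 (y t)) →
    (∀ t, 0 ≤ t → f1 (promisedValue r x t) + j t ≤ f1 (promisedValue r y t)) →
    ∫ τ, headValue r q τ + exp (-r * τ) * j τ ∂G ≤ 0

namespace IsUnboundedDistribution

variable {G : Measure ℝ}

lemma ae_nonneg (hG : IsUnboundedDistribution G) : ∀ᵐ τ ∂G, 0 ≤ τ :=
  ae_iff.2 (by simpa [Iio] using hG.neg)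

lemma real_Ici_pos (hG : IsUnboundedDistribution G) (t : ℝ) : 0 < G.real (Ici t) :=
  have := hG.prob
  ENNReal.toReal_pos ((hG.tail_pos t).trans_le (measure_mono Ioi_subset_Ici_self)).ne'
    (measure_ne_top _ _)

lemma integrable_exp_mul {r : ℝ} (hr : 0 < r) (hG : IsUnboundedDistribution G) {j : ℝ → ℝ}
    (hj : IsBoundedMeasurable j) : Integrable (fun τ => exp (-r * τ) * j τ) G := by
  have := hG.prob
  refine (hj.integrable G).bdd_mul (c := 1) (by fun_prop) ?_
  filter_upwards [hG.ae_nonneg] with τ hτ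
  rw [Real.norm_of_nonneg (Real.exp_nonneg _)]
  exact Real.exp_le_one_iff.2 (by nlinarith)

lemma ae_eq_zero_of_integral_headValue {r : ℝ} (hr : 0 < r) (hG : IsUnboundedDistribution G)
    {q : ℝ → ℝ} (hq : IsBoundedMeasurable q) (hq0 : ∀ t, 0 ≤ q t)
    (h : ∫ τ, headValue r q τ ∂G ≤ 0) : ∀ᵐ t, 0 < t → q t = 0 := by
  have := hG.prob
  have hnonneg := headValue_nonneg hr hq0
  have hzero := (integral_eq_zero_iff_of_nonneg hnonneg ((hq.headValue hr).integrable G)).1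
    (h.antisymm (integral_nonneg hnonneg))
  refine ae_forall_Ioi_of_forall_Ioo fun b => ?_
  obtain ⟨τ, hτ, hbτ⟩ : ∃ τ, headValue r q τ = 0 ∧ b < τ := by
    by_contra! hcon
    exact (hG.tail_pos b).ne' (measure_mono_null (fun τ hτ hz => (hcon τ hz).not_gt hτ) hzero)
  have hw : ∀ s, 0 ≤ r * exp (-r * s) * q s := fun s => mul_nonneg (discount_pos hr s).le (hq0 s)
  have hae := (setIntegral_eq_zero_iff_of_nonneg_ae (.of_forall hw)
    ((hq.integrableOn_Ioi hr 0).mono_set Ioo_subset_Ioi_self)).1 hτ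
  filter_upwards [(ae_restrict_iff' measurableSet_Ioo).1 hae] with t ht htb
  exact (mul_eq_zero.1 (ht ⟨htb.1, htb.2.trans hbτ⟩)).resolve_left (discount_pos hr t).ne'

end IsUnboundedDistribution

section Excursion

variable {r u0 m p0 p1 : ℝ} {I0 I1 : Set ℝ} {f0 f1 : ℝ → ℝ} {G : Measure ℝ} {x y : ℝ → ℝ}

lemma headValue_perturbation_le (hr : 0 < r) (hx : IsBoundedMeasurable x)
    (hy : IsBoundedMeasurable y) {q : ℝ → ℝ} (hq : IsBoundedMeasurable q) (hp0 : 0 ≤ p0)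
    (hxy0 : promisedValue r x 0 ≤ promisedValue r y 0) {τ : ℝ} (hτ : 0 ≤ τ)
    (hsign : 0 ≤ (p1 - p0) * (promisedValue r y τ - promisedValue r x τ)) :
    headValue r q τ ≤ headValue r (fun t => p0 * (y t - x t) + q t) τ
      + exp (-r * τ) * (p1 * (promisedValue r y τ - promisedValue r x τ)) := by
  have hyx := (hy.sub hx).const_mul p0
  rw [headValue_eq hr hq hτ, headValue_eq hr (hyx.add hq) hτ]
  simp only [tailValue_add hr hyx hq, tailValue_const_mul, tailValue_sub hr hy hx]
  simp only [tailValue_eq_exp_mul_promisedValue (x := x),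
    tailValue_eq_exp_mul_promisedValue (x := y), mul_zero, Real.exp_zero, one_mul]
  linarith [mul_nonneg (Real.exp_pos (-r * τ)).le hsign, mul_nonneg hp0 (sub_nonneg.2 hxy0)]

-- The supergradient `p0` bounds the flow gain and `p1` the reward gain, and by `hsign` and `hY0`
-- these bounds add up to something nonnegative. What strict concavity adds is then lost for `x`.
lemma IsOptimalFlow.ae_abs_sub_lt_of_excursion (hr : 0 < r) (hf0 : StrictConcaveOn ℝ I0 f0)
    (hG : IsUnboundedDistribution G) (hx : IsOptimalFlow r I0 I1 f0 f1 G x)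
    (hm0 : m ∈ I0) (hm1 : m ∈ I1) (hp0 : ∀ v ∈ I0, f0 v ≤ f0 m + p0 * (v - m))
    (hp1 : ∀ v ∈ I1, f1 v ≤ f1 m + p1 * (v - m)) (hp0_nonneg : 0 ≤ p0)
    (hy : IsBoundedMeasurable y) (hym : ∀ t, y t = m ∨ y t = x t)
    (hYm : ∀ t, 0 ≤ t → promisedValue r y t = m ∨ promisedValue r y t = promisedValue r x t)
    (hsign : ∀ t, 0 ≤ t → 0 ≤ (p1 - p0) * (promisedValue r y t - promisedValue r x t))
    (hY0 : promisedValue r x 0 ≤ promisedValue r y 0) {e : ℝ} (he : 0 < e) :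
    ∀ᵐ t, 0 < t → |x t - y t| < e := by
  have hxb := hx.isBoundedMeasurable
  obtain ⟨d, hd, hgap⟩ := exists_supergradient_gap_of_strictConcaveOn hf0 he hm0 hp0
  set S := {t | e ≤ |x t - y t|}
  have hS : MeasurableSet S :=
    measurableSet_le measurable_const (hxb.measurable.sub hy.measurable).abs
  have hq := (IsBoundedMeasurable.const d).indicator hS
  have hj := ((hy.promisedValue hr).sub (hxb.promisedValue hr)).const_mul p1
  have hqyx := ((hy.sub hxb).const_mul p0).add hq
  have hflowGain : ∀ t, f0 (x t) + (p0 * (y t - x t) + S.indicator (fun _ => d) t) ≤ f0 (y t) := by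
    intro t
    rcases hym t with ht | ht
    · by_cases htS : t ∈ S
      · rw [indicator_of_mem htS, ht]
        linarith [hgap (x t) (hx.mem0 t) (ht ▸ htS)]
      · rw [indicator_of_notMem htS, ht]
        linarith [hp0 (x t) (hx.mem0 t)]
    · have htS : t ∉ S := fun h => (he.trans_le h).ne' (by rw [ht, sub_self, abs_zero])
      rw [indicator_of_notMem htS, ht, sub_self, mul_zero, add_zero, add_zero]
  have hrewardGain : ∀ t, 0 ≤ t → f1 (promisedValue r x t)
      + p1 * (promisedValue r y t - promisedValue r x t) ≤ f1 (promisedValue r y t) := by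
    intro t ht
    rcases hYm t ht with h | h
    · rw [h]; linarith [hp1 _ (hx.mem1 t ht)]
    · rw [h, sub_self, mul_zero, add_zero]
  have hopt := hx.optimal y _ _ hy hqyx hj
    (fun t _ => (hym t).elim (fun h => h ▸ hm0) fun h => h ▸ hx.mem0 t)
    (fun t ht => (hYm t ht).elim (fun h => h ▸ hm1) fun h => h ▸ hx.mem1 t ht)
    (fun t _ => hflowGain t) hrewardGain
  have := hG.prob
  have hzero := hG.ae_eq_zero_of_integral_headValue hr hq (indicator_nonneg fun _ _ => hd.le)
    (le_trans (integral_mono_ae ((hq.headValue hr).integrable G)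
      (((hqyx.headValue hr).integrable G).add (hG.integrable_exp_mul hr hj))
      (hG.ae_nonneg.mono fun τ hτ =>
        headValue_perturbation_le hr hxb hy hq hp0_nonneg hY0 hτ (hsign τ hτ))) hopt)
  filter_upwards [hzero] with t ht ht0
  by_contra! htS
  exact hd.ne' ((indicator_of_mem (s := S) htS fun _ => d).symm.trans (ht ht0))

lemma IsOptimalFlow.ae_eq_of_excursion (hr : 0 < r) (hf0 : StrictConcaveOn ℝ I0 f0)
    (hG : IsUnboundedDistribution G) (hx : IsOptimalFlow r I0 I1 f0 f1 G x)
    (hm0 : m ∈ I0) (hm1 : m ∈ I1) (hp0 : ∀ v ∈ I0, f0 v ≤ f0 m + p0 * (v - m))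
    (hp1 : ∀ v ∈ I1, f1 v ≤ f1 m + p1 * (v - m)) (hp0_nonneg : 0 ≤ p0)
    (hy : IsBoundedMeasurable y) (hym : ∀ t, y t = m ∨ y t = x t)
    (hYm : ∀ t, 0 ≤ t → promisedValue r y t = m ∨ promisedValue r y t = promisedValue r x t)
    (hsign : ∀ t, 0 ≤ t → 0 ≤ (p1 - p0) * (promisedValue r y t - promisedValue r x t))
    (hY0 : promisedValue r x 0 ≤ promisedValue r y 0) :
    ∀ᵐ t, 0 < t → x t = y t := by
  have hclose : ∀ n : ℕ, ∀ᵐ t, 0 < t → |x t - y t| < 1 / ((n : ℝ) + 1) := fun n =>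
    hx.ae_abs_sub_lt_of_excursion hr hf0 hG hm0 hm1 hp0 hp1 hp0_nonneg hy hym hYm hsign hY0
      Nat.one_div_pos_of_nat
  filter_upwards [ae_all_iff.2 hclose] with t ht ht0
  by_contra hne
  obtain ⟨n, hn⟩ := exists_nat_one_div_lt (abs_pos.2 (sub_ne_zero.2 hne))
  exact (ht n ht0).not_gt hn

lemma exists_last_le {X : ℝ → ℝ} (hX : Continuous X) {s t : ℝ} (hst : s ≤ t) (hs : X s ≤ m)
    (ht : m < X t) : ∃ a ∈ Ico s t, X a = m ∧ ∀ τ ∈ Ioc a t, m < X τ := by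
  obtain ⟨c, hc, hcm⟩ := intermediate_value_Icc hst hX.continuousOn ⟨hs, ht.le⟩
  obtain ⟨a, ⟨ha, ham⟩, hmax⟩ := (isCompact_Icc.inter_right
    (isClosed_eq hX continuous_const)).exists_isGreatest ⟨c, hc, hcm⟩
  rw [mem_ofPred_eq] at ham
  refine ⟨a, ⟨ha.1, ha.2.lt_of_ne ?_⟩, ham, fun τ hτ => ?_⟩
  · rintro rfl
    exact ht.ne' ham
  · by_contra! hτm
    obtain ⟨c, hc, hcm⟩ := intermediate_value_Icc hτ.2 hX.continuousOn ⟨hτm, ht.le⟩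
    exact (hmax ⟨⟨ha.1.trans (hτ.1.le.trans hc.1), hc.2⟩, hcm⟩).not_gt (hτ.1.trans_le hc.1)

lemma exists_first_le {X : ℝ → ℝ} (hX : Continuous X) {s t : ℝ} (hst : s ≤ t) (hs : m < X s)
    (ht : X t ≤ m) : ∃ b ∈ Ioc s t, X b = m ∧ ∀ τ ∈ Ico s b, m < X τ := by
  obtain ⟨a, ha, ham, h⟩ := exists_last_le (X := fun τ => X (-τ)) (by fun_prop)
    (neg_le_neg hst) (by simpa using ht) (by simpa using hs)
  refine ⟨-a, ⟨by linarith [ha.2], by linarith [ha.1]⟩, ham, fun τ hτ => ?_⟩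
  simpa using h (-τ) ⟨by linarith [hτ.2], by linarith [hτ.1]⟩

lemma exists_excursion {X : ℝ → ℝ} (hX : Continuous X) {s t τ : ℝ} (hst : s ≤ t) (htτ : t ≤ τ)
    (hs : X s ≤ m) (ht : m < X t) (hτ : X τ ≤ m) :
    ∃ a b, s ≤ a ∧ t ∈ Ioo a b ∧ X a = m ∧ X b = m ∧ ∀ u ∈ Ioo a b, m < X u := by
  obtain ⟨a, ha, ham, hat⟩ := exists_last_le hX hst hs ht
  obtain ⟨b, hb, hbm, htb⟩ := exists_first_le hX htτ ht hτ
  refine ⟨a, b, ha.1, ⟨ha.2, hb.1⟩, ham, hbm, fun u hu => ?_⟩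
  exact (le_total u t).elim (fun hut => hat u ⟨hu.1, hut⟩) fun htu => htb u ⟨htu, hu.2⟩

lemma promisedValue_flatten_excursion (hr : 0 < r) (hx : IsBoundedMeasurable x) {a b : ℝ}
    (hab : a ≤ b) (ha : promisedValue r x a = m) (hb : promisedValue r x b = m) (u : ℝ) :
    (u ∈ Ioo a b ∧ promisedValue r (flatten (Ioo a b) m x) u = m) ∨
      promisedValue r (flatten (Ioo a b) m x) u = promisedValue r x u := by
  rw [promisedValue_flatten_Ioo hr hx hab hb, ha, sub_self, mul_zero, mul_zero, add_zero]
  split_ifs with hua hub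
  · exact .inr rfl
  · rcases hub.eq_or_lt with rfl | hub
    · exact .inr hb.symm
    · exact .inl ⟨⟨not_le.1 hua, hub⟩, rfl⟩
  · exact .inr rfl

lemma exists_flatten_of_lt (hr : 0 < r) (hx : IsBoundedMeasurable x) {s t : ℝ} (hs : 0 ≤ s)
    (hst : s ≤ t) (hsm : promisedValue r x s ≤ m) (hmt : m < promisedValue r x t) :
    ∃ J, MeasurableSet J ∧ promisedValue r (flatten J m x) t = m ∧
      promisedValue r x 0 ≤ promisedValue r (flatten J m x) 0 ∧
      ∀ u, (m ≤ promisedValue r x u ∧ promisedValue r (flatten J m x) u = m) ∨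
        promisedValue r (flatten J m x) u = promisedValue r x u := by
  have hX := continuous_promisedValue hr hx
  by_cases hreturn : ∃ τ ≥ t, promisedValue r x τ ≤ m
  · obtain ⟨τ, htτ, hτ⟩ := hreturn
    obtain ⟨a, b, hsa, ht, ha, hb, habove⟩ := exists_excursion hX hst htτ hsm hmt hτ
    have hab : a ≤ b := ht.1.le.trans ht.2.le
    refine ⟨Ioo a b, measurableSet_Ioo, ?_, ?_, fun u => ?_⟩
    · rw [promisedValue_flatten_Ioo hr hx hab hb, if_neg ht.1.not_ge, if_pos ht.2.le]
    · refine ((promisedValue_flatten_excursion hr hx hab ha hb 0).resolve_left fun h => ?_).ge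
      exact (hs.trans hsa).not_gt h.1.1
    · exact (promisedValue_flatten_excursion hr hx hab ha hb u).imp_left
        fun h => ⟨(habove u h.1).le, h.2⟩
  · push Not at hreturn
    obtain ⟨a, ha, ham, habove⟩ := exists_last_le hX hst hsm hmt
    refine ⟨Ioi a, measurableSet_Ioi, ?_, ?_, fun u => ?_⟩ <;>
      rw [promisedValue_flatten_Ioi hr hx, ham, sub_self, mul_zero (exp (-r * a)),
        mul_zero (exp (r * _)), add_zero]
    · exact if_neg ha.2.not_ge
    · rw [if_pos (hs.trans ha.1)]
    · split_ifs with hua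
      · exact .inr rfl
      · exact .inl ⟨(le_total u t).elim (fun hut => (habove u ⟨not_le.1 hua, hut⟩).le)
          fun htu => (hreturn u htu).le, rfl⟩

lemma exists_flatten_of_gt (hr : 0 < r) (hx : IsBoundedMeasurable x) {s t : ℝ} (hs : 0 ≤ s)
    (hst : s ≤ t) (hsm : promisedValue r x s < m) (hmt : m ≤ promisedValue r x t) :
    ∃ J, MeasurableSet J ∧ promisedValue r (flatten J m x) s = m ∧
      ∀ u, 0 ≤ u → (promisedValue r x u ≤ m ∧ promisedValue r (flatten J m x) u = m) ∨
        promisedValue r (flatten J m x) u = promisedValue r x u := by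
  have hX := continuous_promisedValue hr hx
  by_cases hbefore : ∃ τ ∈ Icc 0 s, m ≤ promisedValue r x τ
  · obtain ⟨τ, ⟨_, hτs⟩, hτ⟩ := hbefore
    obtain ⟨a, b, _, hsab, ha, hb, hbelow⟩ := exists_excursion (m := -m) hX.neg hτs hst
      (neg_le_neg hτ) (neg_lt_neg hsm) (neg_le_neg hmt)
    replace ha := neg_inj.1 ha
    replace hb := neg_inj.1 hb
    have hab : a ≤ b := hsab.1.le.trans hsab.2.le
    refine ⟨Ioo a b, measurableSet_Ioo, ?_, fun u _ => ?_⟩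
    · rw [promisedValue_flatten_Ioo hr hx hab hb, if_neg hsab.1.not_ge, if_pos hsab.2.le]
    · exact (promisedValue_flatten_excursion hr hx hab ha hb u).imp_left
        fun h => ⟨(neg_lt_neg_iff.1 (hbelow u h.1)).le, h.2⟩
  · push Not at hbefore
    obtain ⟨b, hb, hbm, hbelow⟩ := exists_first_le (m := -m) hX.neg hst (neg_lt_neg hsm)
      (neg_le_neg hmt)
    replace hbm := neg_inj.1 hbm
    have hb0 : 0 ≤ b := hs.trans hb.1.le
    have hflat : ∀ u, 0 ≤ u → promisedValue r (flatten (Ioo 0 b) m x) u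
        = if u ≤ b then m else promisedValue r x u := by
      intro u hu
      rw [promisedValue_flatten_Ioo hr hx hb0 hbm]
      rcases hu.eq_or_lt with rfl | hu
      · simp [hb0]
      · rw [if_neg hu.not_ge]
    refine ⟨Ioo 0 b, measurableSet_Ioo, by rw [hflat s hs, if_pos hb.1.le], fun u hu => ?_⟩
    rw [hflat u hu]
    split_ifs with hub
    · refine .inl ⟨?_, rfl⟩
      rcases hub.eq_or_lt with rfl | hub
      · exact hbm.le
      · exact (le_total u s).elim (fun hus => (hbefore u ⟨hu, hus⟩).le)
          fun hsu => (neg_lt_neg_iff.1 (hbelow u ⟨hsu, hub⟩)).le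
    · exact .inr rfl

lemma IsOptimalFlow.antitoneOn_promisedValue (hr : 0 < r) (h0 : IsRealFrontier u0 I0 f0)
    (h1 : IsRealFrontier u0 I1 f1) (hf0 : StrictConcaveOn ℝ I0 f0) (hmono : MonotoneOn f0 I0)
    (hG : IsUnboundedDistribution G) (hx : IsOptimalFlow r I0 I1 f0 f1 G x) :
    AntitoneOn (promisedValue r x) (Ici 0) := by
  intro s (hs : 0 ≤ s) t (ht : 0 ≤ t) hst
  by_contra! hlt
  have hxb := hx.isBoundedMeasurable
  obtain ⟨m, hsm, hmt⟩ := exists_between hlt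
  have hm : m ∈ Ioo 0 u0 :=
    ⟨(h1.subset_Icc (hx.mem1 s hs)).1.trans_lt hsm, hmt.trans_le (h1.subset_Icc (hx.mem1 t ht)).2⟩
  have hm0 : m ∈ I0 := h0.Ioc_subset (Ioo_subset_Ioc_self hm)
  have hm1 : m ∈ I1 := h1.Ioc_subset (Ioo_subset_Ioc_self hm)
  obtain ⟨p0, hp0⟩ := h0.exists_supergradient hm
  obtain ⟨p1, hp1⟩ := h1.exists_supergradient hm
  have hp0_nonneg : 0 ≤ p0 := by
    have hu0 : u0 ∈ I0 := h0.Ioc_subset ⟨hm.1.trans hm.2, le_rfl⟩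
    have := (hmono hm0 hu0 hm.2.le).trans (hp0 u0 hu0)
    exact nonneg_of_mul_nonneg_left (by linarith) (sub_pos.2 hm.2)
  have hflatten : ∀ J, MeasurableSet J → promisedValue r x 0 ≤ promisedValue r (flatten J m x) 0 →
      (∀ u, 0 ≤ u → (0 ≤ (p1 - p0) * (m - promisedValue r x u) ∧
        promisedValue r (flatten J m x) u = m) ∨
          promisedValue r (flatten J m x) u = promisedValue r x u) →
      ∀ u, 0 ≤ u → promisedValue r x u = promisedValue r (flatten J m x) u := by
    intro J hJ hJ0 hJm u hu
    have hae := hx.ae_eq_of_excursion hr hf0 hG hm0 hm1 hp0 hp1 hp0_nonneg (hxb.flatten hJ m)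
      (fun v => (em (v ∈ J)).imp flatten_of_mem flatten_of_notMem)
      (fun v hv => (hJm v hv).imp_left And.right)
      (fun v hv => (hJm v hv).elim (fun h => h.2.symm ▸ h.1) fun h => by rw [h, sub_self, mul_zero])
      hJ0
    exact promisedValue_congr_ae (hae.mono fun v hv huv => hv (hu.trans_lt huv))
  rcases le_total p1 p0 with hp | hp
  · obtain ⟨J, hJ, hJt, hJ0, hJm⟩ := exists_flatten_of_lt hr hxb hs hst hsm.le hmt
    have := hflatten J hJ hJ0 (fun u _ => (hJm u).imp_left fun h =>
      ⟨mul_nonneg_of_nonpos_of_nonpos (by linarith) (by linarith), h.2⟩) t ht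
    linarith
  · obtain ⟨J, hJ, hJs, hJm⟩ := exists_flatten_of_gt hr hxb hs hst hsm hmt.le
    have := hflatten J hJ ((hJm 0 le_rfl).elim (fun h => h.1.trans h.2.ge) Eq.ge)
      (fun u hu => (hJm u hu).imp_left fun h =>
        ⟨mul_nonneg (by linarith) (by linarith), h.2⟩) s hs
    linarith

end Excursion

/-! ### Shifting consumption in time -/

/-- The flow that is constant on `B`, zero elsewhere, and whose value at time `0` is `1`. -/
def unitFlow (r : ℝ) (B : Set ℝ) (t : ℝ) : ℝ :=
  (∫ s in B, r * exp (-r * s))⁻¹ * B.indicator 1 t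

/-- The change of flow that takes one unit of value from the times in `B₁` and moves it to the times
in `B₂`. -/
def shiftFlow (r : ℝ) (B₁ B₂ : Set ℝ) (t : ℝ) : ℝ := unitFlow r B₂ t - unitFlow r B₁ t

/-- A set of times in `(a,b)` that is large enough to carry a unit of value. -/
structure IsWindow (B : Set ℝ) (a b : ℝ) : Prop where
  measurableSet : MeasurableSet B
  subset_Ioo : B ⊆ Ioo a b
  volume_pos : 0 < volume B

lemma HasLeftMass.isWindow {S : Set ℝ} {s t : ℝ} (h : HasLeftMass S t) (hS : MeasurableSet S)
    (hst : s < t) : IsWindow (S ∩ Ioo s t) s t :=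
  ⟨hS.inter measurableSet_Ioo, inter_subset_right, h s hst⟩

section Shift

variable {r : ℝ} {B : Set ℝ} {a b : ℝ}

lemma unitFlow_of_mem {t : ℝ} (ht : t ∈ B) :
    unitFlow r B t = (∫ s in B, r * exp (-r * s))⁻¹ := by
  rw [unitFlow, indicator_of_mem ht, Pi.one_apply, mul_one]

lemma unitFlow_of_notMem {t : ℝ} (ht : t ∉ B) : unitFlow r B t = 0 := by
  rw [unitFlow, indicator_of_notMem ht, mul_zero]

lemma tailValue_unitFlow (hB : MeasurableSet B) (t : ℝ) :
    tailValue r (unitFlow r B) t =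
      (∫ s in B, r * exp (-r * s))⁻¹ * ∫ s in Ioi t ∩ B, r * exp (-r * s) := by
  unfold unitFlow
  simp only [tailValue_const_mul, tailValue_indicator hB, Pi.one_apply, mul_one]

namespace IsWindow

lemma lt (hB : IsWindow B a b) : a < b :=
  let ⟨_, hs⟩ := nonempty_of_measure_ne_zero hB.volume_pos.ne'
  (hB.subset_Ioo hs).1.trans (hB.subset_Ioo hs).2

lemma isBoundedMeasurable_unitFlow (hB : IsWindow B a b) : IsBoundedMeasurable (unitFlow r B) :=
  ((IsBoundedMeasurable.const 1).indicator hB.measurableSet).const_mul _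

lemma mono (hB : IsWindow B a b) {a' : ℝ} (ha : a' ≤ a) : IsWindow B a' b :=
  ⟨hB.measurableSet, hB.subset_Ioo.trans (Ioo_subset_Ioo_left ha), hB.volume_pos⟩

lemma integrableOn_discount (hr : 0 < r) (hB : IsWindow B a b) :
    IntegrableOn (fun s => r * exp (-r * s)) B :=
  (integrableOn_discount_Ioi hr a).mono_set fun _ ht => (hB.subset_Ioo ht).1

lemma integral_discount_pos (hr : 0 < r) (hB : IsWindow B a b) :
    0 < ∫ s in B, r * exp (-r * s) := by
  rw [setIntegral_pos_iff_support_of_nonneg_ae (.of_forall fun s => (discount_pos hr s).le)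
    (hB.integrableOn_discount hr)]
  have hsupport : (Function.support fun s => r * exp (-r * s)) = univ :=
    eq_univ_of_forall fun s => (discount_pos hr s).ne'
  rw [hsupport, univ_inter]
  exact hB.volume_pos

lemma tailValue_unitFlow_of_le (hr : 0 < r) (hB : IsWindow B a b) {t : ℝ} (ht : t ≤ a) :
    tailValue r (unitFlow r B) t = 1 := by
  have hsubset : B ⊆ Ioi t := fun s hs => ht.trans_lt (hB.subset_Ioo hs).1
  rw [tailValue_unitFlow hB.measurableSet, inter_eq_right.2 hsubset]
  exact inv_mul_cancel₀ (hB.integral_discount_pos hr).ne'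

lemma tailValue_unitFlow_of_ge (hB : IsWindow B a b) {t : ℝ} (ht : b ≤ t) :
    tailValue r (unitFlow r B) t = 0 := by
  have hempty : Ioi t ∩ B = ∅ :=
    eq_empty_of_forall_notMem fun s hs => ((hB.subset_Ioo hs.2).2.trans_le ht).not_gt hs.1
  rw [tailValue_unitFlow hB.measurableSet, hempty, Measure.restrict_empty, integral_zero_measure,
    mul_zero]

lemma tailValue_unitFlow_mem_Icc (hr : 0 < r) (hB : IsWindow B a b) (t : ℝ) :
    tailValue r (unitFlow r B) t ∈ Icc (0 : ℝ) 1 := by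
  have hw := hB.integral_discount_pos hr
  have hnonneg := fun s => (discount_pos hr s).le
  rw [tailValue_unitFlow hB.measurableSet]
  refine ⟨mul_nonneg (inv_nonneg.2 hw.le) (integral_nonneg hnonneg), (inv_mul_le_one₀ hw).2 ?_⟩
  exact setIntegral_mono_set (hB.integrableOn_discount hr) (.of_forall hnonneg)
    (.of_forall fun s hs => hs.2)

lemma isBoundedMeasurable_tailValue_unitFlow (hr : 0 < r) (hB : IsWindow B a b) :
    IsBoundedMeasurable (tailValue r (unitFlow r B)) :=
  .of_mem_Icc (continuous_tailValue hr hB.isBoundedMeasurable_unitFlow).measurable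
    (hB.tailValue_unitFlow_mem_Icc hr)

lemma headValue_unitFlow (hr : 0 < r) (hB : IsWindow B a b) (ha : 0 ≤ a) {t : ℝ} (ht : 0 ≤ t) :
    headValue r (unitFlow r B) t = 1 - tailValue r (unitFlow r B) t := by
  rw [headValue_eq hr hB.isBoundedMeasurable_unitFlow ht, hB.tailValue_unitFlow_of_le hr ha]

end IsWindow

variable {B₁ B₂ : Set ℝ} {s₁ t₁ t₂ : ℝ}

lemma isBoundedMeasurable_shiftFlow (h₁ : IsWindow B₁ s₁ t₁) (h₂ : IsWindow B₂ t₁ t₂) :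
    IsBoundedMeasurable (shiftFlow r B₁ B₂) :=
  h₂.isBoundedMeasurable_unitFlow.sub h₁.isBoundedMeasurable_unitFlow

lemma tailValue_shiftFlow (hr : 0 < r) (h₁ : IsWindow B₁ s₁ t₁) (h₂ : IsWindow B₂ t₁ t₂) (t : ℝ) :
    tailValue r (shiftFlow r B₁ B₂) t
      = tailValue r (unitFlow r B₂) t - tailValue r (unitFlow r B₁) t :=
  tailValue_sub hr h₂.isBoundedMeasurable_unitFlow h₁.isBoundedMeasurable_unitFlow t

lemma tailValue_shiftFlow_mem_Icc (hr : 0 < r) (h₁ : IsWindow B₁ s₁ t₁) (h₂ : IsWindow B₂ t₁ t₂)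
    (t : ℝ) : tailValue r (shiftFlow r B₁ B₂) t ∈ Icc (0 : ℝ) 1 := by
  have hm₁ := h₁.tailValue_unitFlow_mem_Icc hr t
  have hm₂ := h₂.tailValue_unitFlow_mem_Icc hr t
  rw [tailValue_shiftFlow hr h₁ h₂]
  rcases le_total t t₁ with h | h
  · rw [h₂.tailValue_unitFlow_of_le hr h]
    exact ⟨sub_nonneg.2 hm₁.2, sub_le_self 1 hm₁.1⟩
  · rwa [h₁.tailValue_unitFlow_of_ge h, sub_zero]

lemma tailValue_shiftFlow_eq_zero (hr : 0 < r) (h₁ : IsWindow B₁ s₁ t₁) (h₂ : IsWindow B₂ t₁ t₂)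
    {t : ℝ} (ht : t ∉ Ioo s₁ t₂) : tailValue r (shiftFlow r B₁ B₂) t = 0 := by
  rw [tailValue_shiftFlow hr h₁ h₂]
  rcases le_or_gt t s₁ with h | h
  · rw [h₁.tailValue_unitFlow_of_le hr h, h₂.tailValue_unitFlow_of_le hr (h.trans h₁.lt.le),
      sub_self]
  · have h' : t₂ ≤ t := not_lt.1 fun h' => ht ⟨h, h'⟩
    rw [h₁.tailValue_unitFlow_of_ge (h₂.lt.le.trans h'), h₂.tailValue_unitFlow_of_ge h', sub_self]

lemma promisedValue_shiftFlow_eq_zero (hr : 0 < r) (h₁ : IsWindow B₁ s₁ t₁)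
    (h₂ : IsWindow B₂ t₁ t₂) {t : ℝ} (ht : t ∉ Ioo s₁ t₂) :
    promisedValue r (shiftFlow r B₁ B₂) t = 0 := by
  rw [promisedValue, tailValue_shiftFlow_eq_zero hr h₁ h₂ ht, mul_zero]

lemma promisedValue_shiftFlow_mem_Icc (hr : 0 < r) (h₁ : IsWindow B₁ s₁ t₁)
    (h₂ : IsWindow B₂ t₁ t₂) (t : ℝ) :
    promisedValue r (shiftFlow r B₁ B₂) t ∈ Icc 0 (exp (r * t₂)) := by
  by_cases ht : t ∈ Ioo s₁ t₂
  · have hm := tailValue_shiftFlow_mem_Icc hr h₁ h₂ t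
    refine ⟨mul_nonneg (Real.exp_pos _).le hm.1,
      (mul_le_of_le_one_right (Real.exp_pos _).le hm.2).trans ?_⟩
    exact Real.exp_le_exp.2 (mul_le_mul_of_nonneg_left ht.2.le hr.le)
  · rw [promisedValue_shiftFlow_eq_zero hr h₁ h₂ ht]
    exact ⟨le_rfl, (Real.exp_pos _).le⟩

lemma exists_shiftSize (hr : 0 < r) (h₁ : IsWindow B₁ s₁ t₁) (h₂ : IsWindow B₂ t₁ t₂) :
    ∃ κ > 0, κ / (∫ s in B₁, r * exp (-r * s)) ∈ Icc 0 1 ∧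
      κ / (∫ s in B₂, r * exp (-r * s)) ∈ Icc 0 1 ∧
      ∀ t, κ * promisedValue r (shiftFlow r B₁ B₂) t ∈ Icc 0 1 := by
  have hw₁ := h₁.integral_discount_pos hr
  have hw₂ := h₂.integral_discount_pos hr
  set w₁ := ∫ s in B₁, r * exp (-r * s)
  set w₂ := ∫ s in B₂, r * exp (-r * s)
  have hκ : 0 < min (min w₁ w₂) (exp (r * t₂))⁻¹ := by positivity
  refine ⟨_, hκ, ⟨by positivity, ?_⟩, ⟨by positivity, ?_⟩, fun t => ?_⟩
  · exact (div_le_one hw₁).2 ((min_le_left _ _).trans (min_le_left _ _))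
  · exact (div_le_one hw₂).2 ((min_le_left _ _).trans (min_le_right _ _))
  · have hm := promisedValue_shiftFlow_mem_Icc hr h₁ h₂ t
    refine ⟨mul_nonneg hκ.le hm.1, ?_⟩
    calc _ ≤ (exp (r * t₂))⁻¹ * exp (r * t₂) :=
          mul_le_mul (min_le_right _ _) hm.2 hm.1 (inv_nonneg.2 (Real.exp_pos _).le)
      _ = 1 := inv_mul_cancel₀ (Real.exp_pos _).ne'

variable {δ κ α β : ℝ} {I : Set ℝ} {f x : ℝ → ℝ}

lemma shiftFlow_mem_and_le (h₁ : IsWindow B₁ s₁ t₁) (h₂ : IsWindow B₂ t₁ t₂) {t : ℝ}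
    (hκ₁ : κ / (∫ s in B₁, r * exp (-r * s)) ∈ Icc 0 1)
    (hκ₂ : κ / (∫ s in B₂, r * exp (-r * s)) ∈ Icc 0 1) (hx : x t ∈ I)
    (hα : t ∈ B₁ → HasMarginalValue I f (-δ) (x t) α)
    (hβ : t ∈ B₂ → HasMarginalValue I f δ (x t) β) :
    x t + δ * κ * shiftFlow r B₁ B₂ t ∈ I ∧
      f (x t) + δ * κ * (β * unitFlow r B₂ t - α * unitFlow r B₁ t)
        ≤ f (x t + δ * κ * shiftFlow r B₁ B₂ t) := by
  rw [shiftFlow]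
  by_cases ht₁ : t ∈ B₁
  · have ht₂ : t ∉ B₂ := fun h => (h₁.subset_Ioo ht₁).2.not_gt (h₂.subset_Ioo h).1
    obtain ⟨hmem, hle⟩ := (hα ht₁).mul_mem_and_le hκ₁
    set w := ∫ s in B₁, r * exp (-r * s)
    have hstep : -δ * (κ / w) = δ * κ * (0 - w⁻¹) := by ring
    have hvalue : α * (-δ * (κ / w)) = δ * κ * (β * 0 - α * w⁻¹) := by ring
    rw [hvalue, hstep] at hle
    rw [hstep] at hmem
    rw [unitFlow_of_mem ht₁, unitFlow_of_notMem ht₂]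
    exact ⟨hmem, hle⟩
  · rw [unitFlow_of_notMem ht₁, mul_zero, sub_zero, sub_zero]
    by_cases ht₂ : t ∈ B₂
    · obtain ⟨hmem, hle⟩ := (hβ ht₂).mul_mem_and_le hκ₂
      set w := ∫ s in B₂, r * exp (-r * s)
      have hstep : δ * (κ / w) = δ * κ * w⁻¹ := by ring
      have hvalue : β * (δ * (κ / w)) = δ * κ * (β * w⁻¹) := by ring
      rw [hvalue, hstep] at hle
      rw [hstep] at hmem
      rw [unitFlow_of_mem ht₂]
      exact ⟨hmem, hle⟩
    · rw [unitFlow_of_notMem ht₂, mul_zero, mul_zero, add_zero, mul_zero, add_zero]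
      exact ⟨hx, le_rfl⟩

variable {I0 I1 : Set ℝ} {f0 f1 c : ℝ → ℝ} {G : Measure ℝ}

lemma IsOptimalFlow.shift (hr : 0 < r) (hG : IsUnboundedDistribution G)
    (hx : IsOptimalFlow r I0 I1 f0 f1 G x) (h₁ : IsWindow B₁ s₁ t₁) (h₂ : IsWindow B₂ t₁ t₂)
    (hc : IsBoundedMeasurable c)
    (hα : ∀ t ∈ B₁, 0 < t → HasMarginalValue I0 f0 (-δ) (x t) α)
    (hβ : ∀ t ∈ B₂, 0 < t → HasMarginalValue I0 f0 δ (x t) β)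
    (hpromise : ∀ t ∈ Ioo s₁ t₂, 0 ≤ t → HasMarginalValue I1 f1 δ (promisedValue r x t) (c t)) :
    δ * ∫ τ, (β * headValue r (unitFlow r B₂) τ - α * headValue r (unitFlow r B₁) τ
      + c τ * tailValue r (shiftFlow r B₁ B₂) τ) ∂G ≤ 0 := by
  have hd₁ := h₁.isBoundedMeasurable_unitFlow (r := r)
  have hd₂ := h₂.isBoundedMeasurable_unitFlow (r := r)
  have hd := isBoundedMeasurable_shiftFlow (r := r) h₁ h₂
  obtain ⟨κ, hκ, hκ₁, hκ₂, hκ₃⟩ := exists_shiftSize hr h₁ h₂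
  have hvalue (t : ℝ) : promisedValue r (fun t => x t + δ * κ * shiftFlow r B₁ B₂ t) t
      = promisedValue r x t + δ * (κ * promisedValue r (shiftFlow r B₁ B₂) t) := by
    rw [promisedValue, tailValue_add hr hx.isBoundedMeasurable (hd.const_mul _),
      tailValue_const_mul, promisedValue, promisedValue]
    ring
  have hflow (t : ℝ) (ht : 0 < t) := shiftFlow_mem_and_le h₁ h₂ hκ₁ hκ₂ (hx.mem0 t)
    (fun h => hα t h ht) (fun h => hβ t h ht)
  have hreward (t : ℝ) (ht : 0 ≤ t) :
      promisedValue r x t + δ * (κ * promisedValue r (shiftFlow r B₁ B₂) t) ∈ I1 ∧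
        f1 (promisedValue r x t) + c t * (δ * (κ * promisedValue r (shiftFlow r B₁ B₂) t))
          ≤ f1 (promisedValue r x t + δ * (κ * promisedValue r (shiftFlow r B₁ B₂) t)) := by
    by_cases h : t ∈ Ioo s₁ t₂
    · exact (hpromise t h ht).mul_mem_and_le (hκ₃ t)
    · simpa only [promisedValue_shiftFlow_eq_zero hr h₁ h₂ h, mul_zero, add_zero, le_refl, and_true]
        using hx.mem1 t ht
  have hsize : IsBoundedMeasurable fun t => κ * promisedValue r (shiftFlow r B₁ B₂) t :=
    .of_mem_Icc ((continuous_promisedValue hr hd).measurable.const_mul κ) hκ₃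
  have hopt := hx.optimal _ _ _ (hx.isBoundedMeasurable.add (hd.const_mul (δ * κ)))
    (((hd₂.const_mul β).sub (hd₁.const_mul α)).const_mul (δ * κ)) (hc.mul (hsize.const_mul δ))
    (fun t ht => (hflow t ht).1) (fun t ht => hvalue t ▸ (hreward t ht).1)
    (fun t ht => (hflow t ht).2) (fun t ht => hvalue t ▸ (hreward t ht).2)
  refine nonpos_of_mul_nonpos_right ?_ hκ
  rw [← integral_const_mul, ← integral_const_mul]
  refine (integral_congr_ae ?_).trans_le hopt
  filter_upwards [hG.ae_nonneg] with τ hτ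
  have hβα := (hd₂.const_mul β).sub (hd₁.const_mul α)
  rw [headValue_eq hr hd₁ hτ, headValue_eq hr hd₂ hτ, headValue_eq hr (hβα.const_mul _) hτ,
    promisedValue]
  simp only [tailValue_const_mul, tailValue_sub hr (hd₂.const_mul β) (hd₁.const_mul α)]
  linear_combination
    -(c τ * δ * κ * tailValue r (shiftFlow r B₁ B₂) τ) * exp_mul_exp_neg r τ

lemma tendsto_integral_mul_tailValue_unitFlow (hr : 0 < r) [IsFiniteMeasure G]
    {B : ℕ → Set ℝ} {a : ℕ → ℝ} {t : ℝ} (hB : ∀ n, IsWindow (B n) (a n) t)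
    (ha : Tendsto a atTop (nhds t)) (hc : IsBoundedMeasurable c) :
    Tendsto (fun n => ∫ τ, c τ * tailValue r (unitFlow r (B n)) τ ∂G) atTop
      (nhds (∫ τ in Iio t, c τ ∂G)) := by
  obtain ⟨C, hC⟩ := hc.bounded
  rw [← integral_indicator measurableSet_Iio]
  refine tendsto_integral_of_dominated_convergence (fun _ => C) (fun n => ?_)
    (integrable_const C) (fun n => .of_forall fun τ => ?_) (.of_forall fun τ => ?_)
  · exact (hc.measurable.mul (continuous_tailValue hr
      (hB n).isBoundedMeasurable_unitFlow).measurable).aestronglyMeasurable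
  · have hm := (hB n).tailValue_unitFlow_mem_Icc hr τ
    rw [norm_mul, Real.norm_of_nonneg hm.1]
    exact (mul_le_of_le_one_right (norm_nonneg _) hm.2).trans (hC τ)
  · refine tendsto_const_nhds.congr' ?_
    rcases lt_or_ge τ t with h | h
    · filter_upwards [ha.eventually_const_le h] with n hn
      rw [(hB n).tailValue_unitFlow_of_le hr hn, mul_one, indicator_of_mem (mem_Iio.2 h)]
    · refine .of_forall fun n => ?_
      beta_reduce
      rw [(hB n).tailValue_unitFlow_of_ge h, mul_zero, indicator_of_notMem (notMem_Iio.2 h)]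

lemma IsOptimalFlow.shift_of_nonneg (hr : 0 < r) (hG : IsUnboundedDistribution G)
    (hx : IsOptimalFlow r I0 I1 f0 f1 G x) {a₁ a₂ : ℝ} (h₁ : IsWindow B₁ a₁ t₁)
    (h₂ : IsWindow B₂ a₂ t₂) (hs₁ : s₁ ≤ a₁) (ht₁ : 0 ≤ t₁) (ht : t₁ ≤ a₂) (hα₁ : α ≠ 0 → 0 ≤ a₁)
    (hc : IsBoundedMeasurable c)
    (hα : ∀ t ∈ B₁, 0 < t → HasMarginalValue I0 f0 (-δ) (x t) α)
    (hβ : ∀ t ∈ B₂, 0 < t → HasMarginalValue I0 f0 δ (x t) β)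
    (hpromise : ∀ t ∈ Ioo s₁ t₂, 0 ≤ t → HasMarginalValue I1 f1 δ (promisedValue r x t) (c t)) :
    δ * (β * (1 - ∫ τ, 1 * tailValue r (unitFlow r B₂) τ ∂G)
      - α * (1 - ∫ τ, 1 * tailValue r (unitFlow r B₁) τ ∂G)
      + (∫ τ, c τ * tailValue r (unitFlow r B₂) τ ∂G
        - ∫ τ, c τ * tailValue r (unitFlow r B₁) τ ∂G)) ≤ 0 := by
  have := hG.prob
  have hT₁ := h₁.isBoundedMeasurable_tailValue_unitFlow hr
  have hT₂ := h₂.isBoundedMeasurable_tailValue_unitFlow hr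
  have h₁' := h₁.mono hs₁
  have h₂' := h₂.mono ht
  refine le_of_eq_of_le ?_ (hx.shift hr hG h₁' h₂' hc hα hβ hpromise)
  have hhead₁ {τ : ℝ} (hτ : 0 ≤ τ) : α * headValue r (unitFlow r B₁) τ
      = α * (1 - tailValue r (unitFlow r B₁) τ) := by
    rcases eq_or_ne α 0 with rfl | hα0
    · rw [zero_mul, zero_mul]
    · rw [h₁.headValue_unitFlow hr (hα₁ hα0) hτ]
  have hint {T : ℝ → ℝ} (hT : IsBoundedMeasurable T) (γ : ℝ) :
      γ * (1 - ∫ τ, 1 * T τ ∂G) = ∫ τ, γ * (1 - T τ) ∂G := by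
    simp only [one_mul, integral_const_mul]
    rw [integral_sub (integrable_const _) (hT.integrable G), integral_const, probReal_univ,
      one_smul]
  have hu₁ := ((IsBoundedMeasurable.const 1).sub hT₁).const_mul α
  have hu₂ := ((IsBoundedMeasurable.const 1).sub hT₂).const_mul β
  have hv₁ := hc.mul hT₁
  have hv₂ := hc.mul hT₂
  rw [hint hT₂, hint hT₁, ← integral_sub (hu₂.integrable G) (hu₁.integrable G),
    ← integral_sub (hv₂.integrable G) (hv₁.integrable G),
    ← integral_add ((hu₂.sub hu₁).integrable G) ((hv₂.sub hv₁).integrable G)]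
  · congr 1
    refine integral_congr_ae ?_
    filter_upwards [hG.ae_nonneg] with τ hτ
    rw [hhead₁ hτ, h₂.headValue_unitFlow hr (ht₁.trans ht) hτ, tailValue_shiftFlow hr h₁' h₂',
      mul_sub (c τ)]

lemma IsOptimalFlow.firstOrderCondition (hr : 0 < r) (hG : IsUnboundedDistribution G)
    (hx : IsOptimalFlow r I0 I1 f0 f1 G x) {S₁ S₂ : Set ℝ} (hS₁ : MeasurableSet S₁)
    (hS₂ : MeasurableSet S₂) (hc : IsBoundedMeasurable c) (ht₁ : 0 ≤ t₁) (hα₁ : t₁ = 0 → α = 0)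
    (hs₁ : s₁ < t₁) (ht : t₁ < t₂) (hleft₁ : HasLeftMass S₁ t₁) (hleft₂ : HasLeftMass S₂ t₂)
    (hα : ∀ t ∈ S₁, 0 < t → HasMarginalValue I0 f0 (-δ) (x t) α)
    (hβ : ∀ t ∈ S₂, 0 < t → HasMarginalValue I0 f0 δ (x t) β)
    (hpromise : ∀ t ∈ Ioo s₁ t₂, 0 ≤ t → HasMarginalValue I1 f1 δ (promisedValue r x t) (c t)) :
    δ * (β * G.real (Ici t₂) - α * G.real (Ici t₁) + ∫ τ in Ico t₁ t₂, c τ ∂G) ≤ 0 := by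
  have := hG.prob
  obtain ⟨a₁, -, ha₁t, ha₁⟩ := exists_seq_strictMono_tendsto t₁
  obtain ⟨a₂, -, ha₂t, ha₂⟩ := exists_seq_strictMono_tendsto t₂
  have hB₁ (n : ℕ) := hleft₁.isWindow hS₁ (ha₁t n)
  have hB₂ (n : ℕ) := hleft₂.isWindow hS₂ (ha₂t n)
  have hone := IsBoundedMeasurable.const (α := ℝ) 1
  have hlimits {c : ℝ → ℝ} (hc : IsBoundedMeasurable c) :=
    And.intro (tendsto_integral_mul_tailValue_unitFlow (G := G) hr hB₁ ha₁ hc)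
      (tendsto_integral_mul_tailValue_unitFlow (G := G) hr hB₂ ha₂ hc)
  have hlim := (((((hlimits hone).2.const_sub 1).const_mul β).sub
    (((hlimits hone).1.const_sub 1).const_mul α)).add
      ((hlimits hc).2.sub (hlimits hc).1)).const_mul δ
  have hIci (t : ℝ) : 1 - ∫ _ in Iio t, (1 : ℝ) ∂G = G.real (Ici t) := by
    rw [setIntegral_const, smul_eq_mul, mul_one, ← compl_Iio, probReal_compl_eq_one_sub
      measurableSet_Iio]
  have hIco : (∫ τ in Iio t₂, c τ ∂G) - ∫ τ in Iio t₁, c τ ∂G = ∫ τ in Ico t₁ t₂, c τ ∂G := by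
    rw [← Iio_union_Ico_eq_Iio ht.le, setIntegral_union (Iio_disjoint_Ici le_rfl |>.mono_right
      Ico_subset_Ici_self) measurableSet_Ico (hc.integrable G).integrableOn
      (hc.integrable G).integrableOn, add_sub_cancel_left]
  rw [hIci, hIci, hIco] at hlim
  refine le_of_tendsto hlim ?_
  filter_upwards [ha₁.eventually_const_le hs₁, ha₂.eventually_const_le ht,
    eventually_imp_distrib_left.2 fun h : α ≠ 0 =>
      ha₁.eventually_const_le (ht₁.lt_of_ne' (mt hα₁ h))] with n hs hn h0
  exact hx.shift_of_nonneg hr hG (hB₁ n) (hB₂ n) hs ht₁ hn h0 hc (fun t h => hα t h.1)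
    (fun t h => hβ t h.1) hpromise

end Shift

section Monotone

variable {a b : ℝ} {c : ℝ → ℝ} {G : Measure ℝ}

lemma exists_isBoundedMeasurable_eqOn_of_monotoneOn (hab : a ≤ b) (hc : MonotoneOn c (Icc a b)) :
    ∃ c', IsBoundedMeasurable c' ∧ EqOn c' c (Icc a b) := by
  have hmono : Monotone ((Icc a b).domRestrict c) := monotoneOn_iff_monotone.1 hc
  refine ⟨IccExtend hab ((Icc a b).domRestrict c), .of_mem_Icc (a := c a) (b := c b)
    (hmono.IccExtend hab).measurable (fun t => ⟨?_, ?_⟩), fun t ht => IccExtend_of_mem hab _ ht⟩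
  · exact hc ⟨le_rfl, hab⟩ (projIcc a b hab t).2 (projIcc a b hab t).2.1
  · exact hc (projIcc a b hab t).2 ⟨hab, le_rfl⟩ (projIcc a b hab t).2.2

lemma exists_le_of_add_le_setIntegral_of_monotoneOn [IsFiniteMeasure G] (hab : a < b)
    {α B ε : ℝ} (hε : 0 < ε) :
    ∃ t ∈ Ioo a b, ∀ c : ℝ → ℝ, MonotoneOn c (Icc a b) → c b ≤ B →
      α * G.real (Ico a b) + ε ≤ ∫ τ in Ico a b, c τ ∂G → α ≤ c t := by
  obtain ⟨t, ht, hGt⟩ := exists_measureReal_Ico_lt G hab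
    (show 0 < ε / (|B - α| + 1) by positivity)
  rw [lt_div_iff₀ (by positivity)] at hGt
  refine ⟨t, ht, fun c hc hcB hint => ?_⟩
  by_contra! hlt
  have htmem : t ∈ Icc a b := Ioo_subset_Icc_self ht
  have hleft : Ico a t ⊆ Icc a b := Ico_subset_Icc_self.trans (Icc_subset_Icc_right ht.2.le)
  have hright : Ico t b ⊆ Icc a b := Ico_subset_Icc_self.trans (Icc_subset_Icc_left ht.1.le)
  have hcint : IntegrableOn c (Icc a b) G := hc.integrableOn_of_measure_ne_top
    (isLeast_Icc hab.le) (isGreatest_Icc hab.le) (measure_ne_top _ _) measurableSet_Icc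
  have hsplit : ∫ τ in Ico a b, c τ ∂G ≤ α * G.real (Ico a t) + B * G.real (Ico t b) := by
    rw [← Ico_union_Ico_eq_Ico ht.1.le ht.2.le, setIntegral_union Ico_disjoint_Ico_same
      measurableSet_Ico (hcint.mono_set hleft) (hcint.mono_set hright)]
    refine add_le_add ?_ ?_
    · refine (setIntegral_mono_on (hcint.mono_set hleft) (integrableOn_const (C := α))
        measurableSet_Ico fun τ hτ => ?_).trans_eq ?_
      · exact (hc (hleft hτ) htmem hτ.2.le).trans hlt.le
      · rw [setIntegral_const, smul_eq_mul, mul_comm]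
    · refine (setIntegral_mono_on (hcint.mono_set hright) (integrableOn_const (C := B))
        measurableSet_Ico fun τ hτ => ?_).trans_eq ?_
      · exact (hc (hright hτ) ⟨hab.le, le_rfl⟩ hτ.2.le).trans hcB
      · rw [setIntegral_const, smul_eq_mul, mul_comm]
  have hadd : G.real (Ico a b) = G.real (Ico a t) + G.real (Ico t b) := by
    rw [← Ico_union_Ico_eq_Ico ht.1.le ht.2.le, measureReal_union Ico_disjoint_Ico_same
      measurableSet_Ico]
  have habs := mul_le_mul_of_nonneg_right (le_abs_self (B - α))
    (measureReal_nonneg (μ := G) (s := Ico t b))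
  have hnonneg := measureReal_nonneg (μ := G) (s := Ico t b)
  rw [hadd] at hint
  linarith

lemma secant_monotoneOn {I J : Set ℝ} {f X Y : ℝ → ℝ} (hf : ConcaveOn ℝ I f) (hX : AntitoneOn X J)
    (hY : AntitoneOn Y J) (hXI : ∀ t ∈ J, X t ∈ I) (hYI : ∀ t ∈ J, Y t ∈ I)
    (hXY : ∀ t ∈ J, X t < Y t) :
    MonotoneOn (fun t => (f (Y t) - f (X t)) / (Y t - X t)) J :=
  fun s hs t ht hst => secant_anti_of_concaveOn hf (hXI t ht) (hYI s hs) (hXY t ht) (hXY s hs)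
    (hX hs ht hst) (hY hs ht hst)

end Monotone

section FlowMonotone

variable {r u0 v w α β δ s₁ t₁ t₂ : ℝ} {I0 I1 S₁ S₂ : Set ℝ} {f0 f1 c x : ℝ → ℝ} {G : Measure ℝ}

lemma IsRealFrontier.exists_hasMarginalValue_of_lt (h0 : IsRealFrontier u0 I0 f0)
    (hf0 : StrictConcaveOn ℝ I0 f0) (hv : 0 ≤ v) (hvw : v < w) (hw : w ∈ I0) :
    ∃ m ∈ I0, m < w ∧ ∃ α δ, (f0 w - f0 m) / (w - m) < α ∧ 0 < δ ∧
      (∀ u ∈ I0, u ≤ v → HasMarginalValue I0 f0 δ u α) ∧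
      ∀ u ∈ I0, w ≤ u → HasMarginalValue I0 f0 (-δ) u ((f0 w - f0 m) / (w - m)) := by
  obtain ⟨m, hvm, hmw⟩ := exists_between hvw
  obtain ⟨l, hvl, hlm⟩ := exists_between hvm
  have hm : m ∈ I0 := h0.mem_of_pos_of_le (hv.trans_lt hvm) hmw.le hw
  have hl : l ∈ I0 := h0.mem_of_pos_of_le (hv.trans_lt hvl) hlm.le hm
  have hδ : 0 < min (m - l) (w - m) := lt_min (sub_pos.2 hlm) (sub_pos.2 hmw)
  refine ⟨m, hm, hmw, (f0 m - f0 l) / (m - l), min (m - l) (w - m),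
    hf0.slope_anti_adjacent hl hw hlm hmw, hδ, fun u hu huv => ?_, fun u hu hwu => ?_⟩
  · exact (hasMarginalValue_of_le h0.concave hu hm (huv.trans hvl.le) hlm).mono
      (Icc_subset_uIcc ⟨hδ.le, min_le_left _ _⟩)
  · refine (hasMarginalValue_of_ge h0.concave hm hu hwu hmw).mono (Icc_subset_uIcc' ⟨?_, ?_⟩)
    · linarith [min_le_right (m - l) (w - m)]
    · exact neg_nonpos.2 hδ.le

lemma IsOptimalFlow.firstOrderCondition_of_monotoneOn (hr : 0 < r) (hG : IsUnboundedDistribution G)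
    (hx : IsOptimalFlow r I0 I1 f0 f1 G x) (hS₁ : MeasurableSet S₁) (hS₂ : MeasurableSet S₂)
    (hc : MonotoneOn c (Icc s₁ t₂)) (ht₁ : 0 ≤ t₁) (hα₁ : t₁ = 0 → α = 0) (hs₁ : s₁ < t₁)
    (ht : t₁ < t₂) (hleft₁ : HasLeftMass S₁ t₁) (hleft₂ : HasLeftMass S₂ t₂)
    (hα : ∀ t ∈ S₁, 0 < t → HasMarginalValue I0 f0 (-δ) (x t) α)
    (hβ : ∀ t ∈ S₂, 0 < t → HasMarginalValue I0 f0 δ (x t) β)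
    (hpromise : ∀ t ∈ Ioo s₁ t₂, 0 ≤ t → HasMarginalValue I1 f1 δ (promisedValue r x t) (c t)) :
    δ * (β * G.real (Ici t₂) - α * G.real (Ici t₁) + ∫ τ in Ico t₁ t₂, c τ ∂G) ≤ 0 := by
  obtain ⟨c', hc', heq⟩ := exists_isBoundedMeasurable_eqOn_of_monotoneOn (hs₁.trans ht).le hc
  have hIco : EqOn c c' (Ico t₁ t₂) :=
    fun t h => (heq ⟨hs₁.le.trans h.1, h.2.le⟩).symm
  rw [setIntegral_congr_fun measurableSet_Ico hIco]
  exact hx.firstOrderCondition hr hG hS₁ hS₂ hc' ht₁ hα₁ hs₁ ht hleft₁ hleft₂ hα hβ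
    fun t h h0 => (heq (Ioo_subset_Icc_self h)).symm ▸ hpromise t h h0

lemma ae_le_of_promisedValue_eq (hr : 0 < r) (hx : IsBoundedMeasurable x) {a b k : ℝ}
    (h : ∀ t ∈ Ioo a b, promisedValue r x t = k) : ∀ᵐ s, s ∈ Ioo a b → x s ≤ k := by
  refine ae_le_of_tailValue_sub_le hr hx (.const k) fun s t has hst htb => ?_
  rw [tailValue_eq_exp_mul_promisedValue, tailValue_eq_exp_mul_promisedValue,
    h s ⟨has, hst.trans htb⟩, h t ⟨has.trans hst, htb⟩, tailValue_const hr, tailValue_const hr,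
    mul_comm k, mul_comm k]

lemma ae_promisedValue_le (hr : 0 < r) (hx : IsBoundedMeasurable x) {a b : ℝ}
    (hanti : AntitoneOn (promisedValue r x) (Icc a b)) :
    ∀ᵐ s, s ∈ Ioo a b → promisedValue r x b ≤ x s := by
  refine ae_le_of_tailValue_sub_le hr (.const _) hx fun s t has hst htb => ?_
  have hs : s ∈ Icc a b := ⟨has.le, (hst.trans htb).le⟩
  have ht : t ∈ Icc a b := ⟨(has.trans hst).le, htb.le⟩
  have hst' := hanti hs ht hst.le
  have htb' := hanti ht ⟨(has.trans (hst.trans htb)).le, le_rfl⟩ htb.le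
  have hexp : exp (-r * t) ≤ exp (-r * s) := Real.exp_le_exp.2 (by nlinarith)
  rw [tailValue_const hr, tailValue_const hr, tailValue_eq_exp_mul_promisedValue,
    tailValue_eq_exp_mul_promisedValue]
  nlinarith [Real.exp_pos (-r * s)]

lemma promisedValue_lt_of_hasLeftMass (hr : 0 < r) (hx : IsBoundedMeasurable x) {a b : ℝ}
    (hab : a < b) (hanti : AntitoneOn (promisedValue r x) (Icc a b))
    (hleft : HasLeftMass {t | w ≤ x t} b) (hw : promisedValue r x b < w) :
    promisedValue r x b < promisedValue r x a := by
  have ha : a ∈ Icc a b := ⟨le_rfl, hab.le⟩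
  have hb : b ∈ Icc a b := ⟨hab.le, le_rfl⟩
  refine (hanti ha hb hab.le).lt_of_ne fun heq => ?_
  have hae := ae_le_of_promisedValue_eq hr hx (a := a) (b := b) (k := promisedValue r x b)
    fun s hs => le_antisymm
      ((hanti ha (Ioo_subset_Icc_self hs) hs.1.le).trans_eq heq.symm)
      (hanti (Ioo_subset_Icc_self hs) hb hs.2.le)
  obtain ⟨u, hu, hwu, hle⟩ := hleft.exists_mem hab hae
  exact (hw.trans_le hwu).not_ge (hle hu)

lemma IsOptimalFlow.exists_le_secant (hr : 0 < r) (h1 : IsRealFrontier u0 I1 f1)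
    (hG : IsUnboundedDistribution G) (hx : IsOptimalFlow r I0 I1 f0 f1 G x)
    (hanti : AntitoneOn (promisedValue r x) (Ici 0)) (hS₁ : MeasurableSet S₁)
    (hS₂ : MeasurableSet S₂) (ht₁ : 0 < t₁) (ht : t₁ < t₂) (hleft₁ : HasLeftMass S₁ t₁)
    (hleft₂ : HasLeftMass S₂ t₂) (hβα : β < α) (hδ : 0 < δ) (hδ₂ : δ < promisedValue r x t₂)
    (hα : ∀ t ∈ S₁, HasMarginalValue I0 f0 δ (x t) α)
    (hβ : ∀ t ∈ S₂, HasMarginalValue I0 f0 (-δ) (x t) β) :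
    ∃ t ∈ Ioo t₁ t₂, ∀ d ∈ Ioc 0 δ, α ≤ (f1 (promisedValue r x t)
      - f1 (promisedValue r x t - d)) / (promisedValue r x t - (promisedValue r x t - d)) := by
  have := hG.prob
  set X := promisedValue r x
  set b : ℝ → ℝ → ℝ := fun d t => (f1 (X t) - f1 (X t - d)) / (X t - (X t - d))
  have hX : AntitoneOn X (Icc 0 t₂) := hanti.mono Icc_subset_Ici_self
  have ht₂ : t₂ ∈ Icc 0 t₂ := ⟨(ht₁.trans ht).le, le_rfl⟩
  have hmem {t : ℝ} (h : t ∈ Icc 0 t₂) : X t ∈ I1 := hx.mem1 t h.1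
  have hmem' {d t : ℝ} (hd : d ∈ Ioc 0 δ) (h : t ∈ Icc 0 t₂) : X t - d ∈ I1 :=
    h1.mem_of_pos_of_le (by linarith [hX h ht₂ h.2, hd.2]) (sub_le_self _ hd.1.le) (hmem h)
  have hmono {d : ℝ} (hd : d ∈ Ioc 0 δ) : MonotoneOn (b d) (Icc 0 t₂) :=
    secant_monotoneOn h1.concave (fun s hs t ht hst => sub_le_sub_right (hX hs ht hst) d) hX
      (fun _ => hmem' hd) (fun _ => hmem) (fun t _ => sub_lt_self _ hd.1)
  have hgain : 0 < (α - β) * G.real (Ici t₂) := mul_pos (sub_pos.2 hβα) (hG.real_Ici_pos t₂)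
  obtain ⟨t, htmem, hmax⟩ := exists_le_of_add_le_setIntegral_of_monotoneOn (G := G) (α := α)
    (B := b δ t₂) ht hgain
  refine ⟨t, htmem, fun d hd => hmax (b d) ((hmono hd).mono (Icc_subset_Icc_left ht₁.le)) ?_ ?_⟩
  · exact secant_anti_of_concaveOn h1.concave (hmem' ⟨hδ, le_rfl⟩ ht₂) (hmem ht₂)
      (sub_lt_self _ hδ) (sub_lt_self _ hd.1) (sub_le_sub_left hd.2 _) le_rfl
  · have hfoc := hx.firstOrderCondition_of_monotoneOn hr hG hS₁ hS₂ (hmono hd) (δ := -d) (α := α)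
      (β := β) ht₁.le (fun h => absurd h ht₁.ne') ht₁ ht hleft₁ hleft₂
      (fun t h _ => (hα t h).mono (by rw [neg_neg]; exact Icc_subset_uIcc ⟨hd.1.le, hd.2⟩))
      (fun t h _ => (hβ t h).mono
        (Icc_subset_uIcc' ⟨neg_le_neg hd.2, neg_nonpos.2 hd.1.le⟩))
      (fun t h _ => by
        have htI : t ∈ Icc 0 t₂ := Ioo_subset_Icc_self h
        simpa only [sub_sub_cancel_left] using hasMarginalValue_of_ge h1.concave (hmem' hd htI)
          (hmem htI) le_rfl (sub_lt_self (X t) hd.1))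
    rw [neg_mul, neg_nonpos, mul_nonneg_iff_of_pos_left hd.1] at hfoc
    have hadd := measureReal_Ici_eq_add G ht.le
    rw [hadd] at hfoc
    linarith

lemma IsOptimalFlow.not_hasLeftMass_of_le_secant (hr : 0 < r) (h1 : IsRealFrontier u0 I1 f1)
    (hG : IsUnboundedDistribution G) (hx : IsOptimalFlow r I0 I1 f0 f1 G x)
    (hanti : AntitoneOn (promisedValue r x) (Ici 0)) (hS₁ : MeasurableSet S₁)
    (hS₂ : MeasurableSet S₂) {t t' : ℝ} (ht' : 0 ≤ t') (htt' : t' < t)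
    (hleft₂ : HasLeftMass S₂ t) (hβα : β < α) (hδ : 0 < δ)
    (hα : ∀ s ∈ S₁, HasMarginalValue I0 f0 δ (x s) α)
    (hβ : ∀ s ∈ S₂, HasMarginalValue I0 f0 (-δ) (x s) β)
    (hlt : promisedValue r x t < promisedValue r x t')
    (hslope : ∀ d ∈ Ioc 0 δ, α ≤ (f1 (promisedValue r x t') - f1 (promisedValue r x t' - d)) /
      (promisedValue r x t' - (promisedValue r x t' - d)))
    {t₃ : ℝ} (ht₃ : t < t₃) : ¬ HasLeftMass S₁ t₃ := by
  intro hleft₁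
  have := hG.prob
  set X := promisedValue r x
  obtain ⟨m, hm, hmt'⟩ := exists_between hlt
  obtain ⟨s, hs, hsm⟩ : ∃ s ∈ Ioo t' t, X s < m := by
    have hev := ((continuous_promisedValue hr hx.isBoundedMeasurable).continuousWithinAt
      (s := Iio t)).eventually_lt_const hm
    obtain ⟨s, hsm, hs⟩ := (hev.and (Ioo_mem_nhdsLT htt')).exists
    exact ⟨s, hs, hsm⟩
  have hs0 : 0 < s := ht'.trans_lt hs.1
  set d := min δ (X t' - m)
  have hd : d ∈ Ioc 0 δ := ⟨lt_min hδ (sub_pos.2 hmt'), min_le_left _ _⟩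
  have hk : X t' ∈ I1 := hx.mem1 t' ht'
  have hfoc := hx.firstOrderCondition hr hG hS₂ hS₁ (.const _) (s₁ := s) (δ := d) (α := β)
    (β := α) (hs0.trans hs.2).le (fun h => absurd h (hs0.trans hs.2).ne') hs.2 ht₃ hleft₂ hleft₁
    (fun u h _ => (hβ u h).mono (Icc_subset_uIcc' ⟨neg_le_neg hd.2, neg_nonpos.2 hd.1.le⟩))
    (fun u h _ => (hα u h).mono (Icc_subset_uIcc ⟨hd.1.le, hd.2⟩))
    (fun u hu h0 => by
      have hXu : X u ≤ m := (hanti hs0.le h0 hu.1.le).trans hsm.le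
      simpa only [sub_sub_cancel] using hasMarginalValue_of_le h1.concave (hx.mem1 u h0) hk
        (show X u ≤ X t' - d by linarith [min_le_right δ (X t' - m)]) (sub_lt_self _ hd.1))
  rw [setIntegral_const, smul_eq_mul] at hfoc
  have hslope_d := hslope d hd
  rw [sub_sub_cancel] at hslope_d
  have hfoc := nonpos_of_mul_nonpos_right hfoc hd.1
  have hadd := measureReal_Ici_eq_add G ht₃.le
  have hgain := mul_pos (sub_pos.2 hβα) (hG.real_Ici_pos t)
  have hmid := mul_le_mul_of_nonneg_left hslope_d (measureReal_nonneg (μ := G) (s := Ico t t₃))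
  have hmul : α * G.real (Ici t) = α * G.real (Ico t t₃) + α * G.real (Ici t₃) := by
    rw [hadd, mul_add]
  linarith

lemma IsOptimalFlow.not_hasLeftMass_of_pos (hr : 0 < r) (h0 : IsRealFrontier u0 I0 f0)
    (h1 : IsRealFrontier u0 I1 f1) (hf0 : StrictConcaveOn ℝ I0 f0)
    (hG : IsUnboundedDistribution G) (hx : IsOptimalFlow r I0 I1 f0 f1 G x)
    (hanti : AntitoneOn (promisedValue r x) (Ici 0)) (hvw : v < w) (ht₁ : 0 < t₁)
    (ht : t₁ < t₂) (hX₂ : 0 < promisedValue r x t₂) (hleft₁ : HasLeftMass {t | x t ≤ v} t₁) :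
    ¬ HasLeftMass {t | w ≤ x t} t₂ := by
  intro hleft₂
  have hxb := hx.isBoundedMeasurable
  have hS₁ : MeasurableSet {t | x t ≤ v} := measurableSet_le hxb.measurable measurable_const
  have hS₂ : MeasurableSet {t | w ≤ x t} := measurableSet_le measurable_const hxb.measurable
  have hXv : promisedValue r x t₂ ≤ v := by
    obtain ⟨s, hs, hsv, hle⟩ := hleft₁.exists_mem ht₁
      (ae_promisedValue_le hr hxb (hanti.mono (Icc_subset_Ici_self : Icc 0 t₁ ⊆ _)))
    exact (hanti ht₁.le (ht₁.trans ht).le ht.le).trans ((hle hs).trans hsv)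
  have hv : 0 < v := hX₂.trans_le hXv
  obtain ⟨u, -, hwu, -⟩ := hleft₂.exists_mem ht (.of_forall fun _ => trivial)
  obtain ⟨m, -, -, α, δ, hβα, hδ, hα, hβ⟩ := h0.exists_hasMarginalValue_of_lt hf0 hv.le hvw
    (h0.mem_of_pos_of_le (hv.trans hvw) hwu (hx.mem0 u))
  set η := min δ (promisedValue r x t₂ / 2)
  have hη : 0 < η := lt_min hδ (half_pos hX₂)
  have hηδ : η ≤ δ := min_le_left _ _
  replace hα := fun t (h : x t ≤ v) => (hα (x t) (hx.mem0 t) h).mono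
    (Icc_subset_uIcc ⟨hη.le, hηδ⟩)
  replace hβ := fun t (h : w ≤ x t) => (hβ (x t) (hx.mem0 t) h).mono
    (Icc_subset_uIcc' ⟨neg_le_neg hηδ, neg_nonpos.2 hη.le⟩)
  obtain ⟨t', ht', hslope⟩ := hx.exists_le_secant hr h1 hG hanti hS₁ hS₂ ht₁ ht hleft₁ hleft₂ hβα
    hη ((min_le_right _ _).trans_lt (half_lt_self hX₂)) hα hβ
  have ht'0 : 0 < t' := ht₁.trans ht'.1
  have hlt := promisedValue_lt_of_hasLeftMass hr hxb ht'.2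
    (hanti.mono (Icc_subset_Ici_self.trans (Ici_subset_Ici.2 ht'0.le))) hleft₂ (hXv.trans_lt hvw)
  have hae : ∀ᵐ t, t₂ < t → v < x t := by
    filter_upwards [ae_hasLeftMass {t | x t ≤ v}] with t hleft htt
    by_contra! hle
    exact hx.not_hasLeftMass_of_le_secant hr h1 hG hanti hS₁ hS₂ ht'0.le ht'.2 hleft₂ hβα hη hα hβ
      hlt hslope htt (hleft hle)
  have htail := mul_exp_lt_tailValue hr hxb hae
  rw [tailValue_eq_exp_mul_promisedValue, mul_comm] at htail
  exact (lt_of_mul_lt_mul_left htail (Real.exp_pos _).le).not_ge hXv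

lemma IsOptimalFlow.not_hasLeftMass (hr : 0 < r) (h0 : IsRealFrontier u0 I0 f0)
    (h1 : IsRealFrontier u0 I1 f1) (hf0 : StrictConcaveOn ℝ I0 f0)
    (hG : IsUnboundedDistribution G) (hx : IsOptimalFlow r I0 I1 f0 f1 G x)
    (hanti : AntitoneOn (promisedValue r x) (Ici 0)) (hvw : v < w) (ht₁ : 0 < t₁)
    (ht : t₁ < t₂) (hleft₁ : HasLeftMass {t | x t ≤ v} t₁) :
    ¬ HasLeftMass {t | w ≤ x t} t₂ := by
  intro hleft₂
  rcases lt_or_ge 0 (promisedValue r x t₂) with hX | hX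
  · exact hx.not_hasLeftMass_of_pos hr h0 h1 hf0 hG hanti hvw ht₁ ht hX hleft₁ hleft₂
  obtain ⟨u, -, hu, -⟩ := hleft₁.exists_mem ht₁ (.of_forall fun _ => trivial)
  have hw : 0 < w := ((h0.subset_Icc (hx.mem0 u)).1.trans hu).trans_lt hvw
  obtain ⟨t, ht', hleft⟩ := hleft₂.exists_lt ht
  have hX₂ : 0 ≤ promisedValue r x t₂ := (h1.subset_Icc (hx.mem1 t₂ (ht₁.trans ht).le)).1
  have hXt := promisedValue_lt_of_hasLeftMass hr hx.isBoundedMeasurable ht'.2 (hanti.mono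
    (Icc_subset_Ici_self.trans (Ici_subset_Ici.2 (ht₁.trans ht'.1).le))) hleft₂ (hX.trans_lt hw)
  exact hx.not_hasLeftMass_of_pos hr h0 h1 hf0 hG hanti hvw ht₁ ht'.1 (hX₂.trans_lt hXt) hleft₁
    hleft

end FlowMonotone

/-! ### Monotone likelihood ratios -/

section MonotoneLikelihoodRatio

variable {G G' : Measure ℝ}

lemma two_mul_lintegral_mul_lintegral {α : Type*} [MeasurableSpace α] {μ : Measure α} [SFinite μ]
    {a b : α → ℝ≥0∞} (ha : Measurable a) (hb : Measurable b) :
    2 * ((∫⁻ s, a s ∂μ) * ∫⁻ s, b s ∂μ) =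
      ∫⁻ p : α × α, a p.1 * b p.2 + b p.1 * a p.2 ∂μ.prod μ := by
  rw [lintegral_add_left (by fun_prop), lintegral_prod_mul ha.aemeasurable hb.aemeasurable,
    lintegral_prod_mul hb.aemeasurable ha.aemeasurable, mul_comm (∫⁻ s, b s ∂μ), two_mul]

-- Chebyshev's argument: symmetrising both double integrals, the inequality holds pointwise.
lemma lintegral_mul_mul_lintegral_le {μ : Measure ℝ} [SFinite μ] {T : Set ℝ}
    {g g' k : ℝ → ℝ≥0∞} (hg : Measurable g) (hg' : Measurable g') (hk : Measurable k)
    (hratio : ∀ s ∈ T, ∀ t ∈ T, s ≤ t → g s * g' t ≤ g t * g' s) (hanti : AntitoneOn k T) :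
    (∫⁻ s in T, k s * g s ∂μ) * ∫⁻ s in T, g' s ∂μ ≤
      (∫⁻ s in T, k s * g' s ∂μ) * ∫⁻ s in T, g s ∂μ := by
  rw [← ENNReal.mul_le_mul_iff_right two_ne_zero ENNReal.ofNat_ne_top,
    two_mul_lintegral_mul_lintegral (a := fun s => k s * g s) (hk.mul hg) hg',
    two_mul_lintegral_mul_lintegral (a := fun s => k s * g' s) (hk.mul hg') hg,
    Measure.prod_restrict]
  have hpair : ∀ s ∈ T, ∀ t ∈ T, s ≤ t →
      k s * g s * g' t + g' s * (k t * g t) ≤ k s * g' s * g t + g s * (k t * g' t) := by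
    intro s hs t ht hst
    obtain ⟨d, hd⟩ := exists_add_of_le (hratio s hs t ht hst)
    calc k s * g s * g' t + g' s * (k t * g t)
        = k s * (g s * g' t) + k t * (g t * g' s) := by ring
      _ = k s * (g s * g' t) + k t * (g s * g' t) + k t * d := by rw [hd]; ring
      _ ≤ k s * (g s * g' t) + k t * (g s * g' t) + k s * d := by gcongr; exact hanti hs ht hst
      _ = k s * (g t * g' s) + k t * (g s * g' t) := by rw [hd]; ring
      _ = k s * g' s * g t + g s * (k t * g' t) := by ring
  refine setLIntegral_mono (by fun_prop) fun p hp => ?_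
  rcases le_total p.1 p.2 with h | h
  · exact hpair p.1 hp.1 p.2 hp.2 h
  · convert hpair p.2 hp.2 p.1 hp.1 h using 1 <;> ring

lemma setLIntegral_withDensity_eq_setLIntegral_inter {μ : Measure ℝ} {g k : ℝ → ℝ≥0∞} {S T : Set ℝ}
    (hg : Measurable g) (hk : Measurable k) (hS : MeasurableSet S) (hT : MeasurableSet T)
    (hae : ∀ᵐ s ∂μ.withDensity g, s ∈ T) :
    ∫⁻ s in S, k s ∂μ.withDensity g = ∫⁻ s in S ∩ T, k s * g s ∂μ := by
  have hinter : S =ᵐ[μ.withDensity g] (S ∩ T : Set ℝ) := by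
    filter_upwards [hae] with s hs
    exact propext ⟨fun h => ⟨h, hs⟩, And.left⟩
  rw [Measure.restrict_congr_set hinter,
    setLIntegral_withDensity_eq_setLIntegral_mul _ hg hk (hS.inter hT)]
  simp only [Pi.mul_apply, mul_comm]

lemma MLRDominates.lintegral_le (h : MLRDominates G G') {k : ℝ → ℝ≥0∞} {t : ℝ}
    (hk : Measurable k) (hanti : AntitoneOn k (Ici t)) :
    (∫⁻ s in Ici t, k s ∂G) * G' (Ici t) ≤ (∫⁻ s in Ici t, k s ∂G') * G (Ici t) := by
  obtain ⟨g, g', hg, hg', hGg, hGg', hratio⟩ := h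
  set T := G.support ∪ G'.support
  have hT : MeasurableSet T :=
    (Measure.isClosed_support.union Measure.isClosed_support).measurableSet
  have hGT : ∀ᵐ s ∂G, s ∈ T := mem_of_superset Measure.support_mem_ae subset_union_left
  have hGT' : ∀ᵐ s ∂G', s ∈ T := mem_of_superset Measure.support_mem_ae subset_union_right
  have hG {j : ℝ → ℝ≥0∞} (hj : Measurable j) :
      ∫⁻ s in Ici t, j s ∂G = ∫⁻ s in Ici t ∩ T, j s * g s := by
    rw [hGg] at hGT ⊢
    exact setLIntegral_withDensity_eq_setLIntegral_inter hg.coe_nnreal_ennreal hj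
      measurableSet_Ici hT hGT
  have hG' {j : ℝ → ℝ≥0∞} (hj : Measurable j) :
      ∫⁻ s in Ici t, j s ∂G' = ∫⁻ s in Ici t ∩ T, j s * g' s := by
    rw [hGg'] at hGT' ⊢
    exact setLIntegral_withDensity_eq_setLIntegral_inter hg'.coe_nnreal_ennreal hj
      measurableSet_Ici hT hGT'
  rw [← setLIntegral_one (μ := G), ← setLIntegral_one (μ := G'), hG hk, hG' hk,
    hG (j := fun _ => 1) measurable_const, hG' (j := fun _ => 1) measurable_const]
  simp only [one_mul]
  exact lintegral_mul_mul_lintegral_le hg.coe_nnreal_ennreal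
    hg'.coe_nnreal_ennreal hk (fun s hs u hu hsu => by exact_mod_cast hratio s hs.2 u hu.2 hsu)
    (hanti.mono inter_subset_left)

lemma MLRDominates.integral_le [IsFiniteMeasure G] [IsFiniteMeasure G'] (h : MLRDominates G G')
    {k : ℝ → ℝ} {t : ℝ} (hk : IsBoundedMeasurable k) (hanti : AntitoneOn k (Ici t))
    (hnonneg : ∀ s, 0 ≤ k s) :
    (∫ s in Ici t, k s ∂G) * G'.real (Ici t) ≤ (∫ s in Ici t, k s ∂G') * G.real (Ici t) := by
  have hle := h.lintegral_le hk.measurable.ennreal_ofReal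
    fun a ha b hb hab => ENNReal.ofReal_le_ofReal (hanti ha hb hab)
  have hfin : ∫⁻ s in Ici t, ENNReal.ofReal (k s) ∂G' ≠ ⊤ :=
    (hk.integrable (G'.restrict (Ici t))).lintegral_lt_top.ne
  rw [integral_eq_lintegral_of_nonneg_ae (.of_forall hnonneg) hk.measurable.aestronglyMeasurable,
    integral_eq_lintegral_of_nonneg_ae (.of_forall hnonneg) hk.measurable.aestronglyMeasurable,
    measureReal_def, measureReal_def, ← ENNReal.toReal_mul, ← ENNReal.toReal_mul]
  exact ENNReal.toReal_mono (ENNReal.mul_ne_top hfin (measure_ne_top _ _)) hle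

lemma exists_crossing_of_monotoneOn {c : ℝ → ℝ} {a b : ℝ} (hab : a ≤ b)
    (hc : MonotoneOn c (Icc a b)) (β : ℝ) :
    ∃ s ∈ Icc a b, (∀ τ ∈ Ico a s, c τ < β) ∧ ∀ τ ∈ Ioo s b, β ≤ c τ := by
  set T := insert a {τ ∈ Icc a b | c τ < β}
  have hT : T ⊆ Icc a b := insert_subset ⟨le_rfl, hab⟩ (sep_subset _ _)
  have haT : a ∈ T := mem_insert _ _
  have hbdd : BddAbove T := bddAbove_Icc.mono hT
  have has : a ≤ sSup T := le_csSup hbdd haT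
  have hsb : sSup T ≤ b := csSup_le ⟨a, haT⟩ fun τ hτ => (hT hτ).2
  refine ⟨sSup T, ⟨has, hsb⟩, fun τ hτ => ?_, fun τ hτ => ?_⟩
  · obtain ⟨τ', rfl | hτ', hlt⟩ := exists_lt_of_lt_csSup ⟨a, haT⟩ hτ.2
    · exact absurd hlt hτ.1.not_gt
    · exact (hc ⟨hτ.1, hτ.2.le.trans hsb⟩ hτ'.1 hlt.le).trans_lt hτ'.2
  · by_contra! hlt
    exact (le_csSup hbdd (.inr ⟨⟨has.trans hτ.1.le, hτ.2.le⟩, hlt⟩)).not_gt hτ.1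

lemma antitoneOn_indicator_sub {c : ℝ → ℝ} {a s β : ℝ} (hc : MonotoneOn c (Ico a s))
    (hle : ∀ τ ∈ Ico a s, c τ ≤ β) :
    AntitoneOn ((Ico a s).indicator fun τ => β - c τ) (Ici a) := by
  intro τ hτ τ' hτ' hττ'
  by_cases h : τ' < s
  · rw [indicator_of_mem (mem_Ico.2 ⟨hτ', h⟩), indicator_of_mem (mem_Ico.2 ⟨hτ, hττ'.trans_lt h⟩)]
    exact sub_le_sub_left (hc ⟨hτ, hττ'.trans_lt h⟩ ⟨hτ', h⟩ hττ') β
  · rw [indicator_of_notMem fun h' => h h'.2]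
    exact indicator_nonneg (fun τ hτ => sub_nonneg.2 (hle τ hτ)) τ

lemma setIntegral_Ici_indicator_sub [IsFiniteMeasure G] {c : ℝ → ℝ} (hc : IsBoundedMeasurable c)
    (a s β : ℝ) : ∫ τ in Ici a, (Ico a s).indicator (fun τ => β - c τ) τ ∂G =
      β * G.real (Ico a s) - ∫ τ in Ico a s, c τ ∂G := by
  rw [setIntegral_indicator measurableSet_Ico, inter_eq_right.2 Ico_subset_Ici_self,
    integral_sub (integrable_const _) (hc.integrable G).integrableOn, setIntegral_const,
    smul_eq_mul, mul_comm]

lemma mul_measureReal_Ico_le_setIntegral [IsFiniteMeasure G] [NullSingletonClass G] {c : ℝ → ℝ}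
    (hc : IsBoundedMeasurable c) {a b β : ℝ} (hle : ∀ τ ∈ Ioo a b, β ≤ c τ) :
    β * G.real (Ico a b) ≤ ∫ τ in Ico a b, c τ ∂G := by
  rw [mul_comm, ← smul_eq_mul, ← setIntegral_const, integral_Ico_eq_integral_Ioo,
    integral_Ico_eq_integral_Ioo]
  exact setIntegral_mono_on (integrable_const _).integrableOn (hc.integrable G).integrableOn
    measurableSet_Ioo hle

-- With `s` the time at which `c` crosses `β`, the hypothesis at `s` bounds the `G'`-integral of
-- the decreasing function `(β - c) 1_{[t₁, s)}`, which conditionally on `[t₁, ∞)` only falls when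
-- `G'` is replaced by `G`.
lemma MLRDominates.rate_nonneg [IsFiniteMeasure G] [IsFiniteMeasure G'] [NullSingletonClass G]
    (h : MLRDominates G G') {c : ℝ → ℝ} {t₁ t₂ α β : ℝ} (hc : IsBoundedMeasurable c)
    (ht : t₁ ≤ t₂) (hmono : MonotoneOn c (Icc t₁ t₂)) (hpos : 0 < G'.real (Ici t₁))
    (hrate : ∀ s ∈ Icc t₁ t₂,
      0 ≤ β * G'.real (Ici s) - α * G'.real (Ici t₁) + ∫ τ in Ico t₁ s, c τ ∂G') :
    0 ≤ β * G.real (Ici t₂) - α * G.real (Ici t₁) + ∫ τ in Ico t₁ t₂, c τ ∂G := by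
  obtain ⟨s, hs, hbelow, habove⟩ := exists_crossing_of_monotoneOn ht hmono β
  have hle := h.integral_le (((IsBoundedMeasurable.const β).sub hc).indicator measurableSet_Ico)
    (antitoneOn_indicator_sub (hmono.mono (Ico_subset_Icc_self.trans (Icc_subset_Icc_right hs.2)))
      fun τ hτ => (hbelow τ hτ).le)
    (indicator_nonneg fun τ hτ => (sub_pos.2 (hbelow τ hτ)).le)
  rw [setIntegral_Ici_indicator_sub hc, setIntegral_Ici_indicator_sub hc] at hle
  have hearly' : β * G'.real (Ico t₁ s) - ∫ τ in Ico t₁ s, c τ ∂G' ≤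
      (β - α) * G'.real (Ici t₁) := by
    linarith [hrate s hs, congrArg (β * ·) (measureReal_Ici_eq_add G' hs.1)]
  have hearly : β * G.real (Ico t₁ s) - ∫ τ in Ico t₁ s, c τ ∂G ≤ (β - α) * G.real (Ici t₁) := by
    refine le_of_mul_le_mul_right (hle.trans ?_) hpos
    linarith [mul_le_mul_of_nonneg_right hearly' (measureReal_nonneg (μ := G) (s := Ici t₁))]
  have hlate := mul_measureReal_Ico_le_setIntegral (G := G) hc habove
  have hsplit : ∫ τ in Ico t₁ t₂, c τ ∂G = ∫ τ in Ico t₁ s, c τ ∂G + ∫ τ in Ico s t₂, c τ ∂G := by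
    rw [← Ico_union_Ico_eq_Ico hs.1 hs.2, setIntegral_union Ico_disjoint_Ico_same
      measurableSet_Ico (hc.integrable G).integrableOn (hc.integrable G).integrableOn]
  linarith [congrArg (β * ·) (measureReal_Ici_eq_add G hs.1),
    congrArg (β * ·) (measureReal_Ici_eq_add G hs.2)]

end MonotoneLikelihoodRatio

/-! ### Comparison of optimal flows -/

section Comparison

variable {r u0 v w α β δ s s₁ t₀ t₁ t₂ : ℝ} {I0 I1 S₁ : Set ℝ} {f0 f1 c x x' : ℝ → ℝ}
  {G G' : Measure ℝ}

lemma IsOptimalFlow.hasLeftMass_of_le (hr : 0 < r) (h0 : IsRealFrontier u0 I0 f0)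
    (h1 : IsRealFrontier u0 I1 f1) (hf0 : StrictConcaveOn ℝ I0 f0)
    (hG : IsUnboundedDistribution G) (hx : IsOptimalFlow r I0 I1 f0 f1 G x)
    (hanti : AntitoneOn (promisedValue r x) (Ici 0)) (hleft : HasLeftMass {t | v ≤ x t} t₂)
    (hs₀ : 0 < s) (hs : s ≤ t₂) : HasLeftMass {t | v ≤ x t} s := by
  have hgt (n : ℕ) : ∀ᵐ t, t ∈ Ioo 0 t₂ → v - 1 / ((n : ℝ) + 1) < x t := by
    filter_upwards [ae_hasLeftMass {t | x t ≤ v - 1 / ((n : ℝ) + 1)}] with t ht htt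
    by_contra! hle
    exact hx.not_hasLeftMass hr h0 h1 hf0 hG hanti (sub_lt_self v Nat.one_div_pos_of_nat)
      htt.1 htt.2 (ht hle) hleft
  have hle : ∀ᵐ t, t ∈ Ioo 0 t₂ → v ≤ x t := by
    filter_upwards [ae_all_iff.2 hgt] with t ht htt
    by_contra! hlt
    obtain ⟨n, hn⟩ := exists_nat_one_div_lt (sub_pos.2 hlt)
    linarith [ht n htt]
  intro s' hs'
  have hsub : Ioo (max s' 0) s ≤ᵐ[volume] ({t | v ≤ x t} ∩ Ioo s' s : Set ℝ) := by
    filter_upwards [hle] with t ht htt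
    exact ⟨ht ⟨(le_max_right _ _).trans_lt htt.1, htt.2.trans_le hs⟩,
      (le_max_left _ _).trans_lt htt.1, htt.2⟩
  refine lt_of_lt_of_le ?_ (measure_mono_ae hsub)
  rw [Real.volume_Ioo, ENNReal.ofReal_pos, sub_pos]
  exact max_lt hs' hs₀

lemma exists_monotoneOn_hasMarginalValue {I : Set ℝ} {f X Y : ℝ → ℝ} {a b : ℝ}
    (hf : ConcaveOn ℝ I f) (hab : a ≤ b) (hXc : ContinuousOn X (Icc a b))
    (hYc : ContinuousOn Y (Icc a b)) (hX : AntitoneOn X (Icc a b)) (hY : AntitoneOn Y (Icc a b))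
    (hXI : ∀ t ∈ Icc a b, X t ∈ I) (hYI : ∀ t ∈ Icc a b, Y t ∈ I)
    (hXY : ∀ t ∈ Icc a b, X t < Y t) :
    ∃ c ε, IsBoundedMeasurable c ∧ MonotoneOn c (Icc a b) ∧ 0 < ε ∧ ∀ t ∈ Icc a b,
      HasMarginalValue I f ε (X t) (c t) ∧ HasMarginalValue I f (-ε) (Y t) (c t) := by
  obtain ⟨m, hm, hmin⟩ := isCompact_Icc.exists_isMinOn (nonempty_Icc.2 hab) (hYc.sub hXc)
  have hmono := secant_monotoneOn hf hX hY hXI hYI hXY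
  obtain ⟨c, hc, hceq⟩ := exists_isBoundedMeasurable_eqOn_of_monotoneOn hab hmono
  have hε : 0 < Y m - X m := sub_pos.2 (hXY m hm)
  refine ⟨c, Y m - X m, hc, hmono.congr hceq.symm, hε, fun t ht => ?_⟩
  have hgap : Y m - X m ≤ Y t - X t := hmin ht
  rw [hceq ht]
  exact ⟨(hasMarginalValue_of_le hf (hXI t ht) (hYI t ht) le_rfl (hXY t ht)).mono
      (Icc_subset_uIcc ⟨hε.le, hgap⟩),
    (hasMarginalValue_of_ge hf (hXI t ht) (hYI t ht) le_rfl (hXY t ht)).mono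
      (Icc_subset_uIcc' ⟨by linarith, neg_nonpos.2 hε.le⟩)⟩

lemma IsOptimalFlow.rate_nonneg (hr : 0 < r) (h0 : IsRealFrontier u0 I0 f0)
    (h1 : IsRealFrontier u0 I1 f1) (hf0 : StrictConcaveOn ℝ I0 f0)
    (hG : IsUnboundedDistribution G) (hx : IsOptimalFlow r I0 I1 f0 f1 G x)
    (hanti : AntitoneOn (promisedValue r x) (Ici 0)) (hS₁ : MeasurableSet S₁)
    (hc : IsBoundedMeasurable c) (ht₁ : 0 ≤ t₁) (hα₁ : t₁ = 0 → α = 0) (hs₁ : s₁ < t₁)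
    (hδ : 0 < δ) (hαβ : α ≤ β) (hleft₁ : HasLeftMass S₁ t₁)
    (hleft₂ : HasLeftMass {t | w ≤ x t} t₂)
    (hα : ∀ t ∈ S₁, 0 < t → HasMarginalValue I0 f0 δ (x t) α)
    (hβ : ∀ t, w ≤ x t → HasMarginalValue I0 f0 (-δ) (x t) β)
    (hpromise : ∀ t ∈ Ioo s₁ t₂, 0 ≤ t → HasMarginalValue I1 f1 (-δ) (promisedValue r x t) (c t))
    (hs : s ∈ Icc t₁ t₂) :
    0 ≤ β * G.real (Ici s) - α * G.real (Ici t₁) + ∫ τ in Ico t₁ s, c τ ∂G := by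
  obtain rfl | hts := hs.1.eq_or_lt
  · rw [Ico_self, setIntegral_empty, add_zero, ← sub_mul]
    exact mul_nonneg (sub_nonneg.2 hαβ) measureReal_nonneg
  have hfoc := hx.firstOrderCondition hr hG (δ := -δ) hS₁
    (measurableSet_le measurable_const hx.isBoundedMeasurable.measurable) hc ht₁ hα₁ hs₁ hts hleft₁
    (hx.hasLeftMass_of_le hr h0 h1 hf0 hG hanti hleft₂ (ht₁.trans_lt hts) hs.2)
    (by simpa only [neg_neg] using hα) (fun t ht _ => hβ t ht)
    fun t ht => hpromise t ⟨ht.1, ht.2.trans_le hs.2⟩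
  rwa [neg_mul, neg_nonpos, mul_nonneg_iff_of_pos_left hδ] at hfoc

lemma IsOptimalFlow.not_hasLeftMass_of_promisedValue_lt (hr : 0 < r)
    (h0 : IsRealFrontier u0 I0 f0) (h1 : IsRealFrontier u0 I1 f1) (hf0 : StrictConcaveOn ℝ I0 f0)
    (hG : IsUnboundedDistribution G) (hG' : IsUnboundedDistribution G') (hMLR : MLRDominates G G')
    (hx : IsOptimalFlow r I0 I1 f0 f1 G x) (hx' : IsOptimalFlow r I0 I1 f0 f1 G' x')
    (hanti : AntitoneOn (promisedValue r x) (Ici 0))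
    (hanti' : AntitoneOn (promisedValue r x') (Ici 0)) (hS₁ : MeasurableSet S₁) (ht₁ : 0 ≤ t₁)
    (hα₁ : t₁ = 0 → α = 0) (hs₁ : s₁ < t₁) (ht : t₁ < t₂) (hδ : 0 < δ)
    (hleft₁ : HasLeftMass S₁ t₁)
    (hα : ∀ t ∈ S₁, 0 < t →
      HasMarginalValue I0 f0 (-δ) (x t) α ∧ HasMarginalValue I0 f0 δ (x' t) α)
    (hαw : ∀ m ∈ I0, m < w → w ∈ I0 → α ≤ (f0 w - f0 m) / (w - m))
    (hlt : ∀ t ∈ Icc s₁ t₂, 0 ≤ t → promisedValue r x t < promisedValue r x' t) (hvw : v < w) :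
    ¬ HasLeftMass {t | x t ≤ v ∧ w ≤ x' t} t₂ := by
  intro hleft₂
  have := hG.prob
  have := hG'.prob
  have := hG.noAtoms
  have hxb := hx.isBoundedMeasurable
  have hxb' := hx'.isBoundedMeasurable
  obtain ⟨τ, -, ⟨hxτ, hwτ⟩, -⟩ := hleft₂.exists_mem (sub_one_lt t₂) (.of_forall fun _ => trivial)
  have hw : w ∈ I0 := h0.mem_of_pos_of_le
    (((h0.subset_Icc (hx.mem0 τ)).1.trans hxτ).trans_lt hvw) hwτ (hx'.mem0 τ)
  obtain ⟨m, hm, hmw, φ, δ₀, hβφ, hδ₀, hφ, hβ⟩ := h0.exists_hasMarginalValue_of_lt hf0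
    ((h0.subset_Icc (hx.mem0 τ)).1.trans hxτ) hvw hw
  have hJ : Icc (max s₁ 0) t₂ ⊆ Ici 0 := fun t ht => (le_max_right _ _).trans ht.1
  obtain ⟨c, ε, hc, hcmono, hε, hcX⟩ := exists_monotoneOn_hasMarginalValue h1.concave
    ((max_le hs₁.le ht₁).trans ht.le) (continuous_promisedValue hr hxb).continuousOn
    (continuous_promisedValue hr hxb').continuousOn (hanti.mono hJ) (hanti'.mono hJ)
    (fun t ht => hx.mem1 t (hJ ht)) (fun t ht => hx'.mem1 t (hJ ht))
    fun t ht => hlt t ⟨(le_max_left _ _).trans ht.1, ht.2⟩ (hJ ht)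
  have hwindow {t : ℝ} (ht : t ∈ Ioo s₁ t₂) (ht0 : 0 ≤ t) : t ∈ Icc (max s₁ 0) t₂ :=
    ⟨max_le ht.1.le ht0, ht.2.le⟩
  obtain ⟨η, hη, hηmin⟩ := exists_between (lt_min (lt_min hδ₀ hδ) hε)
  have hle : η ≤ δ₀ ∧ η ≤ δ ∧ η ≤ ε := by simpa only [le_min_iff, and_assoc] using hηmin.le
  have hup {ζ : ℝ} (h : η ≤ ζ) : η ∈ uIcc 0 ζ := Icc_subset_uIcc ⟨hη.le, h⟩
  have hdown {ζ : ℝ} (h : η ≤ ζ) : -η ∈ uIcc 0 (-ζ) :=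
    Icc_subset_uIcc' ⟨neg_le_neg h, neg_nonpos.2 hη.le⟩
  have hfoc := hx.firstOrderCondition hr hG hS₁
    ((measurableSet_le hxb.measurable measurable_const).inter
      (measurableSet_le measurable_const hxb'.measurable)) hc ht₁ hα₁ hs₁ ht hleft₁ hleft₂
    (fun t htS ht0 => (hα t htS ht0).1.mono (hdown hle.2.1))
    (fun t htS _ => (hφ (x t) (hx.mem0 t) htS.1).mono (hup hle.1))
    fun t ht ht0 => (hcX t (hwindow ht ht0)).1.mono (hup hle.2.2)
  have hrate' := fun s (hs : s ∈ Icc t₁ t₂) => hx'.rate_nonneg hr h0 h1 hf0 hG' hanti' hS₁ hc ht₁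
    hα₁ hs₁ hη (hαw m hm hmw hw) hleft₁ (hleft₂.mono fun t ht => ht.2)
    (fun t htS ht0 => (hα t htS ht0).2.mono (hup hle.2.1))
    (fun t htw => (hβ (x' t) (hx'.mem0 t) htw).mono (hdown hle.1))
    (fun t ht ht0 => (hcX t (hwindow ht ht0)).2.mono (hdown hle.2.2)) hs
  have hrate := hMLR.rate_nonneg hc ht.le
    (hcmono.mono (Icc_subset_Icc_left (max_le hs₁.le ht₁))) (hG'.real_Ici_pos t₁) hrate'
  have hgain := mul_lt_mul_of_pos_right hβφ (hG.real_Ici_pos t₂)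
  exact hfoc.not_gt (mul_pos hη (by linarith))

lemma exists_hasLeftMass_of_tailValue_lt (hr : 0 < r) (hx : IsBoundedMeasurable x)
    (hx' : IsBoundedMeasurable x') {a b : ℝ} (hab : a ≤ b)
    (h : tailValue r x a - tailValue r x b < tailValue r x' a - tailValue r x' b) :
    ∃ v w t, v < w ∧ t ∈ Ioo a b ∧ HasLeftMass {t | x t ≤ v ∧ w ≤ x' t} t :=
  exists_separated_hasLeftMass fun hle =>
    h.not_ge (tailValue_sub_le_of_ae_le hr hx' hx hab hle)

lemma exists_later_hasLeftMass_of_promisedValue_lt (hr : 0 < r) (hx : IsBoundedMeasurable x)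
    (hx' : IsBoundedMeasurable x') (hlt : promisedValue r x t₀ < promisedValue r x' t₀) :
    ∃ v w t, v < w ∧ t₀ < t ∧ HasLeftMass {t | x t ≤ v ∧ w ≤ x' t} t ∧
      ∀ s ∈ Icc t₀ t, promisedValue r x s < promisedValue r x' s := by
  have hX := (continuous_promisedValue hr hx').sub (continuous_promisedValue hr hx)
  have htail : tailValue r x t₀ < tailValue r x' t₀ := by
    simp only [tailValue_eq_exp_mul_promisedValue]
    gcongr
  obtain ⟨b, hb, hbelow, htail_b⟩ : ∃ b, t₀ < b ∧
      (∀ t ∈ Ico t₀ b, promisedValue r x t < promisedValue r x' t) ∧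
      tailValue r x' b - tailValue r x b < tailValue r x' t₀ - tailValue r x t₀ := by
    by_cases! hcross : ∃ τ ≥ t₀, promisedValue r x' τ - promisedValue r x τ ≤ 0
    · obtain ⟨τ, hτ, hτ0⟩ := hcross
      obtain ⟨b, hb, hb0, hbelow⟩ := exists_first_le hX hτ (sub_pos.2 hlt) hτ0
      refine ⟨b, hb.1, fun t ht => sub_pos.1 (hbelow t ht), ?_⟩
      rw [tailValue_eq_exp_mul_promisedValue b, tailValue_eq_exp_mul_promisedValue b,
        sub_eq_zero.1 hb0, sub_self]
      exact sub_pos.2 htail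
    · have hlim := (tendsto_tailValue hr hx').sub (tendsto_tailValue hr hx)
      rw [sub_zero] at hlim
      obtain ⟨b, htail_b, hb⟩ := ((hlim.eventually_lt_const (sub_pos.2 htail)).and
        (eventually_gt_atTop t₀)).exists
      exact ⟨b, hb, fun t ht => sub_pos.1 (hcross t ht.1), htail_b⟩
  obtain ⟨v, w, t, hvw, ht, hleft⟩ := exists_hasLeftMass_of_tailValue_lt hr hx hx' hb.le
    (by linarith)
  exact ⟨v, w, t, hvw, ht.1, hleft, fun s hs => hbelow s ⟨hs.1, hs.2.trans_lt ht.2⟩⟩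

lemma exists_earlier_hasLeftMass_of_promisedValue_lt (hr : 0 < r) (hx : IsBoundedMeasurable x)
    (hx' : IsBoundedMeasurable x') {τ : ℝ} (hτ : τ ≤ t₀)
    (hle : promisedValue r x' τ ≤ promisedValue r x τ)
    (hlt : promisedValue r x t₀ < promisedValue r x' t₀) :
    ∃ v w s t, v < w ∧ τ < s ∧ s < t ∧ t < t₀ ∧ HasLeftMass {t | x' t ≤ v ∧ w ≤ x t} t ∧
      ∀ u ∈ Icc s t₀, promisedValue r x u < promisedValue r x' u := by
  obtain ⟨a, ha, ha0, habove⟩ := exists_last_le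
    ((continuous_promisedValue hr hx').sub (continuous_promisedValue hr hx)) hτ
    (sub_nonpos.2 hle) (sub_pos.2 hlt)
  have htail : tailValue r x t₀ < tailValue r x' t₀ := by
    simp only [tailValue_eq_exp_mul_promisedValue]
    gcongr
  have htail_a : tailValue r x' a = tailValue r x a := by
    simp only [tailValue_eq_exp_mul_promisedValue, sub_eq_zero.1 ha0]
  obtain ⟨v, w, t, hvw, ht, hleft⟩ := exists_hasLeftMass_of_tailValue_lt hr hx' hx ha.2.le
    (by linarith)
  obtain ⟨s, has, hst⟩ := exists_between ht.1
  exact ⟨v, w, s, t, hvw, ha.1.trans_lt has, hst, ht.2, hleft,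
    fun u hu => sub_pos.1 (habove u ⟨has.trans_le hu.1, hu.2⟩)⟩

lemma hasMarginalValue_secant {I : Set ℝ} {f : ℝ → ℝ} (hf : ConcaveOn ℝ I f) {y z u u' : ℝ}
    (hy : y ∈ I) (hz : z ∈ I) (hyz : y < z) (hu : u ∈ I) (hzu : z ≤ u) (hu' : u' ∈ I)
    (huy' : u' ≤ y) : HasMarginalValue I f (-(z - y)) u ((f z - f y) / (z - y)) ∧
      HasMarginalValue I f (z - y) u' ((f z - f y) / (z - y)) :=
  ⟨neg_sub z y ▸ hasMarginalValue_of_ge hf hy hu hzu hyz, hasMarginalValue_of_le hf hu' hz huy' hyz⟩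

lemma IsOptimalFlow.not_hasLeftMass_of_hasLeftMass (hr : 0 < r) (h0 : IsRealFrontier u0 I0 f0)
    (h1 : IsRealFrontier u0 I1 f1) (hf0 : StrictConcaveOn ℝ I0 f0)
    (hG : IsUnboundedDistribution G) (hG' : IsUnboundedDistribution G') (hMLR : MLRDominates G G')
    (hx : IsOptimalFlow r I0 I1 f0 f1 G x) (hx' : IsOptimalFlow r I0 I1 f0 f1 G' x')
    (hanti : AntitoneOn (promisedValue r x) (Ici 0))
    (hanti' : AntitoneOn (promisedValue r x') (Ici 0)) {y z : ℝ} (hyz : y < z) (ht₁ : 0 < t₁)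
    (hs₁ : s₁ < t₁) (ht : t₁ < t₂) (hleft₁ : HasLeftMass {t | x' t ≤ y ∧ z ≤ x t} t₁)
    (hlt : ∀ t ∈ Icc s₁ t₂, promisedValue r x t < promisedValue r x' t) (hvw : v < w) :
    ¬ HasLeftMass {t | x t ≤ v ∧ w ≤ x' t} t₂ := by
  intro hleft₂
  have hwy : w ≤ y := by
    by_contra! hyw
    exact hx'.not_hasLeftMass hr h0 h1 hf0 hG' hanti' hyw ht₁ ht (hleft₁.mono fun t ht => ht.1)
      (hleft₂.mono fun t ht => ht.2)
  obtain ⟨u, -, ⟨-, hzu⟩, -⟩ := hleft₁.exists_mem (sub_one_lt t₁) (.of_forall fun _ => trivial)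
  obtain ⟨u₂, -, ⟨hu₂v, -⟩, -⟩ := hleft₂.exists_mem (sub_one_lt t₂) (.of_forall fun _ => trivial)
  have hy0 : 0 < y := (((h0.subset_Icc (hx.mem0 u₂)).1.trans hu₂v).trans_lt hvw).trans_le hwy
  have hz : z ∈ I0 := h0.mem_of_pos_of_le (hy0.trans hyz) hzu (hx.mem0 u)
  have hy : y ∈ I0 := h0.mem_of_pos_of_le hy0 hyz.le hz
  refine hx.not_hasLeftMass_of_promisedValue_lt hr h0 h1 hf0 hG hG' hMLR hx' hanti hanti'
    ((measurableSet_le hx'.isBoundedMeasurable.measurable measurable_const).inter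
      (measurableSet_le measurable_const hx.isBoundedMeasurable.measurable)) ht₁.le
    (fun h => absurd h ht₁.ne') hs₁ ht (sub_pos.2 hyz) hleft₁
    (fun t ht _ => hasMarginalValue_secant h0.concave hy hz hyz (hx.mem0 t) ht.2 (hx'.mem0 t) ht.1)
    (fun m hm hmw _ => ?_) (fun t ht _ => hlt t ht) hvw hleft₂
  exact secant_anti_of_concaveOn h0.concave hm hz hmw hyz (hmw.le.trans hwy) (hwy.trans hyz.le)

-- If the promises are ordered the wrong way all the way back to `0`, then consumption is not moved
-- but created: it is taken from the fictitious negative times, at the marginal value `α = 0`.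
lemma IsOptimalFlow.promisedValue_le (hr : 0 < r) (h0 : IsRealFrontier u0 I0 f0)
    (h1 : IsRealFrontier u0 I1 f1) (hf0 : StrictConcaveOn ℝ I0 f0) (hmono : MonotoneOn f0 I0)
    (hG : IsUnboundedDistribution G) (hG' : IsUnboundedDistribution G') (hMLR : MLRDominates G G')
    (hx : IsOptimalFlow r I0 I1 f0 f1 G x) (hx' : IsOptimalFlow r I0 I1 f0 f1 G' x')
    (ht₀ : 0 ≤ t₀) : promisedValue r x' t₀ ≤ promisedValue r x t₀ := by
  by_contra! hlt
  have hanti := hx.antitoneOn_promisedValue hr h0 h1 hf0 hmono hG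
  have hanti' := hx'.antitoneOn_promisedValue hr h0 h1 hf0 hmono hG'
  have hxb := hx.isBoundedMeasurable
  have hxb' := hx'.isBoundedMeasurable
  obtain ⟨v, w, t₂, hvw, ht₂, hleft₂, hlater⟩ :=
    exists_later_hasLeftMass_of_promisedValue_lt hr hxb hxb' hlt
  by_cases! hcross : ∃ τ ∈ Icc 0 t₀, promisedValue r x' τ ≤ promisedValue r x τ
  · obtain ⟨τ, hτ, hτle⟩ := hcross
    obtain ⟨y, z, s₁, t₁, hyz, hτs, hst, ht₁, hleft₁, hearlier⟩ :=
      exists_earlier_hasLeftMass_of_promisedValue_lt hr hxb hxb' hτ.2 hτle hlt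
    refine hx.not_hasLeftMass_of_hasLeftMass hr h0 h1 hf0 hG hG' hMLR hx' hanti hanti' hyz
      (hτ.1.trans_lt (hτs.trans hst)) hst (ht₁.trans ht₂) hleft₁ (fun t ht => ?_) hvw hleft₂
    rcases le_total t t₀ with h | h
    exacts [hearlier t ⟨ht.1, h⟩, hlater t ⟨h, ht.2⟩]
  · refine hx.not_hasLeftMass_of_promisedValue_lt hr h0 h1 hf0 hG hG' hMLR hx' hanti hanti'
      (S₁ := Iio 0) measurableSet_Iio le_rfl (fun _ => rfl) neg_one_lt_zero (ht₀.trans_lt ht₂)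
      one_pos (fun s hs => ?_) (fun t ht ht0 => absurd ht0 ht.not_gt)
      (fun m hm hmw hw =>
        div_nonneg (sub_nonneg.2 (hmono hm hw hmw.le)) (sub_nonneg.2 hmw.le))
      (fun t ht ht0 => ?_) hvw hleft₂
    · rw [inter_eq_right.2 Ioo_subset_Iio_self, Real.volume_Ioo, ENNReal.ofReal_pos]
      linarith
    · rcases le_total t t₀ with h | h
      exacts [hcross t ⟨ht0, h⟩, hlater t ⟨h, ht.2⟩]

end Comparison

/-! ### Extended-real payoffs -/

section ERealIntegral

variable {μ : Measure ℝ} {f g : ℝ → EReal}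

lemma erealIntegral_mono (h : ∀ᵐ t ∂μ, f t ≤ g t) : erealIntegral μ f ≤ erealIntegral μ g := by
  refine EReal.sub_le_sub ?_ ?_ <;>
    refine EReal.coe_ennreal_le_coe_ennreal_iff.2 (lintegral_mono_ae (h.mono fun t ht => ?_))
  · exact EReal.toENNReal_le_toENNReal ht
  · exact EReal.toENNReal_le_toENNReal (EReal.neg_le_neg_iff.2 ht)

lemma erealIntegral_congr (h : ∀ᵐ t ∂μ, f t = g t) : erealIntegral μ f = erealIntegral μ g :=
  (erealIntegral_mono (h.mono fun _ => le_of_eq)).antisymm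
    (erealIntegral_mono (h.mono fun _ => ge_of_eq))

lemma erealIntegral_coe {f : ℝ → ℝ} (hf : Integrable f μ) :
    erealIntegral μ (fun t => (f t : EReal)) = ((∫ t, f t ∂μ : ℝ) : EReal) := by
  have hpos : ∫⁻ t, ENNReal.ofReal (f t) ∂μ ≠ ⊤ := hf.lintegral_lt_top.ne
  have hneg : ∫⁻ t, ENNReal.ofReal (-f t) ∂μ ≠ ⊤ := hf.neg.lintegral_lt_top.ne
  rw [integral_eq_lintegral_pos_part_sub_lintegral_neg_part hf]
  simp only [erealIntegral, ← EReal.coe_neg, EReal.real_coe_toENNReal, EReal.coe_sub]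
  rw [EReal.coe_ennreal_toReal hpos, EReal.coe_ennreal_toReal hneg]

lemma erealIntegral_eq_bot_iff : erealIntegral μ f = ⊥ ↔ ∫⁻ t, (-f t).toENNReal ∂μ = ⊤ := by
  rw [erealIntegral, sub_eq_add_neg, EReal.add_eq_bot_iff, EReal.neg_eq_bot_iff]
  simp

lemma erealIntegral_dirac (t : ℝ) (f : ℝ → EReal) : erealIntegral (.dirac t) f = f t := by
  rw [erealIntegral, lintegral_dirac, lintegral_dirac]
  induction f t with
  | bot => simp
  | top => simp
  | coe x =>
    rw [← EReal.coe_neg, EReal.real_coe_toENNReal, EReal.real_coe_toENNReal,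
      EReal.coe_ennreal_ofReal, EReal.coe_ennreal_ofReal, ← EReal.coe_sub,
      max_zero_sub_max_neg_zero_eq_self]

lemma ae_ne_bot_of_erealIntegral_ne_bot (hf : AEMeasurable f μ) (h : erealIntegral μ f ≠ ⊥) :
    ∀ᵐ t ∂μ, f t ≠ ⊥ := by
  filter_upwards [ae_lt_top' (measurable_ereal_toENNReal.comp_aemeasurable
    (measurable_neg.comp_aemeasurable hf)) (erealIntegral_eq_bot_iff.not.1 h)] with t ht hbot
  simp [hbot] at ht

lemma enorm_toReal_le_add_toENNReal_neg {y : EReal} {c : ℝ} (hy : y ≠ ⊥) (hyc : y ≤ c) :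
    ‖y.toReal‖ₑ ≤ ‖c‖ₑ + (-y).toENNReal := by
  lift y to ℝ using ⟨(hyc.trans_lt (EReal.coe_lt_top c)).ne, hy⟩
  rw [EReal.coe_le_coe_iff] at hyc
  rw [← EReal.coe_neg, EReal.real_coe_toENNReal, EReal.toReal_coe, Real.enorm_eq_ofReal_abs,
    Real.enorm_eq_ofReal_abs]
  rcases le_total 0 y with h | h
  · exact (ENNReal.ofReal_le_ofReal (abs_le_abs_of_nonneg h hyc)).trans le_self_add
  · rw [abs_of_nonpos h]
    exact le_add_self

lemma integrable_toReal_of_erealIntegral_ne_bot {c : ℝ → ℝ} (hf : AEMeasurable f μ)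
    (hc : Integrable c μ) (hfc : ∀ᵐ t ∂μ, f t ≤ c t) (h : erealIntegral μ f ≠ ⊥) :
    Integrable (fun t => (f t).toReal) μ := by
  refine ⟨hf.ereal_toReal.aestronglyMeasurable, ?_⟩
  have hneg : ∫⁻ t, (-f t).toENNReal ∂μ ≠ ⊤ := erealIntegral_eq_bot_iff.not.1 h
  calc ∫⁻ t, ‖(f t).toReal‖ₑ ∂μ ≤ ∫⁻ t, (‖c t‖ₑ + (-f t).toENNReal) ∂μ := by
        refine lintegral_mono_ae ?_
        filter_upwards [ae_ne_bot_of_erealIntegral_ne_bot hf h, hfc] with t hbot hle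
        exact enorm_toReal_le_add_toENNReal_neg hbot hle
    _ = ∫⁻ t, ‖c t‖ₑ ∂μ + ∫⁻ t, (-f t).toENNReal ∂μ := lintegral_add_left' hc.1.enorm _
    _ < ⊤ := ENNReal.add_lt_top.2 ⟨hc.2, hneg.lt_top⟩

lemma erealIntegral_eq_coe_integral_toReal {c : ℝ → ℝ} (hf : AEMeasurable f μ)
    (hc : Integrable c μ) (hfc : ∀ᵐ t ∂μ, f t ≤ c t) (h : erealIntegral μ f ≠ ⊥) :
    erealIntegral μ f = ((∫ t, (f t).toReal ∂μ : ℝ) : EReal) := by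
  rw [← erealIntegral_coe (integrable_toReal_of_erealIntegral_ne_bot hf hc hfc h)]
  refine erealIntegral_congr ?_
  filter_upwards [ae_ne_bot_of_erealIntegral_ne_bot hf h, hfc] with t hbot hle
  exact (EReal.coe_toReal (hle.trans_lt (EReal.coe_lt_top _)).ne hbot).symm

lemma coe_mul_eq_bot_iff {a : ℝ} (ha : 0 < a) {x : EReal} : (a : EReal) * x = ⊥ ↔ x = ⊥ := by
  induction x with
  | bot => simp [EReal.coe_mul_bot_of_pos ha]
  | top => simp [EReal.coe_mul_top_of_pos ha]
  | coe x => simp only [← EReal.coe_mul, EReal.coe_ne_bot]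

lemma coe_mul_ne_top {a : ℝ} (ha : 0 < a) {x : EReal} (hx : x ≠ ⊤) : (a : EReal) * x ≠ ⊤ := by
  induction x with
  | bot => simp [EReal.coe_mul_bot_of_pos ha]
  | top => exact absurd rfl hx
  | coe x => rw [← EReal.coe_mul]; exact EReal.coe_ne_top _

end ERealIntegral

section Frontier

variable {F : ℝ≥0 → EReal} {p : ℝ≥0}

lemma IsFrontier.le_peak (hF : IsFrontier F p) (u : ℝ≥0) : F u ≤ F p := by
  rcases eq_or_ne u p with rfl | h
  · exact le_rfl
  · exact (hF.peak u h).le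

lemma IsFrontier.peak_ne_bot (hF : IsFrontier F p) : F p ≠ ⊥ :=
  ((bot_le).trans_lt (hF.peak (p + 1) (by simp))).ne'

lemma IsFrontier.measurable_extend (hF : IsFrontier F p) : Measurable (extendFrontier F) :=
  Measurable.ite (measurableSet_singleton ⊤) measurable_const
    (hF.usc.measurable.comp ENNReal.measurable_toNNReal)

lemma extendFrontier_coe (F : ℝ≥0 → EReal) (u : ℝ≥0) : extendFrontier F u = F u := by
  simp [extendFrontier]

lemma IsFrontier.extend_le_peak (hF : IsFrontier F p) (X : ℝ≥0∞) : extendFrontier F X ≤ F p := by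
  induction X with
  | top => simp [extendFrontier]
  | coe u => exact (extendFrontier_coe F u).trans_le (hF.le_peak u)

lemma IsFrontier.lt_of_convexCombo (hF : IsFrontier F p) {u a b : ℝ≥0} (hu : u ≠ p) (hb : 0 < b)
    (hab : a + b = 1) (hv : F (a * u + b * p) ≠ ⊥) : F u < F (a * u + b * p) := by
  rcases eq_or_ne (F u) ⊥ with hbot | hbot
  · exact hbot ▸ bot_lt_iff_ne_bot.2 hv
  refine lt_of_lt_of_le ?_ (hF.concave u p a b hab)
  have hup := hF.peak u hu
  generalize hy : F u = y at hup hbot ⊢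
  generalize hz : F p = z at hup ⊢
  lift y to ℝ using ⟨hy ▸ (hF.lt_top u).ne, hbot⟩
  lift z to ℝ using ⟨hz ▸ (hF.lt_top p).ne, hz ▸ hF.peak_ne_bot⟩
  have hab' : (a : ℝ) = 1 - b := eq_sub_of_add_eq (by exact_mod_cast hab)
  have hgap := mul_pos (NNReal.coe_pos.2 hb) (sub_pos.2 (EReal.coe_lt_coe_iff.1 hup))
  rw [← EReal.coe_mul, ← EReal.coe_mul, ← EReal.coe_add, EReal.coe_lt_coe_iff, hab']
  linarith

lemma exists_convexCombo_of_between {u v w : ℝ≥0} (h : u < v ∧ v ≤ w ∨ w ≤ v ∧ v < u) :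
    ∃ a b : ℝ≥0, 0 < b ∧ a + b = 1 ∧ a * u + b * w = v := by
  have hmem : (v : ℝ) ∈ segment ℝ (u : ℝ) w := by
    rw [segment_eq_uIcc]
    rcases h with h | h
    · exact mem_uIcc_of_le (by exact_mod_cast h.1.le) (by exact_mod_cast h.2)
    · exact mem_uIcc_of_ge (by exact_mod_cast h.1) (by exact_mod_cast h.2.le)
  obtain ⟨a, b, ha, hb, hab, hv⟩ := hmem
  lift a to ℝ≥0 using ha
  lift b to ℝ≥0 using hb
  simp only [smul_eq_mul] at hv
  have hv : a * u + b * w = v := by exact_mod_cast hv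
  have hab : a + b = 1 := by exact_mod_cast hab
  refine ⟨a, b, pos_iff_ne_zero.2 ?_, hab, hv⟩
  rintro rfl
  rw [add_zero] at hab
  rw [hab, one_mul, zero_mul, add_zero] at hv
  exact h.elim (fun h => h.1.ne hv) fun h => h.2.ne' hv

lemma IsFrontier.lt_of_between (hF : IsFrontier F p) {u v : ℝ≥0}
    (h : u < v ∧ v ≤ p ∨ p ≤ v ∧ v < u) (hv : F v ≠ ⊥) : F u < F v := by
  have hup : u ≠ p :=
    h.elim (fun h => (h.1.trans_le h.2).ne) fun h => (h.1.trans_lt h.2).ne'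
  obtain ⟨a, b, hb, hab, rfl⟩ := exists_convexCombo_of_between h
  exact hF.lt_of_convexCombo hup hb hab hv

/-- The part of the effective domain of `F` on `[0,p]`, as a set of reals. -/
def effectiveDomain (F : ℝ≥0 → EReal) (p : ℝ≥0) : Set ℝ :=
  {u | u ∈ Icc 0 (p : ℝ) ∧ F u.toNNReal ≠ ⊥}

/-- The real function that agrees with the frontier `F` on its effective domain. It takes the junk
value `0` where `F` is infinite, and the value of `F` at `0` at negative reals. -/
def realValue (F : ℝ≥0 → EReal) (u : ℝ) : ℝ := (F u.toNNReal).toReal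

lemma coe_realValue (hF : ∀ u, F u < ⊤) {u : ℝ} (hu : u ∈ effectiveDomain F p) :
    (realValue F u : EReal) = F u.toNNReal :=
  EReal.coe_toReal (hF _).ne hu.2

lemma toNNReal_convexCombo {a b u v : ℝ} (ha : 0 ≤ a) (hb : 0 ≤ b) (hu : 0 ≤ u) (hv : 0 ≤ v) :
    (a * u + b * v).toNNReal = a.toNNReal * u.toNNReal + b.toNNReal * v.toNNReal := by
  rw [Real.toNNReal_add (mul_nonneg ha hu) (mul_nonneg hb hv), Real.toNNReal_mul ha,
    Real.toNNReal_mul hb]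

lemma IsConcave.coe_realValue_le (hc : IsConcave F) (ht : ∀ u, F u < ⊤) {u v a b : ℝ}
    (hu : u ∈ effectiveDomain F p) (hv : v ∈ effectiveDomain F p) (ha : 0 ≤ a) (hb : 0 ≤ b)
    (hab : a + b = 1) :
    ((a * realValue F u + b * realValue F v : ℝ) : EReal) ≤ F (a * u + b * v).toNNReal := by
  have := hc u.toNNReal v.toNNReal a.toNNReal b.toNNReal
    (by rw [← Real.toNNReal_add ha hb, hab, Real.toNNReal_one])
  rw [← coe_realValue ht hu, ← coe_realValue ht hv, Real.coe_toNNReal a ha,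
    Real.coe_toNNReal b hb, ← toNNReal_convexCombo ha hb hu.1.1 hv.1.1] at this
  exact_mod_cast this

lemma IsConcave.convex_effectiveDomain (hc : IsConcave F) (ht : ∀ u, F u < ⊤) :
    Convex ℝ (effectiveDomain F p) := by
  refine fun u hu v hv a b ha hb hab => ⟨convex_Icc 0 (p : ℝ) hu.1 hv.1 ha hb hab, fun hbot => ?_⟩
  have hle := hc.coe_realValue_le ht hu hv ha hb hab
  rw [← smul_eq_mul, ← smul_eq_mul, ← smul_eq_mul, ← smul_eq_mul, hbot, le_bot_iff] at hle
  exact EReal.coe_ne_bot _ hle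

lemma IsConcave.concaveOn_realValue (hc : IsConcave F) (ht : ∀ u, F u < ⊤) :
    ConcaveOn ℝ (effectiveDomain F p) (realValue F) := by
  have hconv := hc.convex_effectiveDomain (p := p) ht
  refine ⟨hconv, fun u hu v hv a b ha hb hab => EReal.coe_le_coe_iff.1 ?_⟩
  rw [coe_realValue ht (hconv hu hv ha hb hab)]
  exact hc.coe_realValue_le ht hu hv ha hb hab

lemma IsConcave.isRealFrontier_effectiveDomain (hc : IsConcave F) (ht : ∀ u, F u < ⊤)
    (h : ∀ u, 0 < u → u ≤ p → F u ≠ ⊥) :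
    IsRealFrontier p (effectiveDomain F p) (realValue F) where
  Ioc_subset _ hu := ⟨Ioc_subset_Icc_self hu,
    h _ (Real.toNNReal_pos.2 hu.1) (Real.toNNReal_le_iff_le_coe.2 hu.2)⟩
  subset_Icc _ hu := hu.1
  concave := hc.concaveOn_realValue ht

lemma IsStrictlyConcave.strictConcaveOn_realValue (hs : IsStrictlyConcave F) (hc : IsConcave F)
    (ht : ∀ u, F u < ⊤) : StrictConcaveOn ℝ (effectiveDomain F p) (realValue F) := by
  have hconv := hc.convex_effectiveDomain (p := p) ht
  refine ⟨hconv, fun u hu v hv huv a b ha hb hab => EReal.coe_lt_coe_iff.1 ?_⟩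
  have := hs u.toNNReal v.toNNReal a.toNNReal b.toNNReal hu.2 hv.2
    (fun h => huv ((Real.toNNReal_eq_toNNReal_iff hu.1.1 hv.1.1).1 h))
    (Real.toNNReal_pos.2 ha) (Real.toNNReal_pos.2 hb)
    (by rw [← Real.toNNReal_add ha.le hb.le, hab, Real.toNNReal_one])
  rw [← coe_realValue ht hu, ← coe_realValue ht hv, Real.coe_toNNReal a ha.le,
    Real.coe_toNNReal b hb.le, ← toNNReal_convexCombo ha.le hb.le hu.1.1 hv.1.1] at this
  rw [coe_realValue ht (hconv hu hv ha.le hb.le hab)]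
  exact_mod_cast this

lemma IsFrontier.monotoneOn_realValue (hF : IsFrontier F p) :
    MonotoneOn (realValue F) (effectiveDomain F p) := by
  intro u hu v hv huv
  rcases huv.eq_or_lt with rfl | huv
  · exact le_rfl
  · rw [← EReal.coe_le_coe_iff, coe_realValue hF.lt_top hu, coe_realValue hF.lt_top hv]
    exact (hF.lt_of_between (.inl ⟨(Real.toNNReal_lt_toNNReal_iff (hu.1.1.trans_lt huv)).2 huv,
      Real.toNNReal_le_iff_le_coe.2 hv.1.2⟩) hv.2).le

end Frontier

section DiscountedIntegral

variable {r T : ℝ} {φ ψ : ℝ → EReal}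

/-- The value at time `0` of the extended-real utility flow `φ` over `(0,T)`. -/
def discountedIntegral (r : ℝ) (φ : ℝ → EReal) (T : ℝ) : EReal :=
  erealIntegral (volume.restrict (Ioo 0 T)) fun t => ((r * exp (-r * t) : ℝ) : EReal) * φ t

lemma discountedIntegral_mono (hr : 0 < r) (h : ∀ᵐ t, 0 < t → φ t ≤ ψ t) :
    discountedIntegral r φ T ≤ discountedIntegral r ψ T := by
  refine erealIntegral_mono ((ae_restrict_iff' measurableSet_Ioo).2 ?_)
  filter_upwards [h] with t ht htT
  exact mul_le_mul_of_nonneg_left (ht htT.1) (by exact_mod_cast (discount_pos hr t).le)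

lemma discountedIntegral_coe {a : ℝ → ℝ}
    (ha : IntegrableOn (fun t => r * exp (-r * t) * a t) (Ioo 0 T)) :
    discountedIntegral r (fun t => (a t : EReal)) T = headValue r a T := by
  simp only [discountedIntegral, ← EReal.coe_mul]
  exact erealIntegral_coe ha

lemma discountedIntegral_ne_bot_of_le {τ : ℝ} (hTτ : T ≤ τ) (h : discountedIntegral r φ τ ≠ ⊥) :
    discountedIntegral r φ T ≠ ⊥ := by
  rw [discountedIntegral, Ne, erealIntegral_eq_bot_iff, ← Ne, ← lt_top_iff_ne_top] at h ⊢
  exact (lintegral_mono_set (Ioo_subset_Ioo_right hTτ)).trans_lt h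

lemma aemeasurable_discount_mul (hφ : AEMeasurable φ) :
    AEMeasurable fun t => ((r * exp (-r * t) : ℝ) : EReal) * φ t :=
  (Measurable.coe_real_ereal (by fun_prop)).aemeasurable.mul hφ

lemma ae_ne_bot_of_discountedIntegral_ne_bot (hr : 0 < r) (hφ : AEMeasurable φ)
    (h : ∀ T, discountedIntegral r φ T ≠ ⊥) : ∀ᵐ t, 0 < t → φ t ≠ ⊥ := by
  refine ae_forall_Ioi_of_forall_Ioo fun T => ?_
  filter_upwards [(ae_restrict_iff' measurableSet_Ioo).1
    (ae_ne_bot_of_erealIntegral_ne_bot (aemeasurable_discount_mul hφ).restrict (h T))] with t ht htT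
  exact (coe_mul_eq_bot_iff (discount_pos hr t)).not.1 (ht htT)

lemma integrableOn_discount_mul_const (hr : 0 < r) (c T : ℝ) :
    IntegrableOn (fun t => r * exp (-r * t) * c) (Ioo 0 T) :=
  ((integrableOn_discount_Ioi hr 0).mono_set Ioo_subset_Ioi_self).mul_const c

lemma discount_mul_le {c : ℝ} (hr : 0 < r) (hc : ∀ t, φ t ≤ c) (t : ℝ) :
    ((r * exp (-r * t) : ℝ) : EReal) * φ t ≤ ((r * exp (-r * t) * c : ℝ) : EReal) := by
  rw [EReal.coe_mul _ c]
  exact mul_le_mul_of_nonneg_left (hc t) (by exact_mod_cast (discount_pos hr t).le)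

lemma integrableOn_of_discountedIntegral_ne_bot {c : ℝ} (hr : 0 < r) (hφ : AEMeasurable φ)
    (hc : ∀ t, φ t ≤ c) (h : discountedIntegral r φ T ≠ ⊥) :
    IntegrableOn (fun t => r * exp (-r * t) * (φ t).toReal) (Ioo 0 T) := by
  simpa only [EReal.toReal_mul, EReal.toReal_coe] using!
    integrable_toReal_of_erealIntegral_ne_bot (aemeasurable_discount_mul hφ).restrict
      (integrableOn_discount_mul_const hr c T) (.of_forall (discount_mul_le hr hc)) h

lemma discountedIntegral_eq_headValue {c : ℝ} (hr : 0 < r) (hφ : AEMeasurable φ)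
    (hc : ∀ t, φ t ≤ c) (h : discountedIntegral r φ T ≠ ⊥) :
    discountedIntegral r φ T = headValue r (fun t => (φ t).toReal) T := by
  simpa only [EReal.toReal_mul, EReal.toReal_coe] using!
    erealIntegral_eq_coe_integral_toReal (aemeasurable_discount_mul hφ).restrict
      (integrableOn_discount_mul_const hr c T) (.of_forall (discount_mul_le hr hc)) h

lemma discountedIntegral_le {c : ℝ} (hr : 0 < r) (hc : ∀ t, φ t ≤ c) (hc0 : 0 ≤ c) (hT : 0 ≤ T) :
    discountedIntegral r φ T ≤ c := by
  refine (discountedIntegral_mono hr (.of_forall fun t _ => hc t)).trans ?_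
  rw [discountedIntegral_coe (integrableOn_discount_mul_const hr c T), EReal.coe_le_coe_iff,
    headValue_eq hr (.const c) hT, tailValue_const hr, tailValue_const hr, mul_zero, Real.exp_zero,
    mul_one]
  exact sub_le_self c (mul_nonneg hc0 (Real.exp_nonneg _))

lemma measurable_setIntegral_Ioo {a : ℝ → ℝ} (ha : AEStronglyMeasurable a volume) :
    Measurable fun τ => ∫ t in Ioo 0 τ, a t := by
  have hprod : ∀ τ, ∫ t in Ioo 0 τ, a t = ∫ t, {p : ℝ × ℝ | 0 < p.2 ∧ p.2 < p.1}.indicator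
      (fun p => ha.mk a p.2) (τ, t) := by
    intro τ
    rw [setIntegral_congr_ae measurableSet_Ioo (ha.ae_eq_mk.mono fun t ht _ => ht),
      ← integral_indicator measurableSet_Ioo]
    rfl
  simp_rw [hprod]
  refine (StronglyMeasurable.integral_prod_right' ?_).measurable
  refine (ha.stronglyMeasurable_mk.comp_measurable measurable_snd).indicator ?_
  exact (measurableSet_lt measurable_const measurable_snd).inter
    (measurableSet_lt measurable_snd measurable_fst)

lemma measurable_headValue {a : ℝ → ℝ} (ha : AEMeasurable a) : Measurable (headValue r a) :=
  measurable_setIntegral_Ioo (AEMeasurable.aestronglyMeasurable (AEMeasurable.mul (by fun_prop) ha))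

end DiscountedIntegral

section Payoff

variable {r τ : ℝ} {F0 F1 : ℝ≥0 → EReal} {u0 u1 : ℝ≥0} {G : Measure ℝ} {m m' : Mechanism}

lemma IsTechnology.F0_ne_bot (hF : IsTechnology F0 F1 u0 u1) {u : ℝ≥0} (hu : 0 < u)
    (huu : u ≤ u0) : F0 u ≠ ⊥ :=
  (hF.finite0 u hu huu).ne'

lemma IsTechnology.F1_ne_bot (hF : IsTechnology F0 F1 u0 u1) {u : ℝ≥0} (hu : 0 < u)
    (huu : u ≤ u0) : F1 u ≠ ⊥ :=
  ((hF.finite0 u hu huu).trans_le (hF.le u)).ne'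

lemma IsFrontier.coe_toReal_peak {F : ℝ≥0 → EReal} {p : ℝ≥0} (hF : IsFrontier F p) :
    ((F p).toReal : EReal) = F p :=
  EReal.coe_toReal (hF.lt_top p).ne hF.peak_ne_bot

lemma IsFrontier.aemeasurable_comp_flow {F : ℝ≥0 → EReal} {p : ℝ≥0} (hF : IsFrontier F p)
    (m : Mechanism) : AEMeasurable (fun t => F (m.flow t)) :=
  hF.usc.measurable.comp_aemeasurable m.measurable_flow

/-- The principal's payoff from the mechanism `m` when the breakthrough arrives at time `τ`. -/
def payoffAt (r : ℝ) (F0 F1 : ℝ≥0 → EReal) (m : Mechanism) (τ : ℝ) : EReal :=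
  discountedIntegral r (fun t => F0 (m.flow t)) τ
    + ((exp (-r * τ) : ℝ) : EReal) * extendFrontier F1 (m.reward τ)

/-- The real counterpart of `payoffAt`, equal to it where both frontiers are finite along `m`. -/
def realPayoffAt (r : ℝ) (F0 F1 : ℝ≥0 → EReal) (m : Mechanism) (τ : ℝ) : ℝ :=
  headValue r (fun t => (F0 (m.flow t)).toReal) τ
    + exp (-r * τ) * (extendFrontier F1 (m.reward τ)).toReal

/-- The payoff of the mechanism `m` under `G` can be computed with real integrals. -/
structure HasRealPayoff (r : ℝ) (F0 F1 : ℝ≥0 → EReal) (G : Measure ℝ) (m : Mechanism) : Prop where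
  flow_ne_bot : ∀ᵐ t, 0 < t → F0 (m.flow t) ≠ ⊥
  integrableOn : ∀ T, IntegrableOn (fun t => r * exp (-r * t) * (F0 (m.flow t)).toReal) (Ioo 0 T)
  discountedIntegral_eq : ∀ T, discountedIntegral r (fun t => F0 (m.flow t)) T
    = headValue r (fun t => (F0 (m.flow t)).toReal) T
  reward_ne_bot : ∀ᵐ τ ∂G, extendFrontier F1 (m.reward τ) ≠ ⊥
  integrable : Integrable (realPayoffAt r F0 F1 m) G
  payoff_eq : payoff r F0 F1 G m = ((∫ τ, realPayoffAt r F0 F1 m τ ∂G : ℝ) : EReal)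

lemma IsIC.antitoneOn_exp_mul_reward (hm : IsIC r m) :
    AntitoneOn (fun t => ENNReal.ofReal (exp (-r * t)) * m.reward t) (Ici 0) := by
  intro s hs t _ hst
  rcases hst.eq_or_lt with rfl | hlt
  · exact le_rfl
  have hdelay := le_add_self.trans ((hm s hs).1 (t - s) (sub_pos.2 hlt))
  rw [add_sub_cancel] at hdelay
  calc ENNReal.ofReal (exp (-r * t)) * m.reward t
      = ENNReal.ofReal (exp (-r * s)) * (ENNReal.ofReal (exp (-r * (t - s))) * m.reward t) := by
        rw [← mul_assoc, ← ENNReal.ofReal_mul (Real.exp_nonneg _), ← Real.exp_add]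
        ring_nf
    _ ≤ _ := mul_le_mul' le_rfl hdelay

lemma IsIC.aemeasurable_reward (hm : IsIC r m) (hG : IsUnboundedDistribution G) :
    AEMeasurable m.reward G := by
  have hdisc := aemeasurable_restrict_of_antitoneOn (μ := G) measurableSet_Ici
    hm.antitoneOn_exp_mul_reward
  rw [Measure.restrict_eq_self_of_ae_mem (s := Ici 0) hG.ae_nonneg] at hdisc
  have hexp : Measurable fun t => ENNReal.ofReal (exp (r * t)) := by fun_prop
  refine (hexp.aemeasurable.mul hdisc).congr (.of_forall fun t => ?_)
  simp only [Pi.mul_apply]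
  rw [← mul_assoc, ← ENNReal.ofReal_mul (Real.exp_nonneg _), exp_mul_exp_neg, ENNReal.ofReal_one,
    one_mul]

lemma IsUnboundedDistribution.lintegral_eq_top (hG : IsUnboundedDistribution G) {f : ℝ → ℝ≥0∞}
    {T : ℝ} (h : ∀ τ, T < τ → f τ = ⊤) : ∫⁻ τ, f τ ∂G = ⊤ := by
  rw [eq_top_iff]
  calc ⊤ = ⊤ * G (Ioi T) := (ENNReal.top_mul (hG.tail_pos T).ne').symm
    _ = ∫⁻ _ in Ioi T, ⊤ ∂G := by rw [setLIntegral_const]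
    _ = ∫⁻ τ in Ioi T, f τ ∂G :=
      setLIntegral_congr_fun measurableSet_Ioi fun τ hτ => (h τ hτ).symm
    _ ≤ ∫⁻ τ, f τ ∂G := setLIntegral_le_lintegral _ _

lemma discountedIntegral_ne_bot_of_payoff_ne_bot (hG : IsUnboundedDistribution G)
    (h : payoff r F0 F1 G m ≠ ⊥) (T : ℝ) :
    discountedIntegral r (fun t => F0 (m.flow t)) T ≠ ⊥ := by
  contrapose h
  refine erealIntegral_eq_bot_iff.2 (hG.lintegral_eq_top (T := T) fun τ hτ => ?_)
  rw [EReal.toENNReal_eq_top_iff, EReal.neg_eq_top_iff, EReal.add_eq_bot_iff]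
  exact .inl (not_ne_iff.1 fun hne => discountedIntegral_ne_bot_of_le hτ.le hne h)

lemma payoffAt_ne_bot_iff_of_discountedIntegral
    (h : discountedIntegral r (fun t => F0 (m.flow t)) τ ≠ ⊥) :
    payoffAt r F0 F1 m τ ≠ ⊥ ↔ extendFrontier F1 (m.reward τ) ≠ ⊥ := by
  rw [payoffAt, EReal.add_ne_bot_iff]
  exact (and_iff_right h).trans (coe_mul_eq_bot_iff (Real.exp_pos _)).not

lemma payoffAt_le (hr : 0 < r) (h0 : IsFrontier F0 u0) (h1 : IsFrontier F1 u1) (hτ : 0 ≤ τ) :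
    payoffAt r F0 F1 m τ ≤ ((|(F0 u0).toReal| + |(F1 u1).toReal| : ℝ) : EReal) := by
  rw [EReal.coe_add]
  refine add_le_add (discountedIntegral_le hr (fun t => ?_) (abs_nonneg _) hτ) ?_
  · exact (h0.le_peak _).trans (h0.coe_toReal_peak.symm.le.trans
      (EReal.coe_le_coe_iff.2 (le_abs_self _)))
  · refine (mul_le_mul_of_nonneg_left ((h1.extend_le_peak _).trans h1.coe_toReal_peak.symm.le)
      (by exact_mod_cast Real.exp_nonneg _)).trans ?_
    rw [← EReal.coe_mul, EReal.coe_le_coe_iff]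
    have hexp : exp (-r * τ) ≤ 1 := Real.exp_le_one_iff.2 (by nlinarith)
    exact (mul_le_mul_of_nonneg_left (le_abs_self _) (Real.exp_nonneg _)).trans
      (mul_le_of_le_one_left (abs_nonneg _) hexp)

lemma toReal_payoffAt (h1 : IsFrontier F1 u1)
    (hinner : discountedIntegral r (fun t => F0 (m.flow t)) τ
      = headValue r (fun t => (F0 (m.flow t)).toReal) τ)
    (hreward : extendFrontier F1 (m.reward τ) ≠ ⊥) :
    (payoffAt r F0 F1 m τ).toReal = realPayoffAt r F0 F1 m τ := by
  rw [payoffAt, hinner, EReal.toReal_add (EReal.coe_ne_top _) (EReal.coe_ne_bot _)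
    (coe_mul_ne_top (Real.exp_pos _) ((h1.extend_le_peak _).trans_lt (h1.lt_top _)).ne)
    ((coe_mul_eq_bot_iff (Real.exp_pos _)).not.2 hreward), EReal.toReal_mul, EReal.toReal_coe,
    EReal.toReal_coe, realPayoffAt]

lemma HasRealPayoff.of_payoff_ne_bot (hr : 0 < r) (h0 : IsFrontier F0 u0) (h1 : IsFrontier F1 u1)
    (hG : IsUnboundedDistribution G) (hm : IsIC r m) (h : payoff r F0 F1 G m ≠ ⊥) :
    HasRealPayoff r F0 F1 G m := by
  have := hG.prob
  have hflow := h0.aemeasurable_comp_flow m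
  have hle : ∀ t, F0 (m.flow t) ≤ ((F0 u0).toReal : EReal) := fun t =>
    (h0.le_peak _).trans_eq h0.coe_toReal_peak.symm
  have hinner_ne := discountedIntegral_ne_bot_of_payoff_ne_bot hG h
  have hinner := fun T => discountedIntegral_eq_headValue hr hflow hle (hinner_ne T)
  have hmeas : AEMeasurable (payoffAt r F0 F1 m) G := by
    have hpayoffAt : payoffAt r F0 F1 m = fun τ =>
        ((headValue r (fun t => (F0 (m.flow t)).toReal) τ : ℝ) : EReal)
          + ((exp (-r * τ) : ℝ) : EReal) * extendFrontier F1 (m.reward τ) :=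
      funext fun τ => by rw [payoffAt, hinner]
    rw [hpayoffAt]
    exact (measurable_headValue hflow.ereal_toReal).coe_real_ereal.aemeasurable.add
      ((Measurable.coe_real_ereal (by fun_prop)).aemeasurable.mul
        (h1.measurable_extend.comp_aemeasurable (hm.aemeasurable_reward hG)))
  have hbound : ∀ᵐ τ ∂G, payoffAt r F0 F1 m τ
      ≤ ((|(F0 u0).toReal| + |(F1 u1).toReal| : ℝ) : EReal) :=
    hG.ae_nonneg.mono fun τ => payoffAt_le hr h0 h1
  have hreward : ∀ᵐ τ ∂G, extendFrontier F1 (m.reward τ) ≠ ⊥ :=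
    (ae_ne_bot_of_erealIntegral_ne_bot hmeas h).mono fun τ =>
      (payoffAt_ne_bot_iff_of_discountedIntegral (hinner_ne τ)).1
  have hreal : (fun τ => (payoffAt r F0 F1 m τ).toReal) =ᵐ[G] realPayoffAt r F0 F1 m :=
    hreward.mono fun τ => toReal_payoffAt h1 (hinner τ)
  exact
    { flow_ne_bot := ae_ne_bot_of_discountedIntegral_ne_bot hr hflow hinner_ne
      integrableOn T := integrableOn_of_discountedIntegral_ne_bot hr hflow hle (hinner_ne T)
      discountedIntegral_eq := hinner
      reward_ne_bot := hreward
      integrable := (integrable_toReal_of_erealIntegral_ne_bot hmeas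
        (integrable_const _) hbound h).congr hreal
      payoff_eq := (erealIntegral_eq_coe_integral_toReal hmeas (integrable_const _) hbound
        h).trans (congrArg _ (integral_congr_ae hreal)) }

lemma le_payoff (hr : 0 < r) {a b : ℝ → ℝ} (ha : ∀ᵐ t, 0 < t → (a t : EReal) ≤ F0 (m.flow t))
    (hai : ∀ T, IntegrableOn (fun t => r * exp (-r * t) * a t) (Ioo 0 T))
    (hb : ∀ᵐ τ ∂G, (b τ : EReal) ≤ extendFrontier F1 (m.reward τ))
    (habi : Integrable (fun τ => headValue r a τ + exp (-r * τ) * b τ) G) :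
    ((∫ τ, headValue r a τ + exp (-r * τ) * b τ ∂G : ℝ) : EReal) ≤ payoff r F0 F1 G m := by
  rw [← erealIntegral_coe habi]
  refine erealIntegral_mono ?_
  filter_upwards [hb] with τ hτ
  rw [EReal.coe_add, EReal.coe_mul, ← discountedIntegral_coe (hai τ)]
  exact add_le_add (discountedIntegral_mono hr ha)
    (mul_le_mul_of_nonneg_left hτ (by exact_mod_cast Real.exp_nonneg _))

lemma payoff_mono (hr : 0 < r) (hG : G (Iio 0) = 0)
    (h0 : ∀ᵐ t, 0 < t → F0 (m.flow t) ≤ F0 (m'.flow t))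
    (h1 : ∀ τ, 0 ≤ τ → extendFrontier F1 (m.reward τ) ≤ extendFrontier F1 (m'.reward τ)) :
    payoff r F0 F1 G m ≤ payoff r F0 F1 G m' := by
  have hG0 : ∀ᵐ τ ∂G, 0 ≤ τ := ae_iff.2 (by simpa [Iio] using hG)
  refine erealIntegral_mono (hG0.mono fun τ hτ => ?_)
  exact add_le_add (discountedIntegral_mono hr h0)
    (mul_le_mul_of_nonneg_left (h1 τ hτ) (by exact_mod_cast Real.exp_nonneg _))

end Payoff

/-! ### Incentive-compatible mechanisms and their deviations -/

section FlowValue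

variable {r : ℝ} {x : ℝ → ℝ} {m : Mechanism}

lemma antitoneOn_tailValue (hr : 0 < r) (hx : IsBoundedMeasurable x) {a : ℝ}
    (h : ∀ᵐ u, a < u → 0 ≤ x u) : AntitoneOn (tailValue r x) (Ici a) := by
  intro s hs t _ hst
  rw [← sub_nonneg, ← setIntegral_Ioo_eq_tailValue_sub hr hx hst]
  refine setIntegral_nonneg_ae measurableSet_Ioo ?_
  filter_upwards [h] with u hu hust
  exact mul_nonneg (discount_pos hr u).le (hu (hs.trans_lt hust.1))

lemma antitone_tailValue (hr : 0 < r) (hx : IsBoundedMeasurable x) (hx0 : ∀ t, 0 ≤ x t) :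
    Antitone (tailValue r x) := fun _ _ hst =>
  antitoneOn_tailValue hr hx (.of_forall fun u _ => hx0 u) (mem_Ici.2 le_rfl) hst hst

lemma tailValue_nonneg (hr : 0 < r) {t : ℝ} (h : ∀ᵐ s, t < s → 0 ≤ x s) : 0 ≤ tailValue r x t := by
  refine setIntegral_nonneg_ae measurableSet_Ioi ?_
  filter_upwards [h] with s hs hst
  exact mul_nonneg (discount_pos hr s).le (hs hst)

lemma promisedValue_const (hr : 0 < r) (c t : ℝ) : promisedValue r (fun _ => c) t = c := by
  rw [promisedValue, tailValue_const hr, mul_left_comm, exp_mul_exp_neg, mul_one]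

lemma ofReal_exp_neg_mul_ofReal_exp_mul (r t a : ℝ) :
    ENNReal.ofReal (exp (-r * t)) * ENNReal.ofReal (exp (r * t) * a) = ENNReal.ofReal a := by
  rw [← ENNReal.ofReal_mul (Real.exp_nonneg _), ← mul_assoc, mul_comm (exp (-r * t)),
    exp_mul_exp_neg, one_mul]

lemma ofReal_exp_mul_flowValue (hr : 0 < r) (hx : IsBoundedMeasurable x) {z : ℝ → ℝ≥0} {t : ℝ}
    (ht : 0 ≤ t) (hz : ∀ᵐ s, 0 < s → (z s : ℝ) = x s) {S : Set ℝ} (hS : MeasurableSet S)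
    (hSt : S ⊆ Ioi t) : ENNReal.ofReal (exp (-r * t)) * flowValue r z t S
      = ENNReal.ofReal (∫ s in S, r * exp (-r * s) * x s) := by
  have hzS : ∀ᵐ s ∂volume.restrict S, (z s : ℝ) = x s := by
    refine (ae_restrict_iff' hS).2 ?_
    filter_upwards [hz] with s hs hsS
    exact hs (ht.trans_lt (hSt hsS))
  rw [flowValue, ← lintegral_const_mul' _ _ ENNReal.ofReal_ne_top,
    ofReal_integral_eq_lintegral_ofReal ((hx.integrableOn_Ioi hr t).mono_set hSt)]
  · refine lintegral_congr_ae ?_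
    filter_upwards [hzS] with s hs
    rw [← hs, ← ENNReal.ofReal_coe_nnreal, ← mul_assoc, ← ENNReal.ofReal_mul (Real.exp_nonneg _),
      ← ENNReal.ofReal_mul (by positivity), mul_left_comm, ← Real.exp_add]
    ring_nf
  · filter_upwards [hzS] with s hs
    rw [← hs]
    positivity

lemma isIC_iff (hr : 0 < r) (hx : IsBoundedMeasurable x)
    (hz : ∀ᵐ s, 0 < s → (m.flow s : ℝ) = x s) :
    IsIC r m ↔ ∀ t, 0 ≤ t → (∀ s, t < s →
      ENNReal.ofReal (tailValue r x t - tailValue r x s)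
        + ENNReal.ofReal (exp (-r * s)) * m.reward s
          ≤ ENNReal.ofReal (exp (-r * t)) * m.reward t) ∧
      ENNReal.ofReal (tailValue r x t) ≤ ENNReal.ofReal (exp (-r * t)) * m.reward t := by
  have hdiscount : ∀ t a b, a ≤ b ↔
      ENNReal.ofReal (exp (-r * t)) * a ≤ ENNReal.ofReal (exp (-r * t)) * b := fun t _ _ =>
    (ENNReal.mul_le_mul_iff_right (ENNReal.ofReal_pos.2 (Real.exp_pos _)).ne'
      ENNReal.ofReal_ne_top).symm
  refine forall₂_congr fun t ht => and_congr ?_ ?_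
  · have hdelay : ∀ s, t < s → (flowValue r m.flow t (Ioo t s)
        + ENNReal.ofReal (exp (-r * (s - t))) * m.reward s ≤ m.reward t ↔
        ENNReal.ofReal (tailValue r x t - tailValue r x s)
          + ENNReal.ofReal (exp (-r * s)) * m.reward s
            ≤ ENNReal.ofReal (exp (-r * t)) * m.reward t) := by
      intro s hs
      rw [hdiscount t, mul_add, ofReal_exp_mul_flowValue hr hx ht hz measurableSet_Ioo
        Ioo_subset_Ioi_self, setIntegral_Ioo_eq_tailValue_sub hr hx hs.le, ← mul_assoc,
        ← ENNReal.ofReal_mul (Real.exp_nonneg _), ← Real.exp_add, ← mul_add, add_sub_cancel]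
    refine ⟨fun h s hs => (hdelay s hs).1 ?_, fun h d hd => ?_⟩
    · simpa only [add_sub_cancel] using h (s - t) (sub_pos.2 hs)
    · have htd : t < t + d := lt_add_of_pos_right t hd
      simpa only [add_sub_cancel_left] using (hdelay (t + d) htd).2 (h (t + d) htd)
  · rw [hdiscount t, ofReal_exp_mul_flowValue hr hx ht hz measurableSet_Ioi le_rfl, tailValue]

lemma isIC_of_le (hr : 0 < r) {P : ℝ → ℝ} (hx : IsBoundedMeasurable x)
    (hz : ∀ᵐ s, 0 < s → (m.flow s : ℝ) = x s)
    (hP : ∀ t, 0 ≤ t → m.reward t = ENNReal.ofReal (exp (r * t) * P t))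
    (hdec : ∀ s t, 0 ≤ s → s < t → tailValue r x s - tailValue r x t ≤ P s - P t)
    (htail : ∀ t, 0 ≤ t → tailValue r x t ≤ P t) : IsIC r m := by
  have hx0 : ∀ᵐ s, 0 < s → 0 ≤ x s :=
    hz.mono fun s hs hs0 => (m.flow s).coe_nonneg.trans_eq (hs hs0)
  have hP0 : ∀ t, 0 ≤ t → 0 ≤ P t := fun t ht =>
    (tailValue_nonneg hr (hx0.mono fun s hs hts => hs (ht.trans_lt hts))).trans (htail t ht)
  have hreward : ∀ t, 0 ≤ t → ENNReal.ofReal (exp (-r * t)) * m.reward t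
      = ENNReal.ofReal (P t) := fun t ht => by
    rw [hP t ht, ofReal_exp_neg_mul_ofReal_exp_mul]
  refine (isIC_iff hr hx hz).2 fun t ht => ⟨fun s hs => ?_, ?_⟩
  · have hs0 : 0 ≤ s := ht.trans hs.le
    rw [hreward t ht, hreward s hs0, ← ENNReal.ofReal_add _ (hP0 s hs0)]
    · exact ENNReal.ofReal_le_ofReal (by linarith [hdec t s ht hs])
    · exact sub_nonneg.2 (antitoneOn_tailValue hr hx hx0 ht hs0 hs.le)
  · rw [hreward t ht]
    exact ENNReal.ofReal_le_ofReal (htail t ht)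

/-- The mechanism with flow `x` and the least incentive-compatible rewards: the values that the
agent gets from never disclosing. -/
def valueMechanism (r : ℝ) (hx : IsBoundedMeasurable x) : Mechanism where
  flow t := (x t).toNNReal
  measurable_flow := hx.measurable.real_toNNReal.aemeasurable
  reward t := ENNReal.ofReal (promisedValue r x t)

lemma isIC_valueMechanism (hr : 0 < r) (hx : IsBoundedMeasurable x) (hx0 : ∀ t, 0 < t → 0 ≤ x t) :
    IsIC r (valueMechanism r hx) :=
  isIC_of_le hr hx (.of_forall fun s hs => Real.coe_toNNReal _ (hx0 s hs)) (fun _ _ => rfl)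
    (fun _ _ _ _ => le_rfl) fun _ _ => le_rfl

end FlowValue

section Deviation

variable {r : ℝ} {F0 F1 : ℝ≥0 → EReal} {u0 u1 : ℝ≥0} {G : Measure ℝ} {m k : Mechanism}

lemma IsOptimal.payoff_ne_bot (hr : 0 < r) (hF : IsTechnology F0 F1 u0 u1)
    (hG : IsUnboundedDistribution G) (hm : IsOptimal r F0 F1 G m) : payoff r F0 F1 G m ≠ ⊥ := by
  have := hG.prob
  have hu0 := IsBoundedMeasurable.const (α := ℝ) (u0 : ℝ)
  have hIC := isIC_valueMechanism hr hu0 fun _ _ => u0.2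
  have hflow : ∀ t, (valueMechanism r hu0).flow t = u0 := fun _ => Real.toNNReal_coe
  have hreward : ∀ τ, (valueMechanism r hu0).reward τ = u0 := fun τ =>
    (congrArg ENNReal.ofReal (promisedValue_const hr u0 τ)).trans ENNReal.ofReal_coe_nnreal
  have hfinite : ((∫ τ, headValue r (fun _ => (F0 u0).toReal) τ + exp (-r * τ) * (F1 u0).toReal ∂G
      : ℝ) : EReal) ≤ payoff r F0 F1 G (valueMechanism r hu0) := by
    refine le_payoff hr (.of_forall fun t _ => ?_) (integrableOn_discount_mul_const hr _)
      (.of_forall fun τ => ?_) ?_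
    · rw [hflow]
      exact EReal.coe_toReal_le (hF.F0_ne_bot hF.u0_pos le_rfl)
    · rw [hreward, extendFrontier_coe]
      exact EReal.coe_toReal_le (hF.F1_ne_bot hF.u0_pos le_rfl)
    · exact (((IsBoundedMeasurable.const _).headValue hr).integrable G).add
        (hG.integrable_exp_mul hr (.const _))
  exact ((EReal.bot_lt_coe _).trans_le (hfinite.trans (hm.2 _ hIC))).ne'

lemma IsOptimal.hasRealPayoff (hr : 0 < r) (hF : IsTechnology F0 F1 u0 u1)
    (hG : IsUnboundedDistribution G) (hm : IsOptimal r F0 F1 G m) : HasRealPayoff r F0 F1 G m :=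
  .of_payoff_ne_bot hr hF.frontier0 hF.frontier1 hG hm.1.1 (hm.payoff_ne_bot hr hF hG)

lemma headValue_add {a q : ℝ → ℝ} {T : ℝ}
    (ha : IntegrableOn (fun t => r * exp (-r * t) * a t) (Ioo 0 T))
    (hq : IntegrableOn (fun t => r * exp (-r * t) * q t) (Ioo 0 T)) :
    headValue r (fun t => a t + q t) T = headValue r a T + headValue r q T := by
  simp only [headValue, mul_add]
  exact integral_add ha hq

lemma IsOptimal.deviation_nonpos (hr : 0 < r) (hF : IsTechnology F0 F1 u0 u1)
    (hG : IsUnboundedDistribution G) (hm : IsOptimal r F0 F1 G m) (hk : IsIC r k)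
    {q j : ℝ → ℝ} (hq : IsBoundedMeasurable q) (hj : IsBoundedMeasurable j)
    (h0 : ∀ᵐ t, 0 < t → (((F0 (m.flow t)).toReal + q t : ℝ) : EReal) ≤ F0 (k.flow t))
    (h1 : ∀ᵐ τ ∂G, (((extendFrontier F1 (m.reward τ)).toReal + j τ : ℝ) : EReal)
      ≤ extendFrontier F1 (k.reward τ)) :
    ∫ τ, headValue r q τ + exp (-r * τ) * j τ ∂G ≤ 0 := by
  have := hG.prob
  have hreal := hm.hasRealPayoff hr hF hG
  have hq_int : ∀ T, IntegrableOn (fun s => r * exp (-r * s) * q s) (Ioo 0 T) := fun T =>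
    (hq.integrableOn_Ioi hr 0).mono_set Ioo_subset_Ioi_self
  have hsum : ∀ τ, headValue r (fun t => (F0 (m.flow t)).toReal + q t) τ
      + exp (-r * τ) * ((extendFrontier F1 (m.reward τ)).toReal + j τ)
      = realPayoffAt r F0 F1 m τ + (headValue r q τ + exp (-r * τ) * j τ) := by
    intro τ
    rw [headValue_add (hreal.integrableOn τ) (hq_int τ), realPayoffAt]
    ring
  have hgain : Integrable (fun τ => headValue r q τ + exp (-r * τ) * j τ) G :=
    ((hq.headValue hr).integrable G).add (hG.integrable_exp_mul hr hj)
  have hle := (le_payoff hr h0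
    (fun T => by simpa only [mul_add] using! (hreal.integrableOn T).add (hq_int T)) h1
    (by simpa only [hsum] using! hreal.integrable.add hgain)).trans (hm.2 k hk)
  rw [hreal.payoff_eq, EReal.coe_le_coe_iff, integral_congr_ae (.of_forall hsum),
    integral_add hreal.integrable hgain] at hle
  linarith

lemma exists_isBoundedMeasurable_gap {α : Type*} [MeasurableSpace α] {μ : Measure α}
    {A B : α → EReal} (hA : AEMeasurable A μ) (hB : AEMeasurable B μ) :
    ∃ q : α → ℝ, IsBoundedMeasurable q ∧ (∀ t, 0 ≤ q t) ∧
      ∀ᵐ t ∂μ, A t ≠ ⊥ → A t ≤ B t → B t ≠ ⊤ →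
        (((A t).toReal + q t : ℝ) : EReal) ≤ B t ∧ (q t = 0 → A t = B t) := by
  have hA' := hA.ereal_toReal
  have hB' := hB.ereal_toReal
  refine ⟨fun t => max 0 (min 1 (hB'.mk _ t - hA'.mk _ t)),
    .of_mem_Icc (a := 0) (b := 1)
      (measurable_const.max (measurable_const.min (hB'.measurable_mk.sub hA'.measurable_mk)))
      fun t => ⟨le_max_left _ _, max_le zero_le_one (min_le_left _ _)⟩,
    fun t => le_max_left _ _, ?_⟩
  filter_upwards [hA'.ae_eq_mk, hB'.ae_eq_mk] with t hAt hBt hbot hle htop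
  rw [← hAt, ← hBt]
  lift B t to ℝ using ⟨htop, ne_bot_of_le_ne_bot hbot hle⟩ with b
  lift A t to ℝ using ⟨(hle.trans_lt (EReal.coe_lt_top b)).ne, hbot⟩ with a
  rw [EReal.coe_le_coe_iff] at hle
  simp only [EReal.toReal_coe, EReal.coe_le_coe_iff, EReal.coe_eq_coe_iff]
  have hgap : max 0 (min 1 (b - a)) ≤ b - a := max_le (sub_nonneg.2 hle) (min_le_right _ _)
  refine ⟨by linarith, fun h => hle.antisymm ?_⟩
  rcases min_le_iff.1 (max_eq_left_iff.1 h) with h | h <;> linarith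

lemma IsOptimal.flow_eq_of_le (hr : 0 < r) (hF : IsTechnology F0 F1 u0 u1)
    (hG : IsUnboundedDistribution G) (hm : IsOptimal r F0 F1 G m) (hk : IsIC r k)
    (h0 : ∀ᵐ t, 0 < t → F0 (m.flow t) ≤ F0 (k.flow t))
    (h1 : ∀ τ, 0 ≤ τ → extendFrontier F1 (m.reward τ) ≤ extendFrontier F1 (k.reward τ)) :
    ∀ᵐ t, 0 < t → F0 (m.flow t) = F0 (k.flow t) := by
  have hreal := hm.hasRealPayoff hr hF hG
  obtain ⟨q, hq, hq0, hgap⟩ := exists_isBoundedMeasurable_gap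
    (hF.frontier0.aemeasurable_comp_flow m) (hF.frontier0.aemeasurable_comp_flow k)
  have hgap : ∀ᵐ t, 0 < t → (((F0 (m.flow t)).toReal + q t : ℝ) : EReal) ≤ F0 (k.flow t) ∧
      (q t = 0 → F0 (m.flow t) = F0 (k.flow t)) := by
    filter_upwards [hgap, h0, hreal.flow_ne_bot] with t hgap h0 hbot ht
    exact hgap (hbot ht) (h0 ht) (hF.frontier0.lt_top _).ne
  have hdev := hm.deviation_nonpos hr hF hG hk hq (.const 0)
    (hgap.mono fun t h ht => (h ht).1) (by
      filter_upwards [hG.ae_nonneg, hreal.reward_ne_bot] with τ hτ hbot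
      rw [add_zero]
      exact (EReal.coe_toReal_le hbot).trans (h1 τ hτ))
  simp only [mul_zero, add_zero] at hdev
  filter_upwards [hG.ae_eq_zero_of_integral_headValue hr hq hq0 hdev, hgap] with t hqt h ht
  exact (h ht).2 (hqt ht)

end Deviation

/-! ### The least incentive-compatible promise -/

section Promise

variable {r p : ℝ} {x P N : ℝ → ℝ}

lemma tailValue_sub_le (hr : 0 < r) (hx : IsBoundedMeasurable x) (hxp : ∀ t, x t ≤ p) {s t : ℝ}
    (hst : s ≤ t) :
    tailValue r x s - tailValue r x t ≤ p * exp (-r * s) - p * exp (-r * t) := by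
  have hp := IsBoundedMeasurable.const (α := ℝ) p
  have h := antitone_tailValue hr (hp.sub hx) (fun t => sub_nonneg.2 (hxp t)) hst
  simp only [tailValue_sub hr hp hx, tailValue_const hr] at h
  linarith

/-- A lower bound, valued at time `0`, for what the agent can be promised at time `t` if she is to
get `N s` at time `s`: for `t ≤ s` she consumes at least `x` until `s`, and for `s ≤ t` her claim
shrinks between `s` and `t` at most as fast as under the constant flow `p`. When `x ≤ p`, the `min`
selects the bound that is relevant in each of the two cases. -/
def deferredPromise (r p : ℝ) (x N : ℝ → ℝ) (t s : ℝ) : ℝ :=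
  exp (-r * s) * N s
    + min (tailValue r x t - tailValue r x s) (p * exp (-r * t) - p * exp (-r * s))

lemma deferredPromise_le_peak {s : ℝ} (hN : N s ≤ p) (t : ℝ) :
    deferredPromise r p x N t s ≤ p * exp (-r * t) := by
  have h := mul_le_mul_of_nonneg_left hN (Real.exp_nonneg (-r * s))
  have := min_le_right (tailValue r x t - tailValue r x s) (p * exp (-r * t) - p * exp (-r * s))
  rw [deferredPromise]
  linarith

lemma deferredPromise_self (t : ℝ) : deferredPromise r p x N t t = exp (-r * t) * N t := by
  simp only [deferredPromise, sub_self, min_self, add_zero]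

lemma deferredPromise_sub_mem {s t : ℝ}
    (h : tailValue r x s - tailValue r x t ≤ p * exp (-r * s) - p * exp (-r * t)) (u : ℝ) :
    deferredPromise r p x N s u - deferredPromise r p x N t u ∈
      Icc (tailValue r x s - tailValue r x t) (p * exp (-r * s) - p * exp (-r * t)) := by
  simp only [deferredPromise, mem_Icc]
  constructor <;>
    rcases min_cases (tailValue r x s - tailValue r x u) (p * exp (-r * s) - p * exp (-r * u))
      with ⟨hs, _⟩ | ⟨hs, _⟩ <;>
    rcases min_cases (tailValue r x t - tailValue r x u) (p * exp (-r * t) - p * exp (-r * u))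
      with ⟨ht, _⟩ | ⟨ht, _⟩ <;> rw [hs, ht] <;> linarith

/-- The smallest path of promises that never falls below `N` and decreases at least as fast as
under the flow `x` and at most as fast as under the constant flow `p`; it is valued at time `0`. -/
def leastPromise (r p : ℝ) (x N : ℝ → ℝ) (t : ℝ) : ℝ :=
  ⨆ s : Ici (0 : ℝ), deferredPromise r p x N t s

lemma deferredPromise_le_leastPromise (hN : ∀ t, N t ≤ p) (t : ℝ) (s : Ici (0 : ℝ)) :
    deferredPromise r p x N t s ≤ leastPromise r p x N t :=
  le_ciSup (f := fun s : Ici (0 : ℝ) => deferredPromise r p x N t s)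
    ⟨p * exp (-r * t), forall_mem_range.2 fun s => deferredPromise_le_peak (hN s) t⟩ s

lemma leastPromise_le_peak (hN : ∀ t, N t ≤ p) (t : ℝ) :
    leastPromise r p x N t ≤ p * exp (-r * t) :=
  ciSup_le fun s => deferredPromise_le_peak (hN s) t

lemma le_leastPromise (hN : ∀ t, N t ≤ p) {t : ℝ} (ht : 0 ≤ t) :
    exp (-r * t) * N t ≤ leastPromise r p x N t :=
  (deferredPromise_self t).ge.trans (deferredPromise_le_leastPromise hN t ⟨t, ht⟩)

lemma leastPromise_sub_mem (hr : 0 < r) (hx : IsBoundedMeasurable x) (hxp : ∀ t, x t ≤ p)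
    (hN : ∀ t, N t ≤ p) {s t : ℝ} (hst : s ≤ t) :
    leastPromise r p x N s - leastPromise r p x N t ∈
      Icc (tailValue r x s - tailValue r x t) (p * exp (-r * s) - p * exp (-r * t)) := by
  have hsub := deferredPromise_sub_mem (N := N) (tailValue_sub_le hr hx hxp hst)
  constructor
  · rw [le_sub_comm]
    refine ciSup_le fun u => ?_
    linarith [(hsub u).1, deferredPromise_le_leastPromise (r := r) (x := x) hN s u]
  · rw [sub_le_iff_le_add]
    refine ciSup_le fun u => ?_
    linarith [(hsub u).2, deferredPromise_le_leastPromise (r := r) (x := x) hN t u]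

lemma tailValue_le_leastPromise (hr : 0 < r) (hx : IsBoundedMeasurable x) (hxp : ∀ t, x t ≤ p)
    (hN : ∀ t, N t ∈ Icc 0 p) (t : ℝ) : tailValue r x t ≤ leastPromise r p x N t := by
  have hNp : ∀ t, N t ≤ p := fun t => (hN t).2
  have hlim := (tendsto_tailValue hr hx).const_sub (tailValue r x t)
  rw [sub_zero] at hlim
  refine le_of_tendsto hlim ?_
  filter_upwards [eventually_ge_atTop 0, eventually_ge_atTop t] with s hs0 hts
  have hnonneg : 0 ≤ leastPromise r p x N s :=
    (mul_nonneg (Real.exp_nonneg _) (hN s).1).trans (le_leastPromise hNp hs0)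
  linarith [(leastPromise_sub_mem hr hx hxp hNp hts).1]

lemma tendsto_leastPromise (hr : 0 < r) (hx : IsBoundedMeasurable x) (hxp : ∀ t, x t ≤ p)
    (hN : ∀ t, N t ∈ Icc 0 p) : Tendsto (leastPromise r p x N) atTop (nhds 0) := by
  refine tendsto_of_tendsto_of_tendsto_of_le_of_le (tendsto_tailValue hr hx)
    (tendsto_tailValue hr (.const p)) (tailValue_le_leastPromise hr hx hxp hN) fun t => ?_
  rw [tailValue_const hr]
  exact leastPromise_le_peak (fun t => (hN t).2) t

lemma leastPromise_le (hr : 0 < r) {n t R : ℝ} (hNn : ∀ t, N t ≤ n) (hnp : n ≤ p) (hnR : n ≤ R)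
    (h : ∀ s, t < s → tailValue r x t - tailValue r x s + exp (-r * s) * N s ≤ exp (-r * t) * R) :
    leastPromise r p x N t ≤ exp (-r * t) * R := by
  refine ciSup_le fun s => ?_
  rw [deferredPromise]
  rcases lt_or_ge t s with hts | hst
  · linarith [h s hts, min_le_left (tailValue r x t - tailValue r x s)
      (p * exp (-r * t) - p * exp (-r * s))]
  · have hexp : exp (-r * t) ≤ exp (-r * s) := Real.exp_le_exp.2 (by nlinarith)
    calc exp (-r * s) * N s
          + min (tailValue r x t - tailValue r x s) (p * exp (-r * t) - p * exp (-r * s))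
        ≤ exp (-r * s) * n + (p * exp (-r * t) - p * exp (-r * s)) := by
          gcongr
          exacts [hNn s, min_le_right _ _]
      _ ≤ exp (-r * t) * n := by nlinarith [mul_nonneg (sub_nonneg.2 hnp) (sub_nonneg.2 hexp)]
      _ ≤ exp (-r * t) * R := by gcongr

lemma deriv_mem_Icc_of_antitone_of_monotone_sub {E : ℝ → ℝ} {E' t : ℝ} (hP : Antitone P)
    (hPE : Monotone fun t => P t - E t) (hE : HasDerivAt E E' t) : deriv P t ∈ Icc E' 0 := by
  have hE' : E' ≤ 0 := by
    have hanti : Antitone E := fun u v huv => by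
      have : P u - E u ≤ P v - E v := hPE huv
      linarith [hP huv]
    exact hE.deriv ▸ hanti.deriv_nonpos
  by_cases hd : DifferentiableAt ℝ P t
  · have hsub : 0 ≤ deriv (fun t => P t - E t) t := hPE.deriv_nonneg
    rw [(hd.hasDerivAt.fun_sub hE).deriv] at hsub
    exact ⟨sub_nonneg.1 hsub, hP.deriv_nonpos⟩
  · rw [deriv_zero_of_not_differentiableAt hd]
    exact ⟨hE', le_rfl⟩

lemma dist_le_dist_of_antitone_of_monotone_sub {E : ℝ → ℝ} (hP : Antitone P)
    (hPE : Monotone fun t => P t - E t) (u v : ℝ) : dist (P u) (P v) ≤ dist (E u) (E v) := by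
  wlog huv : u ≤ v generalizing u v
  · rw [dist_comm, dist_comm (E u)]
    exact this v u (le_of_not_ge huv)
  have hsub : P u - E u ≤ P v - E v := hPE huv
  rw [Real.dist_eq, Real.dist_eq, abs_of_nonneg (sub_nonneg.2 (hP huv))]
  exact (le_abs_self _).trans' (by linarith)

lemma absolutelyContinuousOnInterval_of_dist_le {E : ℝ → ℝ} {a b : ℝ}
    (hE : AbsolutelyContinuousOnInterval E a b)
    (h : ∀ u v, dist (P u) (P v) ≤ dist (E u) (E v)) : AbsolutelyContinuousOnInterval P a b :=
  squeeze_zero (fun _ => Finset.sum_nonneg fun _ _ => dist_nonneg)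
    (fun _ => Finset.sum_le_sum fun _ _ => h _ _) hE

lemma eq_of_sub_eq_of_tendsto {f g : ℝ → ℝ} {l : ℝ}
    (h : ∀ s t, s ≤ t → f s - f t = g s - g t) (hf : Tendsto f atTop (nhds l))
    (hg : Tendsto g atTop (nhds l)) (t : ℝ) : f t = g t := by
  have hlim : Tendsto (fun u => f t - f u) atTop (nhds (g t - l)) :=
    (hg.const_sub (g t)).congr' <| (eventually_ge_atTop t).mono fun u hu => (h t u hu).symm
  exact sub_left_injective (tendsto_nhds_unique (hf.const_sub (f t)) hlim)

lemma exists_tailValue_eq (hr : 0 < r) (hP : Antitone P)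
    (hPE : Monotone fun t => P t - p * exp (-r * t)) (hlim : Tendsto P atTop (nhds 0)) :
    ∃ z, IsBoundedMeasurable z ∧ (∀ t, z t ∈ Icc 0 p) ∧ ∀ t, tailValue r z t = P t := by
  have hE : ∀ t, HasDerivAt (fun t => p * exp (-r * t)) (-(p * (r * exp (-r * t)))) t := fun t =>
    (((hasDerivAt_const_mul (-r)).exp).const_mul p).congr_deriv (by ring)
  have hderiv := fun t => deriv_mem_Icc_of_antitone_of_monotone_sub hP hPE (hE t)
  set z : ℝ → ℝ := fun t => -deriv P t / (r * exp (-r * t))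
  have hz_mem : ∀ t, z t ∈ Icc 0 p := fun t =>
    ⟨div_nonneg (neg_nonneg.2 (hderiv t).2) (discount_pos hr t).le,
      (div_le_iff₀ (discount_pos hr t)).2 (neg_le.1 (hderiv t).1)⟩
  have hz : IsBoundedMeasurable z :=
    .of_mem_Icc ((measurable_deriv P).neg.div (by fun_prop)) hz_mem
  have hsub : ∀ s t, s ≤ t → tailValue r z s - tailValue r z t = P s - P t := by
    intro s t hst
    have hac : AbsolutelyContinuousOnInterval P s t :=
      absolutelyContinuousOnInterval_of_dist_le
        (ContDiffOn.absolutelyContinuousOnInterval (by fun_prop))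
        (dist_le_dist_of_antitone_of_monotone_sub hP hPE)
    rw [← setIntegral_Ioo_eq_tailValue_sub hr hz hst, ← neg_sub, ← hac.integral_deriv_eq_sub,
      intervalIntegral.integral_of_le hst, ← integral_Ioc_eq_integral_Ioo, ← integral_neg]
    refine integral_congr_ae (.of_forall fun u => ?_)
    exact mul_div_cancel₀ _ (discount_pos hr u).ne'
  exact ⟨z, hz, hz_mem, eq_of_sub_eq_of_tendsto hsub (tendsto_tailValue hr hz) hlim⟩

end Promise

/-! ### Binding incentive constraints -/

lemma coe_mul_lt_coe_mul {a : ℝ} (ha : 0 < a) {x y : EReal} (h : x < y) :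
    (a : EReal) * x < (a : EReal) * y := by
  have hcancel : ∀ z : EReal, ((a⁻¹ : ℝ) : EReal) * ((a : EReal) * z) = z := fun z => by
    rw [← mul_assoc, ← EReal.coe_mul, inv_mul_cancel₀ ha.ne', EReal.coe_one, one_mul]
  have hmono : Monotone fun z : EReal => (a : EReal) * z := fun _ _ hz =>
    mul_le_mul_of_nonneg_left hz (EReal.coe_nonneg.2 ha.le)
  exact hmono.strictMono_of_injective (Function.LeftInverse.injective hcancel) h

section Binding

variable {r : ℝ} {F0 F1 : ℝ≥0 → EReal} {u0 u1 : ℝ≥0} {G : Measure ℝ} {m k : Mechanism}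

lemma IsIC.of_flow_le (hm : IsIC r m) (hflow : ∀ t, k.flow t ≤ m.flow t)
    (hreward : k.reward = m.reward) : IsIC r k := by
  have hle : ∀ t S, flowValue r k.flow t S ≤ flowValue r m.flow t S := fun t S =>
    lintegral_mono fun s => mul_le_mul' le_rfl (ENNReal.coe_le_coe.2 (hflow s))
  intro t ht
  rw [hreward]
  exact ⟨fun d hd => (add_le_add (hle _ _) le_rfl).trans ((hm t ht).1 d hd),
    (hle _ _).trans (hm t ht).2⟩

lemma IsOptimal.flow_eq_of_eq_or_lt (hr : 0 < r) (hF : IsTechnology F0 F1 u0 u1)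
    (hG : IsUnboundedDistribution G) (hm : IsOptimal r F0 F1 G m) (hk : IsIC r k)
    (hflow : ∀ᵐ t, 0 < t → m.flow t = k.flow t ∨ F0 (m.flow t) < F0 (k.flow t))
    (hreward : k.reward = m.reward) : ∀ᵐ t, 0 < t → m.flow t = k.flow t := by
  have hle : ∀ᵐ t, 0 < t → F0 (m.flow t) ≤ F0 (k.flow t) :=
    hflow.mono fun t h ht => (h ht).elim (fun h => (congrArg F0 h).le) le_of_lt
  have heq := hm.flow_eq_of_le hr hF hG hk hle fun τ _ => by rw [hreward]
  filter_upwards [hflow, heq] with t h h_eq ht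
  exact (h ht).resolve_right fun hlt => hlt.ne (h_eq ht)

lemma IsOptimal.flow_le_peak (hr : 0 < r) (hF : IsTechnology F0 F1 u0 u1)
    (hG : IsUnboundedDistribution G) (hm : IsOptimal r F0 F1 G m) :
    ∀ᵐ t, 0 < t → m.flow t ≤ u0 := by
  let k : Mechanism :=
    ⟨fun t => min (m.flow t) u0, m.measurable_flow.min aemeasurable_const, m.reward⟩
  have hk : IsIC r k := hm.1.1.of_flow_le (fun t => min_le_left _ _) rfl
  have heq := hm.flow_eq_of_eq_or_lt hr hF hG hk (.of_forall fun t _ => ?_) rfl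
  · filter_upwards [heq] with t h ht
    exact min_eq_left_iff.1 (h ht).symm
  · rcases le_or_gt (m.flow t) u0 with h | h
    · exact .inl (min_eq_left h).symm
    · refine .inr ?_
      rw [show k.flow t = u0 from min_eq_right h.le]
      exact hF.frontier0.peak _ h.ne'

lemma IsOptimal.exists_flow (hr : 0 < r) (hF : IsTechnology F0 F1 u0 u1)
    (hG : IsUnboundedDistribution G) (hm : IsOptimal r F0 F1 G m) :
    ∃ x, IsBoundedMeasurable x ∧ (∀ t, x t ∈ effectiveDomain F0 u0) ∧
      ∀ᵐ t, 0 < t → (m.flow t : ℝ) = x t := by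
  classical
  have hf := m.measurable_flow
  let D : Set ℝ≥0 := Iic u0 ∩ {u | F0 u ≠ ⊥}
  have hD : MeasurableSet D :=
    measurableSet_Iic.inter (hF.frontier0.usc.measurable (measurableSet_singleton ⊥)).compl
  have hu0 : u0 ∈ D := ⟨mem_Iic.2 le_rfl, hF.F0_ne_bot hF.u0_pos le_rfl⟩
  let x : ℝ → ℝ≥0 := fun t => if hf.mk _ t ∈ D then hf.mk _ t else u0
  have hx : Measurable x :=
    .ite (hf.measurable_mk hD) hf.measurable_mk measurable_const
  have hx_mem : ∀ t, x t ∈ D := fun t => by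
    dsimp only [x]
    split_ifs with h
    exacts [h, hu0]
  have hx_Icc : ∀ t, (x t : ℝ) ∈ Icc 0 (u0 : ℝ) := fun t =>
    ⟨(x t).2, NNReal.coe_le_coe.2 (hx_mem t).1⟩
  refine ⟨fun t => x t, .of_mem_Icc hx.coe_nnreal_real hx_Icc, fun t => ⟨hx_Icc t, ?_⟩, ?_⟩
  · rw [Real.toNNReal_coe]
    exact (hx_mem t).2
  · filter_upwards [hm.flow_le_peak hr hF hG, (hm.hasRealPayoff hr hF hG).flow_ne_bot,
      hf.ae_eq_mk] with t hle hbot hmk ht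
    have hmem : hf.mk _ t ∈ D := hmk ▸ ⟨hle ht, hbot ht⟩
    exact NNReal.coe_inj.2 (hmk.trans (if_pos hmem).symm)

lemma IsTechnology.extend_lt (hF : IsTechnology F0 F1 u0 u1) {X : ℝ≥0∞} {Z : ℝ≥0} (hZ : Z ≤ u0)
    (hminZ : min X u1 ≤ Z) (hZmax : Z ≤ max X u1) (hne : X ≠ Z) :
    extendFrontier F1 X < extendFrontier F1 Z := by
  have hpos : 0 < Z → F1 Z ≠ ⊥ := fun h => hF.F1_ne_bot h hZ
  have hge : u1 ≤ Z → F1 Z ≠ ⊥ := fun h => by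
    rcases h.eq_or_lt with rfl | h
    · exact hF.frontier1.peak_ne_bot
    · exact hpos (zero_le.trans_lt h)
  rw [extendFrontier_coe]
  induction X with
  | top =>
    rw [extendFrontier, if_pos rfl, bot_lt_iff_ne_bot]
    exact hge (by simpa using hminZ)
  | coe X =>
    rw [extendFrontier_coe]
    norm_cast at hminZ hZmax hne
    rcases le_total X u1 with h | h
    · rw [min_eq_left h] at hminZ
      rw [max_eq_right h] at hZmax
      have hXZ := hminZ.lt_of_ne hne
      exact hF.frontier1.lt_of_between (.inl ⟨hXZ, hZmax⟩) (hpos (zero_le.trans_lt hXZ))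
    · rw [min_eq_right h] at hminZ
      rw [max_eq_left h] at hZmax
      exact hF.frontier1.lt_of_between (.inr ⟨hminZ, hZmax.lt_of_ne' hne⟩) (hge hminZ)

/-- A reward that is strictly better at a single date `t` is strictly better for the distribution
`δ_t`, so that `m` would be dominated even if `G` does not charge `t`. -/
lemma IsOptimal.reward_eq (hr : 0 < r) (hF : IsTechnology F0 F1 u0 u1)
    (hG : IsUnboundedDistribution G) (hm : IsOptimal r F0 F1 G m) (hk : IsIC r k)
    (hflow : k.flow = m.flow) {Z : ℝ → ℝ≥0} (hkZ : ∀ t, 0 ≤ t → k.reward t = Z t)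
    (hZ : ∀ t, 0 ≤ t → Z t ≤ u0) (hminZ : ∀ t, 0 ≤ t → min (m.reward t) u1 ≤ Z t)
    (hZmax : ∀ t, 0 ≤ t → Z t ≤ max (m.reward t) u1) {t : ℝ} (ht : 0 ≤ t) :
    m.reward t = Z t := by
  by_contra hne
  have hlt : ∀ τ, 0 ≤ τ → m.reward τ ≠ Z τ →
      extendFrontier F1 (m.reward τ) < extendFrontier F1 (k.reward τ) := fun τ hτ h => by
    rw [hkZ τ hτ]
    exact hF.extend_lt (hZ τ hτ) (hminZ τ hτ) (hZmax τ hτ) h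
  have hle : ∀ τ, 0 ≤ τ → extendFrontier F1 (m.reward τ) ≤ extendFrontier F1 (k.reward τ) := by
    intro τ hτ
    by_cases h : m.reward τ = Z τ
    · rw [h, hkZ τ hτ]
    · exact (hlt τ hτ h).le
  refine hm.1.2 k hk ⟨fun H hH => payoff_mono hr hH.2 (.of_forall fun s _ => by rw [hflow]) hle,
    Measure.dirac t, ⟨inferInstance, by simpa using ht⟩, ?_⟩
  have hhead := (hm.hasRealPayoff hr hF hG).discountedIntegral_eq t
  rw [discountedIntegral] at hhead
  rw [payoff, payoff, erealIntegral_dirac, erealIntegral_dirac, hflow, hhead]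
  exact EReal.add_lt_add_left_coe (coe_mul_lt_coe_mul (Real.exp_pos _) (hlt t ht hne)) _

/-- The disclosure reward, capped at `u`. -/
def cappedReward (u : ℝ≥0) (m : Mechanism) (t : ℝ) : ℝ := (min (m.reward t) u).toReal

lemma ofReal_cappedReward (u : ℝ≥0) (m : Mechanism) (t : ℝ) :
    ENNReal.ofReal (cappedReward u m t) = min (m.reward t) u :=
  ENNReal.ofReal_toReal ((min_le_right _ _).trans_lt ENNReal.coe_lt_top).ne

lemma cappedReward_mem_Icc (u : ℝ≥0) (m : Mechanism) (t : ℝ) :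
    cappedReward u m t ∈ Icc 0 (u : ℝ) :=
  ⟨ENNReal.toReal_nonneg, ENNReal.toReal_mono ENNReal.coe_ne_top (min_le_right _ _)⟩

lemma IsIC.ofReal_exp_mul_leastPromise_le (hr : 0 < r) (hm : IsIC r m) {x : ℝ → ℝ}
    (hx : IsBoundedMeasurable x) (hx0 : ∀ t, 0 ≤ x t)
    (hflow : ∀ᵐ t, 0 < t → (m.flow t : ℝ) = x t) {u : ℝ≥0} {p : ℝ} (hup : u ≤ p) {t : ℝ}
    (ht : 0 ≤ t) :
    ENNReal.ofReal (exp (r * t) * leastPromise r p x (cappedReward u m) t)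
      ≤ max (m.reward t) u := by
  rcases eq_or_ne (m.reward t) ⊤ with htop | htop
  · rw [htop, max_eq_left le_top]
    exact le_top
  have hmax : max (m.reward t) u ≠ ⊤ := (max_lt htop.lt_top ENNReal.coe_lt_top).ne
  set R := (max (m.reward t) u).toReal
  have hR : ENNReal.ofReal R = max (m.reward t) u := ENNReal.ofReal_toReal hmax
  suffices h : leastPromise r p x (cappedReward u m) t ≤ exp (-r * t) * R by
    rw [← hR]
    refine ENNReal.ofReal_le_ofReal ((mul_le_mul_of_nonneg_left h (Real.exp_nonneg _)).trans_eq ?_)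
    rw [← mul_assoc, exp_mul_exp_neg, one_mul]
  refine leastPromise_le hr (fun s => (cappedReward_mem_Icc u m s).2) hup
    (ENNReal.toReal_mono hmax (le_max_right _ _)) fun s hts => ?_
  refine (ENNReal.ofReal_le_ofReal_iff (by positivity)).1 ?_
  rw [ENNReal.ofReal_add (sub_nonneg.2 (antitone_tailValue hr hx hx0 hts.le))
      (mul_nonneg (Real.exp_nonneg _) (cappedReward_mem_Icc u m s).1),
    ENNReal.ofReal_mul (Real.exp_nonneg _), ENNReal.ofReal_mul (Real.exp_nonneg _), hR,
    ofReal_cappedReward]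
  calc _ ≤ ENNReal.ofReal (tailValue r x t - tailValue r x s)
        + ENNReal.ofReal (exp (-r * s)) * m.reward s := by gcongr; exact min_le_left _ _
    _ ≤ ENNReal.ofReal (exp (-r * t)) * m.reward t := ((isIC_iff hr hx hflow).1 hm t ht).1 s hts
    _ ≤ ENNReal.ofReal (exp (-r * t)) * max (m.reward t) u := by gcongr; exact le_max_left _ _

lemma IsOptimal.reward_eq_leastPromise (hr : 0 < r) (hF : IsTechnology F0 F1 u0 u1)
    (hG : IsUnboundedDistribution G) (hm : IsOptimal r F0 F1 G m) {x : ℝ → ℝ}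
    (hx : IsBoundedMeasurable x) (hx_mem : ∀ t, x t ∈ Icc 0 (u0 : ℝ))
    (hflow : ∀ᵐ t, 0 < t → (m.flow t : ℝ) = x t) {t : ℝ} (ht : 0 ≤ t) :
    m.reward t = ENNReal.ofReal (exp (r * t) * leastPromise r u0 x (cappedReward u1 m) t) := by
  have hu : (u1 : ℝ) ≤ u0 := NNReal.coe_le_coe.2 hF.conflict.le
  have hN : ∀ t, cappedReward u1 m t ∈ Icc 0 (u0 : ℝ) := fun t =>
    Icc_subset_Icc_right hu (cappedReward_mem_Icc u1 m t)
  have hN_le : ∀ t, cappedReward u1 m t ≤ u0 := fun t => (hN t).2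
  have hx_le : ∀ t, x t ≤ u0 := fun t => (hx_mem t).2
  have hexp : ∀ t a, exp (r * t) * (exp (-r * t) * a) = a := fun t a => by
    rw [← mul_assoc, exp_mul_exp_neg, one_mul]
  set P := leastPromise r u0 x (cappedReward u1 m)
  let k : Mechanism := ⟨m.flow, m.measurable_flow, fun t => ENNReal.ofReal (exp (r * t) * P t)⟩
  have hk : IsIC r k := isIC_of_le hr hx hflow (fun _ _ => rfl)
    (fun s t _ hst => (leastPromise_sub_mem hr hx hx_le hN_le hst.le).1)
    fun t _ => tailValue_le_leastPromise hr hx hx_le hN t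
  refine hm.reward_eq hr hF hG hk rfl (fun _ _ => rfl) (fun s _ => ?_) (fun s hs => ?_)
    (fun s hs => hm.1.1.ofReal_exp_mul_leastPromise_le hr hx (fun t => (hx_mem t).1) hflow hu hs) ht
  · refine Real.toNNReal_le_iff_le_coe.2 ?_
    rw [← hexp s u0, mul_comm (exp (-r * s))]
    exact mul_le_mul_of_nonneg_left (leastPromise_le_peak hN_le s) (Real.exp_nonneg _)
  · rw [← ofReal_cappedReward, ← hexp s (cappedReward u1 m s)]
    exact ENNReal.ofReal_le_ofReal
      (mul_le_mul_of_nonneg_left (le_leastPromise hN_le hs) (Real.exp_nonneg _))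

lemma IsOptimal.tailValue_eq_leastPromise (hr : 0 < r) (hF : IsTechnology F0 F1 u0 u1)
    (hG : IsUnboundedDistribution G) (hm : IsOptimal r F0 F1 G m) {x : ℝ → ℝ}
    (hx : IsBoundedMeasurable x) (hx_mem : ∀ t, x t ∈ Icc 0 (u0 : ℝ))
    (hflow : ∀ᵐ t, 0 < t → (m.flow t : ℝ) = x t) {t : ℝ} (ht : 0 ≤ t) :
    tailValue r x t = leastPromise r u0 x (cappedReward u1 m) t := by
  have hN : ∀ t, cappedReward u1 m t ∈ Icc 0 (u0 : ℝ) := fun t =>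
    Icc_subset_Icc_right (NNReal.coe_le_coe.2 hF.conflict.le) (cappedReward_mem_Icc u1 m t)
  have hx_le : ∀ t, x t ≤ u0 := fun t => (hx_mem t).2
  have hreward : ∀ t : ℝ, 0 ≤ t → _ := fun t ht =>
    hm.reward_eq_leastPromise hr hF hG hx hx_mem hflow ht
  have hsub : ∀ s t, s ≤ t → _ := fun s t hst =>
    leastPromise_sub_mem hr hx hx_le (fun t => (hN t).2) hst
  set P := leastPromise r u0 x (cappedReward u1 m)
  obtain ⟨z, hz, hz_mem, hzP⟩ := exists_tailValue_eq hr (p := u0) (P := P)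
    (fun s t hst => by
      linarith [(hsub s t hst).1, antitone_tailValue hr hx (fun t => (hx_mem t).1) hst])
    (fun s t hst => by linarith [(hsub s t hst).2]) (tendsto_leastPromise hr hx hx_le hN)
  have hxz : ∀ᵐ t, 0 < t → x t ≤ z t := ae_forall_Ioi_of_forall_Ioo fun b =>
    ae_le_of_tailValue_sub_le hr hx hz fun s t _ hst _ => by
      rw [hzP, hzP]
      exact (hsub s t hst.le).1
  let k : Mechanism := ⟨fun t => (z t).toNNReal, hz.measurable.real_toNNReal.aemeasurable, m.reward⟩
  have hk_flow : ∀ t, (k.flow t : ℝ) = z t := fun t => Real.coe_toNNReal _ (hz_mem t).1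
  have hk : IsIC r k := isIC_of_le hr hz (.of_forall fun s _ => hk_flow s) hreward
    (fun s t _ _ => by rw [hzP, hzP]) fun t _ => (hzP t).le
  have heq := hm.flow_eq_of_eq_or_lt hr hF hG hk (k := k) ?_ rfl
  · rw [← hzP t]
    refine tailValue_congr_ae ?_
    filter_upwards [heq, hflow] with s h_eq h_flow hs
    rw [← h_flow (ht.trans_lt hs), ← hk_flow, h_eq (ht.trans_lt hs)]
  · filter_upwards [hflow, hxz] with t h_flow h_le ht
    have hmk : m.flow t ≤ k.flow t := by
      rw [← NNReal.coe_le_coe, h_flow ht, hk_flow]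
      exact h_le ht
    have hku : k.flow t ≤ u0 := Real.toNNReal_le_iff_le_coe.2 (hz_mem t).2
    exact hmk.eq_or_lt.imp_right fun h =>
      hF.frontier0.lt_of_between (.inl ⟨h, hku⟩) (hF.F0_ne_bot (zero_le.trans_lt h) hku)

lemma IsOptimal.reward_eq_promisedValue (hr : 0 < r) (hF : IsTechnology F0 F1 u0 u1)
    (hG : IsUnboundedDistribution G) (hm : IsOptimal r F0 F1 G m) {x : ℝ → ℝ}
    (hx : IsBoundedMeasurable x) (hx_mem : ∀ t, x t ∈ Icc 0 (u0 : ℝ))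
    (hflow : ∀ᵐ t, 0 < t → (m.flow t : ℝ) = x t) {t : ℝ} (ht : 0 ≤ t) :
    m.reward t = ENNReal.ofReal (promisedValue r x t) := by
  rw [hm.reward_eq_leastPromise hr hF hG hx hx_mem hflow ht,
    ← hm.tailValue_eq_leastPromise hr hF hG hx hx_mem hflow ht, promisedValue]

end Binding

section Reduction

variable {r : ℝ} {F0 F1 : ℝ≥0 → EReal} {u0 u1 : ℝ≥0} {G G' : Measure ℝ} {m : Mechanism}

lemma IsTechnology.isRealFrontier0 (hF : IsTechnology F0 F1 u0 u1) :
    IsRealFrontier u0 (effectiveDomain F0 u0) (realValue F0) :=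
  hF.frontier0.concave.isRealFrontier_effectiveDomain hF.frontier0.lt_top fun _ => hF.F0_ne_bot

lemma IsTechnology.isRealFrontier1 (hF : IsTechnology F0 F1 u0 u1) :
    IsRealFrontier u0 (effectiveDomain F1 u0) (realValue F1) :=
  hF.frontier1.concave.isRealFrontier_effectiveDomain hF.frontier1.lt_top fun _ => hF.F1_ne_bot

lemma measure_Ioi_pos_of_not_bddAbove_support (h : ¬ BddAbove G.support) (t : ℝ) :
    0 < G (Ioi t) := by
  obtain ⟨s, hs, hts⟩ := not_bddAbove_iff.1 h t
  exact (Measure.mem_support_iff_forall s).1 hs _ (Ioi_mem_nhds hts)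

lemma IsDistribution.ae_mem_Ici (hG : IsDistribution G) : ∀ᵐ τ ∂G, τ ∈ Ici (0 : ℝ) := by
  rw [← compl_Iio]
  exact measure_eq_zero_iff_ae_notMem.1 hG.2

lemma IsDistribution.isUnboundedDistribution (hG : IsDistribution G) (hac : G ≪ volume)
    (htail : ∀ t, 0 < G (Ioi t)) : IsUnboundedDistribution G :=
  ⟨hG.1, hG.2, ⟨fun _ => hac Real.volume_singleton⟩, htail⟩

lemma MLRDominates.absolutelyContinuous (h : MLRDominates G G') : G ≪ volume ∧ G' ≪ volume := by
  obtain ⟨g, g', -, -, rfl, rfl, -⟩ := h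
  exact ⟨withDensity_absolutelyContinuous _ _, withDensity_absolutelyContinuous _ _⟩

lemma MLRDominates.measure_Ioi_le (h : MLRDominates G G') (hG : IsDistribution G)
    (hG' : IsDistribution G') (t : ℝ) : G' (Ioi t) ≤ G (Ioi t) := by
  have := hG.1
  have := hG'.1
  have hanti : Antitone ((Iic t).indicator (1 : ℝ → ℝ≥0∞)) := fun a b hab =>
    indicator_apply_le' (fun hb => (indicator_of_mem (mem_Iic.2 (hab.trans hb)) 1).ge)
      fun _ => zero_le
  have hle := h.lintegral_le (measurable_one.indicator measurableSet_Iic) (hanti.antitoneOn (Ici 0))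
  rw [Measure.restrict_eq_self_of_ae_mem hG.ae_mem_Ici,
    Measure.restrict_eq_self_of_ae_mem hG'.ae_mem_Ici, lintegral_indicator_one measurableSet_Iic,
    lintegral_indicator_one measurableSet_Iic,
    (mem_ae_iff_prob_eq_one measurableSet_Ici).1 hG.ae_mem_Ici,
    (mem_ae_iff_prob_eq_one measurableSet_Ici).1 hG'.ae_mem_Ici, mul_one, mul_one] at hle
  rw [← compl_Iic, prob_compl_eq_one_sub measurableSet_Iic, prob_compl_eq_one_sub measurableSet_Iic]
  exact tsub_le_tsub_left hle 1

lemma IsOptimal.promisedValue_mem (hr : 0 < r) (hF : IsTechnology F0 F1 u0 u1)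
    (hG : IsUnboundedDistribution G) (hm : IsOptimal r F0 F1 G m) {x : ℝ → ℝ}
    (hx : IsBoundedMeasurable x) (hx_mem : ∀ t, x t ∈ Icc 0 (u0 : ℝ))
    (hreward : ∀ t, 0 ≤ t → m.reward t = ENNReal.ofReal (promisedValue r x t)) {t : ℝ}
    (ht : 0 ≤ t) : promisedValue r x t ∈ effectiveDomain F1 u0 := by
  have hnonneg : ∀ t, 0 ≤ tailValue r x t := fun t =>
    tailValue_nonneg hr (.of_forall fun s _ => (hx_mem s).1)
  have hmem : promisedValue r x t ∈ Icc 0 (u0 : ℝ) := by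
    refine ⟨mul_nonneg (Real.exp_nonneg _) (hnonneg t), ?_⟩
    rw [← promisedValue_const hr u0 t]
    exact mul_le_mul_of_nonneg_left (tailValue_mono hr hx (.const _)
      (.of_forall fun s _ => (hx_mem s).2)) (Real.exp_nonneg _)
  refine ⟨hmem, ?_⟩
  rcases hmem.1.eq_or_lt with h | h
  · -- If the agent is promised `0` at `t`, then also at the later dates, some of which `G` charges.
    have htail : tailValue r x t = 0 := by rw [tailValue_eq_exp_mul_promisedValue, ← h, mul_zero]
    have hfreq : ∃ᵐ τ ∂G, t < τ := frequently_ae_iff.2 (hG.tail_pos t).ne'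
    obtain ⟨τ, hτ, hbot⟩ :=
      (hfreq.and_eventually (hm.hasRealPayoff hr hF hG).reward_ne_bot).exists
    have hτ0 : tailValue r x τ = 0 :=
      ((antitone_tailValue hr hx (fun t => (hx_mem t).1) hτ.le).trans_eq htail).antisymm (hnonneg τ)
    rw [hreward τ (ht.trans hτ.le), promisedValue, hτ0, mul_zero, ENNReal.ofReal_zero] at hbot
    rw [← h, Real.toNNReal_zero, ← extendFrontier_coe F1]
    exact hbot
  · exact hF.F1_ne_bot (Real.toNNReal_pos.2 h) (Real.toNNReal_le_iff_le_coe.2 hmem.2)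

lemma IsOptimal.exists_isOptimalFlow (hr : 0 < r) (hF : IsTechnology F0 F1 u0 u1)
    (hG : IsUnboundedDistribution G) (hm : IsOptimal r F0 F1 G m) :
    ∃ x, IsOptimalFlow r (effectiveDomain F0 u0) (effectiveDomain F1 u0) (realValue F0)
        (realValue F1) G x ∧
      ∀ t, 0 ≤ t → m.reward t = ENNReal.ofReal (promisedValue r x t) := by
  obtain ⟨x, hx, hx_mem, hflow⟩ := hm.exists_flow hr hF hG
  have hx_Icc : ∀ t, x t ∈ Icc 0 (u0 : ℝ) := fun t => (hx_mem t).1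
  have hreward : ∀ t, 0 ≤ t → m.reward t = ENNReal.ofReal (promisedValue r x t) := fun t ht =>
    hm.reward_eq_promisedValue hr hF hG hx hx_Icc hflow ht
  refine ⟨x, ⟨hx, hx_mem, fun t ht => hm.promisedValue_mem hr hF hG hx hx_Icc hreward ht,
    fun y q j hy hq hj hy0 hy1 h0 h1 => ?_⟩, hreward⟩
  refine hm.deviation_nonpos hr hF hG
    (isIC_valueMechanism hr hy fun t ht => (hy0 t ht).1.1) hq hj ?_ ?_
  · filter_upwards [hflow] with t h_flow ht
    have h : ((realValue F0 (x t) + q t : ℝ) : EReal) ≤ realValue F0 (y t) :=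
      EReal.coe_le_coe_iff.2 (h0 t ht)
    rwa [coe_realValue hF.frontier0.lt_top (hy0 t ht), realValue, ← h_flow ht,
      Real.toNNReal_coe] at h
  · filter_upwards [hG.ae_nonneg] with τ hτ
    have h := EReal.coe_le_coe_iff.2 (h1 τ hτ)
    rw [coe_realValue hF.frontier1.lt_top (hy1 τ hτ)] at h
    rw [hreward τ hτ]
    exact h

end Reduction

end Breakthrough

end

theorem mainTheorem7_general (r : ℝ) (hr : 0 < r) (F0 F1 : ℝ≥0 → EReal) (u0 u1 : ℝ≥0)
    (hF : Breakthrough.IsTechnology F0 F1 u0 u1)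
    (hF0 : Breakthrough.IsStrictlyConcave F0)
    (G G' : Measure ℝ)
    (hG : Breakthrough.IsDistribution G) (hG' : Breakthrough.IsDistribution G')
    (hunb : ¬ BddAbove G'.support)
    (hMLR : Breakthrough.MLRDominates G G')
    (m m' : Breakthrough.Mechanism)
    (hm : Breakthrough.IsOptimal r F0 F1 G m)
    (hm' : Breakthrough.IsOptimal r F0 F1 G' m') :
    ∀ t : ℝ, 0 ≤ t → m'.reward t ≤ m.reward t := by
  intro t ht
  have htail' := Breakthrough.measure_Ioi_pos_of_not_bddAbove_support hunb
  have htail : ∀ s, 0 < G (Ioi s) := fun s => (htail' s).trans_le (hMLR.measure_Ioi_le hG hG' s)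
  have hGu := hG.isUnboundedDistribution hMLR.absolutelyContinuous.1 htail
  have hGu' := hG'.isUnboundedDistribution hMLR.absolutelyContinuous.2 htail'
  obtain ⟨x, hx, hmx⟩ := hm.exists_isOptimalFlow hr hF hGu
  obtain ⟨x', hx', hmx'⟩ := hm'.exists_isOptimalFlow hr hF hGu'
  rw [hmx t ht, hmx' t ht]
  exact ENNReal.ofReal_le_ofReal (hx.promisedValue_le hr hF.isRealFrontier0 hF.isRealFrontier1
    (hF0.strictConcaveOn_realValue hF.frontier0.concave hF.frontier0.lt_top)
    hF.frontier0.monotoneOn_realValue hGu hGu' hMLR hx' ht)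

theorem mainTheorem7 (r : ℝ) (hr : 0 < r) (F0 F1 : ℝ≥0 → EReal) (u0 u1 : ℝ≥0)
    (hF : Breakthrough.IsTechnology F0 F1 u0 u1)
    (hF0 : Breakthrough.IsStrictlyConcave F0)
    (G G' : Measure ℝ)
    (hG : Breakthrough.IsDistribution G) (hG' : Breakthrough.IsDistribution G')
    (hGac : G ≪ volume) (hG'ac : G' ≪ volume)
    (hsupp : G.support = G'.support) (hunb : ¬ BddAbove G.support)
    (hMLR : Breakthrough.MLRDominates G G')
    (m m' : Breakthrough.Mechanism)
    (hm : Breakthrough.IsOptimal r F0 F1 G m)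
    (hm' : Breakthrough.IsOptimal r F0 F1 G' m') :
    ∀ t : ℝ, 0 ≤ t → m'.reward t ≤ m.reward t := by
  exact mainTheorem7_general r hr F0 F1 u0 u1 hF hF0 G G' hG hG' (hsupp ▸ hunb) hMLR m m' hm hm'
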